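/- A coloring $\chi$ is a partition of the Euclidean plane $\mathbb{R}^2$ into a set $\mathfrak B$ of black points and a set $\mathfrak W$ of white points; its boundary is the common topological boundary of $\mathfrak B$ and $\mathfrak W$. A set is monochromatic if it is contained in $\mathfrak B$ or in $\mathfrak W$. A unit triangle is a triple of points with pairwise distances $1$; a coloring avoids the unit triangle if no unit triangle is monochromatic. A coloring $\chi'$ is a twin of $\chi$ if both have the same boundary and give the same colors to all points outside this boundary. A coloring is polygonal if (i) each of $\mathfrak B,\mathfrak W$ is contained in the closure of its interior; (ii) the boundary is a union of nondegenerate closed straight segments (bounded segments, half-lines or lines) such that any two distinct ones intersect only at common endpoints; (iii) every bounded subset of the plane is met by only finitely many of these segments. A coloring is zebra-like if its boundary is the disjoint union of simple continuous curves $\mathcal L_i$, $i\in\mathbb Z$, for which there are orthogonal unit vectors $\vec x,\vec y$ such that for every $i$: (a) $\mathcal L_i+\vec x=\mathcal L_i$; (b) $\mathcal L_{i+1}=\mathcal L_i+\frac12\vec x+\frac{\sqrt3}{2}\vec y$; (c) the interior of the region delimited by $\mathcal L_i\cup\mathcal L_{i+1}$ is all of one color, and the interior of the region delimited by $\mathcal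 L_{i-1}\cup\mathcal L_i$ is all of the other color; (d) for all $A\in\mathcal L_i$ and $B\in\mathcal L_{i+1}$, $\|AB\|>1$ if and only if $\theta_{AB}<\frac{\pi}{3}$, where $\theta_{AB}\in[0,\frac{\pi}{2}]$ is the angle between the line $AB$ and the direction $\vec x$. Theorem. For a polygonal coloring $\chi$ the following conditions are equivalent: (C1) $\chi$ is zebra-like. (C2) $\chi$ has a twin $\chi'$ that avoids the unit triangle. (C3) For every monochromatic unit triangle $ABC$, at least one of the points $A,B,C$ belongs to the boundary of $\chi$. -/

import Mathlib

/-- The Euclidean plane. -/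
abbrev Plane : Type := EuclideanSpace ℝ (Fin 2)

/-- A coloring: a partition of the plane into black and white points. -/
structure PlaneColoring where
  black : Set Plane
  white : Set Plane
  disjoint : Disjoint black white
  cover : black ∪ white = Set.univ

/-- A nondegenerate straight segment, possibly unbounded: a closed bounded segment with end
points `a`, `b`; a closed half-line with origin `a` and direction `v`; or a whole line. -/
inductive StraightSegment where
  | bounded (a b : Plane) (hab : a ≠ b) : StraightSegment
  | halfLine (a v : Plane) (hv : v ≠ 0) : StraightSegment
  | line (a v : Plane) (hv : v ≠ 0) : StraightSegment

/-- The set of points of a straight segment. -/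
def StraightSegment.carrier : StraightSegment → Set Plane
  | .bounded a b _ => segment ℝ a b
  | .halfLine a v _ => {p | ∃ t : ℝ, 0 ≤ t ∧ p = a + t • v}
  | .line a v _ => {p | ∃ t : ℝ, p = a + t • v}

/-- The set of endpoints of a straight segment. -/
def StraightSegment.endpoints : StraightSegment → Set Plane
  | .bounded a b _ => {a, b}
  | .halfLine a _ _ => {a}
  | .line _ _ _ => ∅

/-- The acute angle (in `[0, π / 2]`) between the lines spanned by two nonzero vectors. -/
noncomputable def acuteAngle (v w : Plane) : ℝ :=
  min (InnerProductGeometry.angle v w) (Real.pi - InnerProductGeometry.angle v w)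

/-- The (open) region delimited by `K ∪ L`: the points of the complement of `K ∪ L` whose
connected component in that complement is bordered by all of `K` and all of `L`. If `K` and `L`
are disjoint lines that are properly embedded in the plane, this is the open strip between
them. -/
def delimitedRegion (K L : Set Plane) : Set Plane :=
  {p | p ∉ K ∪ L ∧ frontier (connectedComponentIn (K ∪ L)ᶜ p) = K ∪ L}

/-- `A`, `B`, `C` are the vertices of an equilateral triangle with sides of length one. -/
def IsUnitTriangle (A B C : Plane) : Prop :=
  dist A B = 1 ∧ dist B C = 1 ∧ dist C A = 1

namespace PlaneColoring

/-- The common boundary of the black set and the white set. -/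
def boundary (χ : PlaneColoring) : Set Plane :=
  frontier χ.black ∩ frontier χ.white

/-- All points of `X` have the same color. -/
def Monochromatic (χ : PlaneColoring) (X : Set Plane) : Prop :=
  X ⊆ χ.black ∨ X ⊆ χ.white

/-- No unit triangle is monochromatic. -/
def AvoidsUnitTriangle (χ : PlaneColoring) : Prop :=
  ¬ ∃ A B C : Plane, IsUnitTriangle A B C ∧ χ.Monochromatic {A, B, C}

/-- `χ'` is a twin of `χ`: both have the same boundary and the same colors outside of it. -/
def IsTwin (χ' χ : PlaneColoring) : Prop :=
  χ'.boundary = χ.boundary ∧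
    ∀ p, p ∉ χ.boundary → (p ∈ χ'.black ↔ p ∈ χ.black) ∧ (p ∈ χ'.white ↔ p ∈ χ.white)

/-- Polygonal colorings. Collinear segments that meet at a common endpoint need not be merged
into one; merging them does not change the class of colorings. -/
def IsPolygonal (χ : PlaneColoring) : Prop :=
  χ.black ⊆ closure (interior χ.black) ∧
  χ.white ⊆ closure (interior χ.white) ∧
  ∃ S : Set StraightSegment,
    χ.boundary = ⋃ s ∈ S, s.carrier ∧
    (∀ s ∈ S, ∀ t ∈ S, s ≠ t → s.carrier ∩ t.carrier ⊆ s.endpoints ∩ t.endpoints) ∧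
    ∀ R : Set Plane, Bornology.IsBounded R → {s ∈ S | (s.carrier ∩ R).Nonempty}.Finite

/-- Zebra-like colorings. The curve with index `i` is the range of `γ i`. -/
def IsZebraLike (χ : PlaneColoring) : Prop :=
  ∃ (γ : ℤ → ℝ → Plane) (L : ℤ → Set Plane) (x y : Plane),
    (∀ i, Continuous (γ i) ∧ Function.Injective (γ i) ∧ L i = Set.range (γ i)) ∧
    (∀ i j, i ≠ j → Disjoint (L i) (L j)) ∧
    χ.boundary = ⋃ i, L i ∧
    ‖x‖ = 1 ∧ ‖y‖ = 1 ∧ inner ℝ x y = 0 ∧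
    (∀ i, (fun p => p + x) '' L i = L i) ∧
    (∀ i, L (i + 1) =
      (fun p => p + ((1 / 2 : ℝ) • x + (Real.sqrt 3 / 2 : ℝ) • y)) '' L i) ∧
    (∀ i,
      (delimitedRegion (L i) (L (i + 1)) ⊆ χ.black ∧
        delimitedRegion (L (i - 1)) (L i) ⊆ χ.white) ∨
      (delimitedRegion (L i) (L (i + 1)) ⊆ χ.white ∧
        delimitedRegion (L (i - 1)) (L i) ⊆ χ.black)) ∧
    (∀ i, ∀ A ∈ L i, ∀ B ∈ L (i + 1),
      1 < dist A B ↔ acuteAngle (B - A) x < Real.pi / 3)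

end PlaneColoring

open Set Filter Topology

namespace TwoColoring

/-! ### Plane vectors as complex numbers -/

/-! The substance is that (C3) implies (C1). In complex coordinates let `P` and `N` be the interiors
of the two classes. By (C3) neither contains a unit triangle; polygonality gives that the boundary
lies in both closures and is, near each point, a finite union of rays (`ConicColoring`).

Let `A` be a boundary point. As `A` can be pushed into either class, two points of the unit circle
about `A` that are sixty degrees apart never lie in the same open class
(`ConicColoring.rot_notMem`). So the color changes on this circle (crossings) come in hexagons. When
`A` slides along the boundary, the vertices of a hexagon must slide along the boundary as well, and
`rigidity` leaves only finitely many candidates for a nonzero turn of the hexagon. Hence crossing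
directions are locally constant along the boundary (`ConicColoring.switch_locally_constant`), and a
crossing `u` carries the directions of the boundary at `A` to those at `A + u` (`Crossing.dirs_eq`).
Two directions at `A` lie on opposite sides of the normal line of every crossing, and there are at
least two of them. Some crossing of the hexagon makes an angle of less than thirty degrees with the
boundary (`Crossing.exists_near`). Turn the plane so that it is `1`: the boundary at `A` is then one
ray to the right and one to the left, of slope below `1 / √3`, and continues to the graph of a
function on the whole line (`ConicColoring.exists_branch`), a component of the boundary.

Small motions of a triangle with vertices on three parallel pieces of the boundary show that the
translation by `1` keeps the colors on the sides and the translation by `rot` swaps them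
(`ConicColoring.sided_triangle`). A branch equals its translate by `1` or is disjoint from it, and
the latter is impossible (`Branch.not_lt_translate`), so it is periodic. A boundary component
between a branch and its `rot`-translate would be bounded in height, hence again a horizontal
branch, and `Branch.not_between` excludes it. So the boundary consists of the translates of one
branch by multiples of `rot`. As no unit circle about a point of it changes color strictly between 0
and 60 degrees, or between 60 and 120, consecutive curves have points more than a unit apart exactly
if the abscissas differ by more than `1 / 2` (`Branch.one_lt_iff`). The angle condition in (d) means
the same (`Profile.flat_iff`).

For (C1) implies (C2), condition (d) forces the curves to be graphs (`exists_profile`). The twin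
colors the half-open strips alternately. Sides of a unit triangle that join strips of equal parity
obey constraints on their horizontal projections which three sides cannot meet together
(`InStrip.not_even_triangle`). (C2) implies (C3) because twins agree off the boundary. -/

/-- The inner product of two plane vectors. -/
def dot (z w : ℂ) : ℝ := z.re * w.re + z.im * w.im

/-- The determinant of two plane vectors. -/
def cross (z w : ℂ) : ℝ := z.re * w.im - z.im * w.re

/-- The unit vector with polar angle `t`. -/
noncomputable def cis (t : ℝ) : ℂ := ⟨Real.cos t, Real.sin t⟩

/-- The rotation by sixty degrees. -/
noncomputable def rot : ℂ := ⟨1 / 2, Real.sqrt 3 / 2⟩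

@[simp] lemma cis_re (t : ℝ) : (cis t).re = Real.cos t := rfl
@[simp] lemma cis_im (t : ℝ) : (cis t).im = Real.sin t := rfl
@[simp] lemma rot_re : rot.re = 1 / 2 := rfl
@[simp] lemma rot_im : rot.im = Real.sqrt 3 / 2 := rfl

lemma sqrt_three_sq : Real.sqrt 3 * Real.sqrt 3 = 3 := Real.mul_self_sqrt (by norm_num)

lemma sqrt_three_pos : 0 < Real.sqrt 3 := by positivity

lemma sqrt_three_bounds : 17 / 10 < Real.sqrt 3 ∧ Real.sqrt 3 < 18 / 10 := by
  constructor <;> nlinarith [sqrt_three_sq, sqrt_three_pos]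

lemma norm_eq_one_iff {z : ℂ} : ‖z‖ = 1 ↔ z.re * z.re + z.im * z.im = 1 := by
  rw [← sq_eq_sq₀ (norm_nonneg z) zero_le_one, Complex.sq_norm, Complex.normSq_apply]
  norm_num

lemma norm_lt_iff {z : ℂ} {r : ℝ} (hr : 0 < r) :
    ‖z‖ < r ↔ z.re * z.re + z.im * z.im < r * r := by
  rw [← sq_lt_sq₀ (norm_nonneg z) hr.le, Complex.sq_norm, Complex.normSq_apply, sq r]

@[simp] lemma norm_cis (t : ℝ) : ‖cis t‖ = 1 := by
  rw [norm_eq_one_iff, cis_re, cis_im]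
  nlinarith [Real.sin_sq_add_cos_sq t]

@[simp] lemma norm_rot : ‖rot‖ = 1 := by
  rw [norm_eq_one_iff, rot_re, rot_im]
  nlinarith [sqrt_three_sq]

@[simp] lemma cis_zero : cis 0 = 1 := by
  apply Complex.ext <;> simp

lemma cis_add (a b : ℝ) : cis (a + b) = cis a * cis b := by
  apply Complex.ext
  · simp [Real.cos_add]
  · simp [Real.sin_add]; ring

lemma rot_eq_cis : rot = cis (Real.pi / 3) := by
  apply Complex.ext
  · simp
  · simp

lemma continuous_cis : Continuous cis := by
  have h : cis = fun t => ((Real.cos t : ℝ) : ℂ) + ((Real.sin t : ℝ) : ℂ) * Complex.I := by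
    funext t
    apply Complex.ext <;> simp [-Complex.ofReal_cos, -Complex.ofReal_sin]
  rw [h]
  fun_prop

lemma norm_cis_sub_one_le (t : ℝ) : ‖cis t - 1‖ ≤ |t| := by
  apply abs_le_of_sq_le_sq' _ (abs_nonneg t) |>.2
  rw [Complex.sq_norm, Complex.normSq_apply, sq_abs]
  simp only [Complex.sub_re, cis_re, Complex.one_re, Complex.sub_im, cis_im, Complex.one_im]
  nlinarith [Real.one_sub_sq_div_two_le_cos (x := t), Real.sin_sq_add_cos_sq t]

lemma eq_zero_of_cis_eq_one {t : ℝ} (ht : |t| < 3) (h : cis t = 1) : t = 0 := by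
  have h1 : Real.sin t = 0 := by simpa using congrArg Complex.im h
  have h3 := abs_lt.1 ht
  have := Real.pi_gt_three
  exact (Real.sin_eq_zero_iff_of_lt_of_lt (by linarith) (by linarith)).1 h1

lemma eq_zero_of_mul_cis_eq {u : ℂ} (hu : ‖u‖ = 1) {t : ℝ} (ht : |t| < 3) (h : u * cis t = u) :
    t = 0 := by
  apply eq_zero_of_cis_eq_one ht
  have hu0 : u ≠ 0 := by rintro rfl; simp at hu
  exact mul_left_cancel₀ hu0 (by rw [h, mul_one])

lemma norm_mul_cis_sub_le {u : ℂ} (hu : ‖u‖ = 1) (t : ℝ) : ‖u * cis t - u‖ ≤ |t| := by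
  have : u * cis t - u = u * (cis t - 1) := by ring
  rw [this, norm_mul, hu, one_mul]
  exact norm_cis_sub_one_le t

lemma rot_sq : rot * rot = rot - 1 := by
  apply Complex.ext
  · simp; nlinarith [sqrt_three_sq]
  · simp; ring

lemma rot_cube : rot * (rot * rot) = -1 := by
  rw [rot_sq, mul_sub, rot_sq]; ring

/-- The rigidity equations have at most one solution on the unit circle: if a point of a
line moves by `t • d`, and three neighbours at unit distance, in directions that differ by
sixty degrees, stay on three lines, then the rotation is determined. -/
lemma rigidity {u d ζ₁ ζ₂ e₀ e₁ e₂ : ℂ} {t₁ t₂ s₀ s₁ s₂ r₀ r₁ r₂ : ℝ}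
    (hu : ‖u‖ = 1) (hd : ‖d‖ = 1) (h1 : ζ₁ ≠ 0) (h2 : ζ₂ ≠ 0)
    (hu1 : ‖u + ζ₁‖ = 1) (hu2 : ‖u + ζ₂‖ = 1)
    (a0 : ζ₁ + t₁ * d = s₀ * e₀) (a1 : rot * ζ₁ + t₁ * d = s₁ * e₁)
    (a2 : rot * (rot * ζ₁) + t₁ * d = s₂ * e₂)
    (b0 : ζ₂ + t₂ * d = r₀ * e₀) (b1 : rot * ζ₂ + t₂ * d = r₁ * e₁)
    (b2 : rot * (rot * ζ₂) + t₂ * d = r₂ * e₂) : ζ₁ = ζ₂ := by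
  have key : ∀ (a b e : ℂ) (s r : ℝ), a = s * e → b = r * e →
      a.re * b.im - a.im * b.re = 0 := by
    rintro a b e s r rfl rfl
    simp; ring
  have c0 := key _ _ _ _ _ a0 b0
  have c1 := key _ _ _ _ _ a1 b1
  have c2 := key _ _ _ _ _ a2 b2
  rw [← mul_assoc, rot_sq] at c2
  rw [← mul_assoc, rot_sq] at c2
  rw [norm_eq_one_iff] at hu hd hu1 hu2
  obtain ⟨x₁, y₁⟩ := ζ₁
  obtain ⟨x₂, y₂⟩ := ζ₂
  obtain ⟨p, q⟩ := d
  obtain ⟨m, n⟩ := u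
  simp only [Complex.add_re, Complex.add_im, Complex.mul_re, Complex.mul_im, Complex.ofReal_re,
    Complex.ofReal_im, rot_re, rot_im, Complex.sub_re, Complex.sub_im, Complex.one_re,
    Complex.one_im, zero_mul, sub_zero, add_zero] at c0 c1 c2 hu hd hu1 hu2
  have hs := sqrt_three_sq
  have hp := sqrt_three_pos
  generalize Real.sqrt 3 = σ at *
  -- With `w = t₂ • ζ₁ - t₁ • ζ₂ = (a, b)`, the three collinearities read `X + cross (rotᵏ * w) d =
  -- 0` for `k = 0, 1, 2`. Since `rot² = rot - 1`, subtracting the last two gives `cross w d = 0`,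
  -- so `X = 0` and `ζ₁`, `ζ₂` are parallel.
  obtain ⟨X, hX⟩ : ∃ X, X = x₁ * y₂ - y₁ * x₂ := ⟨_, rfl⟩
  obtain ⟨a, ha⟩ : ∃ a, a = t₂ * x₁ - t₁ * x₂ := ⟨_, rfl⟩
  obtain ⟨b, hb⟩ : ∃ b, b = t₂ * y₁ - t₁ * y₂ := ⟨_, rfl⟩
  have e0 : X + (a * q - b * p) = 0 := by rw [hX, ha, hb]; linarith
  have e1 : X + ((a / 2 - σ / 2 * b) * q - (b / 2 + σ / 2 * a) * p) = 0 := by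
    rw [hX, ha, hb]
    linear_combination c1 - (x₁ * y₂ - y₁ * x₂) / 4 * hs
  have e2 : X + ((-a / 2 - σ / 2 * b) * q - (-b / 2 + σ / 2 * a) * p) = 0 := by
    rw [hX, ha, hb]
    linear_combination c2 - (x₁ * y₂ - y₁ * x₂) / 4 * hs
  have f0 : a * q - b * p = 0 := by linear_combination e1 - e2
  have f1 : a * p + b * q = 0 := by
    have : σ * (a * p + b * q) = 0 := by linear_combination 2 * e0 - 2 * e1 - f0
    rcases mul_eq_zero.1 this with h | h
    · exact absurd h hp.ne'
    · exact h
  have hX0 : X = 0 := by linarith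
  have g1 : 2 * (m * x₁ + n * y₁) = -(x₁ * x₁ + y₁ * y₁) := by linarith
  have g2 : 2 * (m * x₂ + n * y₂) = -(x₂ * x₂ + y₂ * y₂) := by linarith
  have hn1 : x₁ * x₁ + y₁ * y₁ ≠ 0 := by
    intro h
    apply h1
    apply Complex.ext
    · exact (mul_self_add_mul_self_eq_zero.1 h).1
    · exact (mul_self_add_mul_self_eq_zero.1 h).2
  have hn2 : x₂ * x₂ + y₂ * y₂ ≠ 0 := by
    intro h
    apply h2
    apply Complex.ext
    · exact (mul_self_add_mul_self_eq_zero.1 h).1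
    · exact (mul_self_add_mul_self_eq_zero.1 h).2
  -- Now `ζ₂ = c • ζ₁`. The circle `‖u + ζ‖ = 1` passes through `ζ = 0`, and a line through `0`
  -- meets it in at most one further point, so `c = 1`.
  obtain ⟨c, hc⟩ : ∃ c, c = (x₁ * x₂ + y₁ * y₂) / (x₁ * x₁ + y₁ * y₁) := ⟨_, rfl⟩
  have hc' : c * (x₁ * x₁ + y₁ * y₁) = x₁ * x₂ + y₁ * y₂ := by
    rw [hc, div_mul_cancel₀ _ hn1]
  have hx2 : x₂ = c * x₁ := by
    apply mul_right_cancel₀ hn1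
    linear_combination (-y₁) * hX0 + y₁ * hX - x₁ * hc'
  have hy2 : y₂ = c * y₁ := by
    apply mul_right_cancel₀ hn1
    linear_combination x₁ * hX0 - x₁ * hX - y₁ * hc'
  have hc1 : c * (c - 1) * (x₁ * x₁ + y₁ * y₁) = 0 := by
    rw [hx2, hy2] at g2
    linear_combination g2 - c * g1
  have hc0 : c ≠ 0 := by
    intro h
    apply hn2
    rw [hx2, hy2, h]; ring
  have : c = 1 := by
    rcases mul_eq_zero.1 hc1 with h | h
    · rcases mul_eq_zero.1 h with h | h
      · exact absurd h hc0
      · linarith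
    · exact absurd h hn1
  rw [hx2, hy2, this]
  simp

/-! ### Colorings with locally conic boundary -/

/-- The complement of the union of two open color classes. -/
def bdry (P N : Set ℂ) : Set ℂ := (P ∪ N)ᶜ

/-- Two disjoint open color classes, without unit triangles, whose complement is contained in the
closure of both of them and is, near every point, a finite union of rays. -/
structure ConicColoring (P N : Set ℂ) : Prop where
  isOpen_left : IsOpen P
  isOpen_right : IsOpen N
  disj : Disjoint P N
  left_dense : bdry P N ⊆ closure P
  right_dense : bdry P N ⊆ closure N
  conic : ∀ p : ℂ, ∃ D : Set ℂ, D.Finite ∧ (∀ d ∈ D, ‖d‖ = 1) ∧ ∃ r > 0, ∀ z : ℂ, ‖z‖ < r →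
    (p + z ∈ bdry P N ↔ ∃ d ∈ D, ∃ t : ℝ, 0 ≤ t ∧ z = t * d)
  noTriangle_left : ∀ A u : ℂ, ‖u‖ = 1 → A ∈ P → A + u ∈ P → A + rot * u ∉ P
  noTriangle_right : ∀ A u : ℂ, ‖u‖ = 1 → A ∈ N → A + u ∈ N → A + rot * u ∉ N

lemma bdry_comm (P N : Set ℂ) : bdry P N = bdry N P := by
  rw [bdry, bdry, union_comm]

lemma ConicColoring.swap {P N : Set ℂ} (h : ConicColoring P N) : ConicColoring N P where
  isOpen_left := h.isOpen_right
  isOpen_right := h.isOpen_left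
  disj := h.disj.symm
  left_dense := by rw [bdry_comm]; exact h.right_dense
  right_dense := by rw [bdry_comm]; exact h.left_dense
  conic := by rw [bdry_comm]; exact h.conic
  noTriangle_left := h.noTriangle_right
  noTriangle_right := h.noTriangle_left

lemma notMem_bdry {P N : Set ℂ} {p : ℂ} : p ∉ bdry P N ↔ p ∈ P ∨ p ∈ N := by
  simp only [bdry, mem_compl_iff, not_not, mem_union]

/-- The directions of the rays contained in `E` near `p`. -/
def dirs (E : Set ℂ) (p : ℂ) : Set ℂ :=
  {d | ‖d‖ = 1 ∧ ∃ r > 0, ∀ t : ℝ, 0 < t → t < r → p + t * d ∈ E}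

lemma norm_ofReal_mul_unit {d : ℂ} (hd : ‖d‖ = 1) {t : ℝ} (ht : 0 ≤ t) : ‖(t : ℂ) * d‖ = t := by
  rw [norm_mul, hd, mul_one, Complex.norm_real, Real.norm_of_nonneg ht]

lemma unit_eq_of_mul_eq {d e : ℂ} (hd : ‖d‖ = 1) (he : ‖e‖ = 1) {s t : ℝ} (hs : 0 < s)
    (ht : 0 ≤ t) (h : (s : ℂ) * d = t * e) : s = t ∧ d = e := by
  have h1 : s = t := by
    rw [← norm_ofReal_mul_unit hd hs.le, ← norm_ofReal_mul_unit he ht, h]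
  refine ⟨h1, ?_⟩
  subst h1
  exact mul_left_cancel₀ (by exact_mod_cast hs.ne') h

variable {P N : Set ℂ}

lemma ConicColoring.isClosed_bdry (h : ConicColoring P N) : IsClosed (bdry P N) :=
  (h.isOpen_left.union h.isOpen_right).isClosed_compl

lemma ConicColoring.notMem_of_mem (h : ConicColoring P N) {p : ℂ} (hp : p ∈ P) : p ∉ N :=
  fun hn => h.disj.le_bot ⟨hp, hn⟩

/-- The finite set of rays in `conic` is determined by the boundary: it is `dirs`. This makes the
directions at different points comparable. -/
lemma ConicColoring.exists_conic (h : ConicColoring P N) (p : ℂ) :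
    (dirs (bdry P N) p).Finite ∧ ∃ r > 0, ∀ z : ℂ, ‖z‖ < r →
      (p + z ∈ bdry P N ↔ ∃ d ∈ dirs (bdry P N) p, ∃ t : ℝ, 0 ≤ t ∧ z = t * d) := by
  obtain ⟨D, hD, hD1, r, hr, hrD⟩ := h.conic p
  have hE : dirs (bdry P N) p = D := by
    ext d
    constructor
    · rintro ⟨hd, r', hr', hd'⟩
      have hm : 0 < min r r' / 2 := by positivity
      have hmr : min r r' / 2 < r := by linarith [min_le_left r r']
      have hmr' : min r r' / 2 < r' := by linarith [min_le_right r r', lt_min hr hr']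
      have h1 := hd' _ hm hmr'
      obtain ⟨e, he, t, ht, h2⟩ := (hrD _ (by rwa [norm_ofReal_mul_unit hd hm.le])).1 h1
      rw [(unit_eq_of_mul_eq hd (hD1 e he) hm ht h2).2]
      exact he
    · intro hd
      refine ⟨hD1 d hd, r, hr, fun t ht htr => ?_⟩
      exact (hrD _ (by rwa [norm_ofReal_mul_unit (hD1 d hd) ht.le])).2 ⟨d, hd, t, ht.le, rfl⟩
  rw [hE]
  exact ⟨hD, r, hr, hrD⟩

lemma exists_pos_forall_norm_lt_notMem {Z : Set ℂ} (hZ : Z.Finite) {p : ℂ} (hp : p ∉ Z) :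
    ∃ r > 0, ∀ z, ‖z - p‖ < r → z ∉ Z := by
  obtain ⟨r, hr, h⟩ := Metric.isOpen_iff.1 hZ.isClosed.isOpen_compl p hp
  exact ⟨r, hr, fun z hz => h (by rwa [Metric.mem_ball, dist_eq_norm])⟩

/-- The boundary meets a unit circle in a discrete set. -/
lemma ConicColoring.exists_arc_free (h : ConicColoring P N) (A : ℂ) {u : ℂ} (hu : ‖u‖ = 1) :
    ∃ ε > 0, ∀ ψ : ℝ, ψ ≠ 0 → |ψ| < ε → A + u * cis ψ ∉ bdry P N := by
  obtain ⟨hD, r, hr, hrD⟩ := h.exists_conic (A + u)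
  set D := dirs (bdry P N) (A + u)
  -- A line through `u` with direction `d` meets the unit circle in at most one further point, `u -
  -- 2 (dot u d) d`. So `Z` is a finite set that misses `u`.
  set Z : Set ℂ := {w | ‖w‖ = 1 ∧ w ≠ u ∧ ∃ d ∈ D, ∃ t : ℝ, w - u = t * d} with hZ
  have hZf : Z.Finite := by
    apply (hD.image fun d => u + ((-2 * dot u d : ℝ) : ℂ) * d).subset
    rintro w ⟨hw, hwu, d, hd, t, ht⟩
    refine ⟨d, hd, ?_⟩
    have hd1 : ‖d‖ = 1 := hd.1
    have hw' : w = u + t * d := by rw [← ht]; ring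
    have ht0 : t ≠ 0 := by
      rintro rfl
      exact hwu (by simpa using hw')
    have : t = -2 * dot u d := by
      rw [hw'] at hw
      rw [norm_eq_one_iff] at hw hu hd1
      simp only [Complex.add_re, Complex.add_im, Complex.mul_re, Complex.mul_im,
        Complex.ofReal_re, Complex.ofReal_im, zero_mul, sub_zero, add_zero] at hw
      have h2 : t * (t + 2 * dot u d) = 0 := by
        rw [dot]; linear_combination hw - hu - t ^ 2 * hd1
      rcases mul_eq_zero.1 h2 with h2 | h2
      · exact absurd h2 ht0
      · linarith
    show u + ((-2 * dot u d : ℝ) : ℂ) * d = w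
    rw [hw', ← this]
  obtain ⟨δ, hδ, hδZ⟩ := exists_pos_forall_norm_lt_notMem hZf (p := u) (fun hu => hu.2.1 rfl)
  refine ⟨min (min r δ) 1, by positivity, fun ψ hψ hψε hmem => ?_⟩
  have h1 : |ψ| < r := hψε.trans_le ((min_le_left _ _).trans (min_le_left _ _))
  have h2 : |ψ| < δ := hψε.trans_le ((min_le_left _ _).trans (min_le_right _ _))
  have h3 : |ψ| < 1 := hψε.trans_le (min_le_right _ _)
  have hle := norm_mul_cis_sub_le hu ψ
  have hmem' : A + u + (u * cis ψ - u) ∈ bdry P N := by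
    convert hmem using 1; ring
  obtain ⟨d, hd, t, -, ht⟩ := (hrD _ (hle.trans_lt h1)).1 hmem'
  refine hδZ (u * cis ψ) (hle.trans_lt h2) ⟨by simp [hu], ?_, d, hd, t, ht⟩
  intro he
  exact hψ (eq_zero_of_mul_cis_eq hu (by linarith) he)

/-- A preconnected set that avoids the boundary and meets `P` lies in `P`. -/
lemma ConicColoring.subset_of_isPreconnected (h : ConicColoring P N) {S : Set ℂ}
    (hS : IsPreconnected S) (hSb : Disjoint S (bdry P N)) {p : ℂ} (hp : p ∈ S) (hpP : p ∈ P) :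
    S ⊆ P := by
  refine hS.subset_left_of_subset_union h.isOpen_left h.isOpen_right h.disj ?_ ⟨p, hp, hpP⟩
  intro q hq
  by_contra hq'
  exact hSb.le_bot ⟨hq, hq'⟩

/-! ### Color changes on unit circles about boundary points -/

/-- The unit circle about `A`, traversed counterclockwise, passes at `A + u` from `P` to `N`. -/
def Switch (P N : Set ℂ) (A u : ℂ) : Prop :=
  ‖u‖ = 1 ∧ ∃ ε > 0, ∀ ψ : ℝ, 0 < ψ → ψ < ε → A + u * cis (-ψ) ∈ P ∧ A + u * cis ψ ∈ N

lemma continuous_arc (A u : ℂ) : Continuous fun ψ => A + u * cis ψ :=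
  continuous_const.add (continuous_const.mul continuous_cis)

lemma ConicColoring.arc_subset (h : ConicColoring P N) {A u : ℂ} {a b : ℝ}
    (hab : ∀ ψ ∈ Ioo a b, A + u * cis ψ ∉ bdry P N) {c : ℝ} (hc : c ∈ Ioo a b)
    (hcP : A + u * cis c ∈ P) : ∀ ψ ∈ Ioo a b, A + u * cis ψ ∈ P := by
  intro ψ hψ
  have hS : IsPreconnected ((fun ψ => A + u * cis ψ) '' Ioo a b) :=
    isPreconnected_Ioo.image _ (continuous_arc A u).continuousOn
  refine h.subset_of_isPreconnected hS ?_ ⟨c, hc, rfl⟩ hcP ⟨ψ, hψ, rfl⟩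
  rw [Set.disjoint_left]
  rintro _ ⟨θ, hθ, rfl⟩
  exact hab θ hθ

/-- If a unit circle has a point of `P` and, further on, a point of `N`, then somewhere in between
it switches from `P` to `N`. -/
lemma ConicColoring.exists_switch (h : ConicColoring P N) {A u : ℂ} (hu : ‖u‖ = 1) {a b : ℝ}
    (hab : a < b) (ha : A + u * cis a ∈ P) (hb : A + u * cis b ∈ N) :
    ∃ ψ ∈ Ioo a b, Switch P N A (u * cis ψ) := by
  set g := fun ψ => A + u * cis ψ with hg
  have hgc : Continuous g := continuous_arc A u
  set S : Set ℝ := {ψ | ψ ∈ Icc a b ∧ g ψ ∈ P} with hS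
  have hSne : S.Nonempty := ⟨a, ⟨le_rfl, hab.le⟩, ha⟩
  have hSb : BddAbove S := ⟨b, fun ψ hψ => hψ.1.2⟩
  -- The supremum `c` of the parameters in `P` belongs to neither open class. Near it the circle
  -- meets the boundary nowhere else, so the arc just before `c`, which contains points of `P`, lies
  -- in `P`, and the arc just after it in `N`.
  set c := sSup S with hc
  have hac : a ≤ c := le_csSup hSb ⟨⟨le_rfl, hab.le⟩, ha⟩
  have hcb : c ≤ b := csSup_le hSne fun ψ hψ => hψ.1.2
  have hafter : ∀ ψ, c < ψ → ψ ≤ b → g ψ ∉ P := fun ψ h1 h2 h3 =>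
    absurd (le_csSup hSb ⟨⟨hac.trans h1.le, h2⟩, h3⟩) (not_le.2 h1)
  have hPo : IsOpen (g ⁻¹' P) := h.isOpen_left.preimage hgc
  have hNo : IsOpen (g ⁻¹' N) := h.isOpen_right.preimage hgc
  have hcP : g c ∉ P := by
    intro hcP
    have hcb' : c ≠ b := by
      rintro h1
      rw [h1] at hcP
      exact h.notMem_of_mem hcP hb
    obtain ⟨ε, hε, hball⟩ := Metric.isOpen_iff.1 hPo c hcP
    have hcb'' := lt_of_le_of_ne hcb hcb'
    obtain ⟨ψ, h1, h2⟩ := exists_between (lt_min hcb'' (lt_add_of_pos_right c hε))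
    refine hafter ψ h1 (h2.le.trans (min_le_left _ _)) (hball ?_)
    rw [Metric.mem_ball, Real.dist_eq, abs_lt]
    constructor <;> linarith [h2.trans_le (min_le_right _ _)]
  have hac' : a < c := lt_of_le_of_ne hac (by rintro h1; exact hcP (h1 ▸ ha))
  have hcN : g c ∉ N := by
    intro hcN
    obtain ⟨ε, hε, hball⟩ := Metric.isOpen_iff.1 hNo c hcN
    obtain ⟨ψ, h1, h2⟩ := exists_lt_of_lt_csSup hSne (show c - ε < sSup S by rw [← hc]; linarith)
    have h3 : ψ ≤ c := le_csSup hSb h1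
    refine h.notMem_of_mem h1.2 (hball ?_)
    rw [Metric.mem_ball, Real.dist_eq, abs_lt]
    constructor <;> linarith
  have hcb' : c < b := lt_of_le_of_ne hcb (by rintro h1; exact hcN (h1 ▸ hb))
  have hu' : ‖u * cis c‖ = 1 := by simp [hu]
  obtain ⟨ε, hε, hfree⟩ := h.exists_arc_free A hu'
  have hfree' : ∀ ψ, ψ ≠ c → |ψ - c| < ε → g ψ ∉ bdry P N := by
    intro ψ h1 h2
    have := hfree (ψ - c) (sub_ne_zero.2 h1) h2
    rwa [mul_assoc, ← cis_add, add_sub_cancel] at this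
  set η := min ε (min (c - a) (b - c)) with hη
  have hη0 : 0 < η := lt_min hε (lt_min (by linarith) (by linarith))
  have hηε : η ≤ ε := min_le_left _ _
  have hη2 : η ≤ b - c := (min_le_right _ _).trans (min_le_right _ _)
  have hleft : ∀ ψ ∈ Ioo (c - η) c, g ψ ∈ P := by
    obtain ⟨ψ, h1, h2⟩ := exists_lt_of_lt_csSup hSne (show c - η < sSup S by rw [← hc]; linarith)
    have h3 : ψ ≤ c := le_csSup hSb h1
    have h4 : ψ ≠ c := by rintro rfl; exact hcP h1.2
    refine h.arc_subset (fun θ hθ => hfree' θ hθ.2.ne ?_) ⟨h2, lt_of_le_of_ne h3 h4⟩ h1.2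
    rw [abs_lt]
    constructor <;> linarith [hθ.1, hθ.2]
  have hright : ∀ ψ ∈ Ioo c (c + η), g ψ ∈ N := by
    intro ψ hψ
    have h1 := hfree' ψ hψ.1.ne' (by rw [abs_lt]; constructor <;> linarith [hψ.1, hψ.2])
    rcases notMem_bdry.1 h1 with h2 | h2
    · exact absurd h2 (hafter ψ hψ.1 (by linarith [hψ.2]))
    · exact h2
  refine ⟨c, ⟨hac', hcb'⟩, hu', η, hη0, fun ψ h1 h2 => ⟨?_, ?_⟩⟩
  · have := hleft (c - ψ) ⟨by linarith, by linarith⟩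
    rwa [mul_assoc, ← cis_add, ← sub_eq_add_neg]
  · have := hright (c + ψ) ⟨by linarith, by linarith⟩
    rwa [mul_assoc, ← cis_add]

lemma mem_bdry_comm {A : ℂ} (hA : A ∈ bdry P N) : A ∈ bdry N P := by
  rwa [bdry_comm]

lemma exists_translate_mem {U : Set ℂ} (hU : IsOpen U) {A w : ℂ} (h : A + w ∈ U) :
    ∃ δ > 0, ∀ A' : ℂ, ‖A' - A‖ < δ → A' + w ∈ U := by
  obtain ⟨δ, hδ, hb⟩ := Metric.isOpen_iff.1 hU _ h
  refine ⟨δ, hδ, fun A' hA' => hb ?_⟩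
  rw [Metric.mem_ball, dist_eq_norm, add_sub_add_right_eq_sub]
  exact hA'

/-- Over a boundary point, two points of the unit circle at an angular distance of sixty degrees
are not in the same open class. -/
lemma ConicColoring.rot_notMem (h : ConicColoring P N) {A w : ℂ} (hA : A ∈ bdry P N)
    (hw : ‖w‖ = 1) (hwP : A + w ∈ P) : A + rot * w ∉ P := by
  intro hwP'
  obtain ⟨δ, hδ, h1⟩ := exists_translate_mem h.isOpen_left hwP
  obtain ⟨δ', hδ', h2⟩ := exists_translate_mem h.isOpen_left hwP'
  -- Membership of the two outer vertices in `P` is stable, so the triangle can be translated until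
  -- its vertex at `A` enters `P` as well.
  obtain ⟨A', hA', hd⟩ := Metric.mem_closure_iff.1 (h.left_dense hA) (min δ δ') (lt_min hδ hδ')
  rw [dist_comm, dist_eq_norm] at hd
  exact h.noTriangle_left A' w hw hA' (h1 A' (hd.trans_le (min_le_left _ _)))
    (h2 A' (hd.trans_le (min_le_right _ _)))

lemma Switch.mem_bdry (h : ConicColoring P N) {A u : ℂ} (hs : Switch P N A u) :
    A + u ∈ bdry P N := by
  obtain ⟨hu, ε, hε, hs⟩ := hs
  by_contra hmem
  rcases notMem_bdry.1 hmem with hm | hm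
  · obtain ⟨δ, hδ, hb⟩ := Metric.isOpen_iff.1 h.isOpen_left _ hm
    have hpos : 0 < min ε δ / 2 := by positivity
    have h1 := (hs (min ε δ / 2) hpos (by linarith [min_le_left ε δ])).2
    refine h.notMem_of_mem (hb ?_) h1
    rw [Metric.mem_ball, dist_eq_norm]
    have := norm_mul_cis_sub_le hu (min ε δ / 2)
    rw [abs_of_pos hpos] at this
    rw [add_sub_add_left_eq_sub]
    linarith [min_le_right ε δ]
  · obtain ⟨δ, hδ, hb⟩ := Metric.isOpen_iff.1 h.isOpen_right _ hm
    have hpos : 0 < min ε δ / 2 := by positivity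
    have h1 := (hs (min ε δ / 2) hpos (by linarith [min_le_left ε δ])).1
    refine h.notMem_of_mem h1 (hb ?_)
    rw [Metric.mem_ball, dist_eq_norm]
    have := norm_mul_cis_sub_le hu (-(min ε δ / 2))
    rw [abs_neg, abs_of_pos hpos] at this
    rw [add_sub_add_left_eq_sub]
    linarith [min_le_right ε δ]

lemma Switch.not_swap (h : ConicColoring P N) {A u : ℂ} (hs : Switch P N A u) :
    ¬ Switch N P A u := by
  rintro ⟨-, δ, hδ, hs'⟩
  obtain ⟨-, ε, hε, hs⟩ := hs
  have hpos : 0 < min ε δ / 2 := by positivity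
  exact h.notMem_of_mem (hs _ hpos (by linarith [min_le_left ε δ])).1
    (hs' _ hpos (by linarith [min_le_right ε δ])).1

/-- Turning by sixty degrees reverses colors on the circle about a boundary point, off the boundary:
`P` before `u` and `N` after it become `N` before `rot * u` and `P` after it. -/
lemma Switch.rot (h : ConicColoring P N) {A u : ℂ} (hA : A ∈ bdry P N)
    (hs : Switch P N A u) : Switch N P A (rot * u) := by
  obtain ⟨hu, ε, hε, hs⟩ := hs
  have hru : ‖TwoColoring.rot * u‖ = 1 := by simp [hu]
  obtain ⟨δ, hδ, hfree⟩ := h.exists_arc_free A hru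
  refine ⟨hru, min ε δ, lt_min hε hδ, fun ψ h0 h1 => ?_⟩
  have hε' := h1.trans_le (min_le_left _ _)
  have hδ' := h1.trans_le (min_le_right _ _)
  obtain ⟨hP, hN⟩ := hs ψ h0 hε'
  constructor
  · have h2 := h.rot_notMem hA (by simp [hu]) hP
    rw [← mul_assoc] at h2
    exact (notMem_bdry.1 (hfree (-ψ) (by linarith) (by rwa [abs_neg, abs_of_pos h0]))).resolve_left
      h2
  · have h2 := h.swap.rot_notMem (mem_bdry_comm hA) (by simp [hu]) hN
    rw [← mul_assoc] at h2
    exact (notMem_bdry.1 (hfree ψ h0.ne' (by rwa [abs_of_pos h0]))).resolve_right h2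

/-- The unit circle about `A` changes its color at `A + u`. -/
def Crossing (P N : Set ℂ) (A u : ℂ) : Prop := Switch P N A u ∨ Switch N P A u

lemma Crossing.swap {A u : ℂ} (hc : Crossing P N A u) : Crossing N P A u := Or.symm hc

lemma Crossing.norm_eq {A u : ℂ} (hc : Crossing P N A u) : ‖u‖ = 1 := by
  rcases hc with hc | hc <;> exact hc.1

lemma Crossing.mem_bdry (h : ConicColoring P N) {A u : ℂ} (hc : Crossing P N A u) :
    A + u ∈ bdry P N := by
  rcases hc with hc | hc
  · exact hc.mem_bdry h
  · exact mem_bdry_comm (hc.mem_bdry h.swap)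

lemma Crossing.rot (h : ConicColoring P N) {A u : ℂ} (hA : A ∈ bdry P N)
    (hc : Crossing P N A u) : Crossing P N A (rot * u) := by
  rcases hc with hc | hc
  · exact Or.inr (hc.rot h hA)
  · exact Or.inl (hc.rot h.swap (mem_bdry_comm hA))

lemma Crossing.neg (h : ConicColoring P N) {A u : ℂ} (hA : A ∈ bdry P N)
    (hc : Crossing P N A u) : Crossing P N A (-u) := by
  have h3 := ((hc.rot h hA).rot h hA).rot h hA
  have : TwoColoring.rot * (TwoColoring.rot * (TwoColoring.rot * u)) = -u := by
    rw [← mul_assoc, ← mul_assoc, mul_assoc TwoColoring.rot, rot_cube, neg_one_mul]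
  rwa [this] at h3

/-- Some `w` close to `1` is such that neither `w` nor `rot * w` leads to the boundary. Their colors
differ, so the color changes on the arc between them. -/
lemma ConicColoring.exists_crossing (h : ConicColoring P N) {A : ℂ} (hA : A ∈ bdry P N) :
    ∃ u, Crossing P N A u := by
  obtain ⟨ε, hε, h1⟩ := h.exists_arc_free A (u := 1) (by simp)
  obtain ⟨δ, hδ, h2⟩ := h.exists_arc_free A (u := rot) (by simp)
  have hpos : 0 < min ε δ / 2 := by positivity
  have h1' := h1 (min ε δ / 2) hpos.ne' (by rw [abs_of_pos hpos]; linarith [min_le_left ε δ])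
  have h2' := h2 (min ε δ / 2) hpos.ne' (by rw [abs_of_pos hpos]; linarith [min_le_right ε δ])
  rw [one_mul] at h1'
  set w := cis (min ε δ / 2) with hw
  have hw1 : ‖w‖ = 1 := norm_cis _
  have hpi : (0 : ℝ) < Real.pi / 3 := by positivity
  rcases notMem_bdry.1 h1' with h3 | h3
  · have h4 := (notMem_bdry.1 h2').resolve_left (h.rot_notMem hA hw1 h3)
    obtain ⟨ψ, -, hψ⟩ := h.exists_switch (A := A) hw1 hpi (by simpa using h3)
      (by rw [← rot_eq_cis, mul_comm]; exact h4)
    exact ⟨_, Or.inl hψ⟩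
  · have h4 := (notMem_bdry.1 h2').resolve_right
      (h.swap.rot_notMem (mem_bdry_comm hA) hw1 h3)
    obtain ⟨ψ, -, hψ⟩ := h.swap.exists_switch (A := A) hw1 hpi (by simpa using h3)
      (by rw [← rot_eq_cis, mul_comm]; exact h4)
    exact ⟨_, Or.inr hψ⟩

/-! ### Crossings are locally constant along the boundary -/

/-- The directions of crossings over boundary points near `A` cannot accumulate at a direction
without being equal to it. -/
lemma ConicColoring.crossing_isolated (h : ConicColoring P N) (A : ℂ) {u : ℂ} (hu : ‖u‖ = 1) :
    ∃ r > 0, ∀ A' ∈ bdry P N, ‖A' - A‖ < r → ∀ ψ : ℝ, |ψ| < r →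
      Crossing P N A' (u * cis ψ) → ψ = 0 := by
  obtain ⟨hD, R, hR, hRD⟩ := h.exists_conic A
  obtain ⟨hD0, R0, hR0, hRD0⟩ := h.exists_conic (A + u)
  obtain ⟨hD1, R1, hR1, hRD1⟩ := h.exists_conic (A + rot * u)
  obtain ⟨hD2, R2, hR2, hRD2⟩ := h.exists_conic (A + rot * (rot * u))
  set D := dirs (bdry P N) A
  set D0 := dirs (bdry P N) (A + u)
  set D1 := dirs (bdry P N) (A + rot * u)
  set D2 := dirs (bdry P N) (A + rot * (rot * u))
  -- The nonzero changes `ζ` of the crossing direction for which, after some displacement `t • d` of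
  -- `A`, three consecutive vertices of the hexagon still lie on boundary lines through their old
  -- positions. By `rigidity` each choice of lines admits at most one `ζ`, so `Z` is finite and
  -- small changes are excluded.
  set Z : Set ℂ := ⋃ d ∈ D, ⋃ e0 ∈ D0, ⋃ e1 ∈ D1, ⋃ e2 ∈ D2,
    {ζ | ζ ≠ 0 ∧ ‖u + ζ‖ = 1 ∧ ∃ t s0 s1 s2 : ℝ, ζ + t * d = s0 * e0 ∧
      rot * ζ + t * d = s1 * e1 ∧ rot * (rot * ζ) + t * d = s2 * e2} with hZ
  have hZf : Z.Finite := by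
    refine hD.biUnion fun d hd => hD0.biUnion fun e0 _ => hD1.biUnion fun e1 _ =>
      hD2.biUnion fun e2 _ => Set.Subsingleton.finite ?_
    rintro ζ₁ ⟨h1, hu1, t₁, s0, s1, s2, a0, a1, a2⟩ ζ₂ ⟨h2, hu2, t₂, r0, r1, r2, b0, b1, b2⟩
    exact rigidity hu hd.1 h1 h2 hu1 hu2 a0 a1 a2 b0 b1 b2
  have hZ0 : (0 : ℂ) ∉ Z := by
    intro h0
    simp only [hZ, mem_iUnion] at h0
    obtain ⟨d, -, e0, -, e1, -, e2, -, h0, -⟩ := h0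
    exact h0 rfl
  obtain ⟨δ, hδ, hδZ⟩ := exists_pos_forall_norm_lt_notMem hZf hZ0
  obtain ⟨r, hr, hrR, hr0, hr1, hr2, hrδ, hr3⟩ : ∃ r > 0, r ≤ R ∧ r ≤ R0 / 2 ∧ r ≤ R1 / 2 ∧
      r ≤ R2 / 2 ∧ r ≤ δ ∧ r ≤ 1 := by
    refine ⟨min R (min (R0 / 2) (min (R1 / 2) (min (R2 / 2) (min δ 1)))), by positivity, ?_⟩
    simp
  refine ⟨r, hr, fun A' hA' hAA ψ hψ hc => ?_⟩
  by_contra hψ0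
  have hle := norm_mul_cis_sub_le hu ψ
  set ζ := u * cis ψ - u with hζ
  have hζr : ‖ζ‖ < r := hle.trans_lt hψ
  have hζ0 : ζ ≠ 0 := fun h0 =>
    hψ0 (eq_zero_of_mul_cis_eq hu (by linarith) (sub_eq_zero.1 h0))
  have hA'' : A + (A' - A) ∈ bdry P N := by simpa using hA'
  obtain ⟨d, hd, t, -, ht⟩ := (hRD _ (hAA.trans_le hrR)).1 hA''
  have hnorm : ∀ c : ℂ, ‖c‖ = 1 → ‖c * ζ + t * d‖ < r + r := by
    intro c hc1
    rw [← ht]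
    refine (norm_add_le _ _).trans_lt (add_lt_add ?_ hAA)
    rwa [norm_mul, hc1, one_mul]
  have k0 : A + u + (1 * ζ + t * d) ∈ bdry P N := by
    convert hc.mem_bdry h using 1
    rw [← ht, hζ]; ring
  have k1 : A + rot * u + (rot * ζ + t * d) ∈ bdry P N := by
    convert (hc.rot h hA').mem_bdry h using 1
    rw [← ht, hζ]; ring
  have k2 : A + rot * (rot * u) + (rot * rot * ζ + t * d) ∈ bdry P N := by
    convert ((hc.rot h hA').rot h hA').mem_bdry h using 1
    rw [← ht, hζ]; ring
  obtain ⟨e0, he0, s0, -, hs0⟩ := (hRD0 _ ((hnorm 1 (by simp)).trans_le (by linarith))).1 k0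
  obtain ⟨e1, he1, s1, -, hs1⟩ := (hRD1 _ ((hnorm rot (by simp)).trans_le (by linarith))).1 k1
  obtain ⟨e2, he2, s2, -, hs2⟩ := (hRD2 _ ((hnorm (rot * rot) (by simp)).trans_le
    (by linarith))).1 k2
  refine hδZ ζ (by rw [sub_zero]; linarith) ?_
  simp only [hZ, mem_iUnion]
  refine ⟨d, hd, e0, he0, e1, he1, e2, he2, hζ0, ?_, t, s0, s1, s2, by rw [← hs0, one_mul],
    hs1, by rw [← hs2, mul_assoc]⟩
  rw [hζ, add_sub_cancel]
  simp [hu]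

/-- A point of `P` before `u` and one of `N` after it persist for nearby `A'`. So the circle about
`A'` switches in between, and isolation puts this switch exactly at `u`. -/
lemma Switch.eventually (h : ConicColoring P N) {A u : ℂ} (hs : Switch P N A u) :
    ∃ r > 0, ∀ A' ∈ bdry P N, ‖A' - A‖ < r → Switch P N A' u := by
  obtain ⟨hu, ε, hε, hs⟩ := hs
  obtain ⟨r, hr, hiso⟩ := h.crossing_isolated A hu
  have hpos : 0 < min ε r / 2 := by positivity
  obtain ⟨h1, h2⟩ := hs _ hpos (by linarith [min_le_left ε r])
  obtain ⟨δ₁, hδ₁, g1⟩ := exists_translate_mem h.isOpen_left h1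
  obtain ⟨δ₂, hδ₂, g2⟩ := exists_translate_mem h.isOpen_right h2
  refine ⟨min r (min δ₁ δ₂), by positivity, fun A' hA' hd => ?_⟩
  have hd1 : ‖A' - A‖ < r := hd.trans_le (min_le_left _ _)
  have hd2 : ‖A' - A‖ < δ₁ := hd.trans_le ((min_le_right _ _).trans (min_le_left _ _))
  have hd3 : ‖A' - A‖ < δ₂ := hd.trans_le ((min_le_right _ _).trans (min_le_right _ _))
  obtain ⟨ψ, hψ, hsw⟩ := h.exists_switch hu (show -(min ε r / 2) < min ε r / 2 by linarith)
    (g1 A' hd2) (g2 A' hd3)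
  have h0 := hiso A' hA' hd1 ψ
    (by rw [abs_lt]; constructor <;> linarith [hψ.1, hψ.2, min_le_right ε r]) (Or.inl hsw)
  rw [h0, cis_zero, mul_one] at hsw
  exact hsw

/-- If the points at angles `-s` and `s` from `u` on the circle about `A` had the wrong colors, the
circle about a nearby `A'` would have the same ones. Besides its switch at `u` it would have to
change color at a small nonzero angle, against isolation. -/
lemma ConicColoring.switch_of_near (h : ConicColoring P N) {A u : ℂ} (hA : A ∈ bdry P N)
    (hu : ‖u‖ = 1) :
    ∃ r > 0, ∀ A' ∈ bdry P N, ‖A' - A‖ < r → Switch P N A' u → Switch P N A u := by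
  obtain ⟨r, hr, hiso⟩ := h.crossing_isolated A hu
  obtain ⟨ε, hε, hfree⟩ := h.exists_arc_free A hu
  have hpos : 0 < min ε r / 2 := by positivity
  set s := min ε r / 2 with hs
  have hsε : s < ε := by linarith [min_le_left ε r]
  have hsr : s < r := by linarith [min_le_right ε r]
  have hf1 := hfree s hpos.ne' (by rwa [abs_of_pos hpos])
  have hf2 := hfree (-s) (by linarith) (by rwa [abs_neg, abs_of_pos hpos])
  have main : ∃ δ > 0, ∀ A' ∈ bdry P N, ‖A' - A‖ < δ → Switch P N A' u →
      A + u * cis (-s) ∈ P ∧ A + u * cis s ∈ N := by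
    rcases notMem_bdry.1 hf2 with h2 | h2
    · rcases notMem_bdry.1 hf1 with h1 | h1
      · obtain ⟨δ, hδ, hg⟩ := exists_translate_mem h.isOpen_left h1
        refine ⟨min δ r, lt_min hδ hr, fun A' hA' hd hsw => ?_⟩
        obtain ⟨-, η, hη, hsw⟩ := hsw
        have hpos' : 0 < min η s / 2 := by positivity
        have hlt : min η s / 2 < s := by linarith [min_le_right η s]
        have hn := (hsw _ hpos' (by linarith [min_le_left η s])).2
        obtain ⟨ψ, hψ, hsw'⟩ := h.swap.exists_switch hu hlt hn
          (hg A' (hd.trans_le (min_le_left _ _)))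
        have h0 := hiso A' hA' (hd.trans_le (min_le_right _ _)) ψ
          (by rw [abs_lt]; constructor <;> linarith [hψ.1, hψ.2]) (Or.inr hsw')
        linarith [hψ.1]
      · exact ⟨1, one_pos, fun _ _ _ _ => ⟨h2, h1⟩⟩
    · obtain ⟨δ, hδ, hg⟩ := exists_translate_mem h.isOpen_right h2
      refine ⟨min δ r, lt_min hδ hr, fun A' hA' hd hsw => ?_⟩
      obtain ⟨-, η, hη, hsw⟩ := hsw
      have hpos' : 0 < min η s / 2 := by positivity
      have hlt : min η s / 2 < s := by linarith [min_le_right η s]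
      have hp := (hsw _ hpos' (by linarith [min_le_left η s])).1
      obtain ⟨ψ, hψ, hsw'⟩ := h.swap.exists_switch hu (neg_lt_neg hlt)
        (hg A' (hd.trans_le (min_le_left _ _))) hp
      have h0 := hiso A' hA' (hd.trans_le (min_le_right _ _)) ψ
        (by rw [abs_lt]; constructor <;> linarith [hψ.1, hψ.2]) (Or.inr hsw')
      linarith [hψ.2]
  obtain ⟨δ, hδ, hmain⟩ := main
  refine ⟨δ, hδ, fun A' hA' hd hsw => ?_⟩
  obtain ⟨h2, h1⟩ := hmain A' hA' hd hsw
  obtain ⟨ψ, hψ, hsw'⟩ := h.exists_switch hu (show -s < s by linarith) h2 h1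
  have h0 := hiso A hA (by simpa using hr) ψ
    (by rw [abs_lt]; constructor <;> linarith [hψ.1, hψ.2]) (Or.inl hsw')
  rwa [h0, cis_zero, mul_one] at hsw'

/-- Along the boundary, the set of switches is locally constant. -/
lemma ConicColoring.switch_locally_constant (h : ConicColoring P N) {A u : ℂ}
    (hA : A ∈ bdry P N) : ∃ r > 0, ∀ A' ∈ bdry P N, ‖A' - A‖ < r →
      (Switch P N A' u ↔ Switch P N A u) := by
  by_cases hu : ‖u‖ = 1
  · obtain ⟨r, hr, h1⟩ := h.switch_of_near hA hu
    by_cases hs : Switch P N A u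
    · obtain ⟨r', hr', h2⟩ := hs.eventually h
      exact ⟨r', hr', fun A' hA' hd => ⟨fun _ => hs, fun _ => h2 A' hA' hd⟩⟩
    · exact ⟨r, hr, fun A' hA' hd => ⟨h1 A' hA' hd, fun h3 => absurd h3 hs⟩⟩
  · exact ⟨1, one_pos, fun A' _ _ => ⟨fun h1 => absurd h1.1 hu, fun h1 => absurd h1.1 hu⟩⟩

lemma ConicColoring.crossing_locally_constant (h : ConicColoring P N) {A u : ℂ}
    (hA : A ∈ bdry P N) : ∃ r > 0, ∀ A' ∈ bdry P N, ‖A' - A‖ < r →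
      (Crossing P N A' u ↔ Crossing P N A u) := by
  obtain ⟨r, hr, h1⟩ := h.switch_locally_constant (u := u) hA
  obtain ⟨r', hr', h2⟩ := h.swap.switch_locally_constant (u := u) (mem_bdry_comm hA)
  refine ⟨min r r', lt_min hr hr', fun A' hA' hd => ?_⟩
  exact or_congr (h1 A' hA' (hd.trans_le (min_le_left _ _)))
    (h2 A' (mem_bdry_comm hA') (hd.trans_le (min_le_right _ _)))

/-! ### Directions of the boundary -/

lemma dot_sq_add_cross_sq (z w : ℂ) :
    dot z w ^ 2 + cross z w ^ 2 = (z.re * z.re + z.im * z.im) * (w.re * w.re + w.im * w.im) := by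
  rw [dot, cross]; ring

lemma dot_sq_add_cross_sq_of_unit {z w : ℂ} (hz : ‖z‖ = 1) (hw : ‖w‖ = 1) :
    dot z w ^ 2 + cross z w ^ 2 = 1 := by
  rw [dot_sq_add_cross_sq, norm_eq_one_iff.1 hz, norm_eq_one_iff.1 hw, one_mul]

lemma dot_neg_right (z w : ℂ) : dot z (-w) = -dot z w := by simp [dot]; ring
lemma dot_neg_left (z w : ℂ) : dot (-z) w = -dot z w := by simp [dot]; ring
lemma cross_neg_left (z w : ℂ) : cross (-z) w = -cross z w := by simp [cross]; ring

lemma cross_mul_cis_sub (d u : ℂ) (ψ : ℝ) :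
    cross d (u * cis ψ - u) = cross d u * (Real.cos ψ - 1) + dot d u * Real.sin ψ := by
  simp [cross, dot]; ring

lemma dot_mul_cis_sub {u : ℂ} (hu : ‖u‖ = 1) (ψ : ℝ) :
    dot u (u * cis ψ - u) = Real.cos ψ - 1 := by
  rw [norm_eq_one_iff] at hu
  simp only [dot, Complex.sub_re, Complex.sub_im, Complex.mul_re, Complex.mul_im, cis_re, cis_im]
  linear_combination (Real.cos ψ - 1) * hu

lemma continuous_cross (d : ℂ) : Continuous (cross d) := by
  unfold cross; fun_prop

lemma continuous_dot (d : ℂ) : Continuous (dot d) := by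
  unfold dot; fun_prop

lemma abs_dot_sub_le {d : ℂ} (hd : ‖d‖ = 1) (z w : ℂ) : |dot d z - dot d w| ≤ ‖z - w‖ := by
  apply abs_le_of_sq_le_sq _ (norm_nonneg _)
  rw [Complex.sq_norm, Complex.normSq_apply]
  have h1 := dot_sq_add_cross_sq d (z - w)
  rw [norm_eq_one_iff.1 hd, one_mul] at h1
  have h2 : dot d z - dot d w = dot d (z - w) := by simp [dot]; ring
  rw [h2]
  linarith [sq_nonneg (cross d (z - w))]

lemma abs_dot_le {d z : ℂ} (hd : ‖d‖ = 1) : |dot d z| ≤ ‖z‖ := by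
  have := abs_dot_sub_le hd z 0
  simpa [dot] using this

lemma mem_ray_iff {e z : ℂ} (he : ‖e‖ = 1) :
    (∃ s : ℝ, 0 ≤ s ∧ z = s * e) ↔ cross e z = 0 ∧ 0 ≤ dot e z := by
  rw [norm_eq_one_iff] at he
  constructor
  · rintro ⟨s, hs, rfl⟩
    simp only [cross, dot, Complex.mul_re, Complex.mul_im, Complex.ofReal_re, Complex.ofReal_im,
      zero_mul, sub_zero, add_zero]
    constructor
    · ring
    · have : e.re * (s * e.re) + e.im * (s * e.im) = s := by linear_combination s * he
      rw [this]; exact hs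
  · rintro ⟨h1, h2⟩
    refine ⟨dot e z, h2, ?_⟩
    rw [cross] at h1
    apply Complex.ext
    · simp only [dot, Complex.mul_re, Complex.ofReal_re, Complex.ofReal_im, zero_mul, sub_zero]
      linear_combination (-z.re) * he - e.im * h1
    · simp only [dot, Complex.mul_im, Complex.ofReal_re, Complex.ofReal_im, zero_mul, add_zero]
      linear_combination (-z.im) * he + e.re * h1

/-! ### Straight points of the boundary and the colors on their sides -/

/-- Near `q`, the set `E` is a line with direction `d`. -/
def IsStraight (E : Set ℂ) (q d : ℂ) : Prop :=
  ∃ r > 0, ∀ z : ℂ, ‖z‖ < r → (q + z ∈ E ↔ cross d z = 0)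

/-- Near `q`, the points to the left of the line through `q` with direction `d` belong to `P` and
those to the right of it to `N`. -/
def Sided (P N : Set ℂ) (q d : ℂ) : Prop :=
  ∃ r > 0, ∀ z : ℂ, ‖z‖ < r → (0 < cross d z → q + z ∈ P) ∧ (cross d z < 0 → q + z ∈ N)

lemma Sided.neg {q d : ℂ} (hs : Sided P N q d) : Sided N P q (-d) := by
  obtain ⟨r, hr, hs⟩ := hs
  refine ⟨r, hr, fun z hz => ?_⟩
  rw [cross_neg_left]
  exact ⟨fun h1 => (hs z hz).2 (by linarith), fun h1 => (hs z hz).1 (by linarith)⟩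

lemma ConicColoring.dirs_nonempty (h : ConicColoring P N) {A : ℂ} (hA : A ∈ bdry P N) :
    (dirs (bdry P N) A).Nonempty := by
  obtain ⟨-, r, hr, hrD⟩ := h.exists_conic A
  obtain ⟨d, hd, -⟩ := (hrD 0 (by simpa using hr)).1 (by simpa using hA)
  exact ⟨d, hd⟩

/-- The other rays at `p` form a closed set that misses `p + t * d` for `t > 0`. So near that point
only the ray with direction `d` is left, and there it looks like a line. -/
lemma ConicColoring.isStraight_of_mem_dirs (h : ConicColoring P N) {p d : ℂ}
    (hd : d ∈ dirs (bdry P N) p) :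
    ∃ r > 0, ∀ t : ℝ, 0 < t → t < r →
      IsStraight (bdry P N) (p + t * d) d ∧ p + t * d ∈ bdry P N := by
  obtain ⟨hD, R, hR, hRD⟩ := h.exists_conic p
  have hd1 : ‖d‖ = 1 := hd.1
  refine ⟨R, hR, fun t ht htR => ?_⟩
  have hmem : p + t * d ∈ bdry P N :=
    (hRD _ (by rwa [norm_ofReal_mul_unit hd1 ht.le])).2 ⟨d, hd, t, ht.le, rfl⟩
  refine ⟨?_, hmem⟩
  set C : Set ℂ := ⋃ e ∈ dirs (bdry P N) p \ {d}, {z | ∃ s : ℝ, 0 ≤ s ∧ z = s * e} with hC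
  have hCc : IsClosed C := by
    refine (hD.subset sdiff_subset).isClosed_biUnion fun e he => ?_
    have : {z : ℂ | ∃ s : ℝ, 0 ≤ s ∧ z = s * e} = {z | cross e z = 0} ∩ {z | 0 ≤ dot e z} := by
      ext z
      exact mem_ray_iff he.1.1
    rw [this]
    exact (isClosed_eq (continuous_cross e) continuous_const).inter
      (isClosed_le continuous_const (continuous_dot e))
  have htC : (t : ℂ) * d ∉ C := by
    intro hm
    simp only [hC, mem_iUnion] at hm
    obtain ⟨e, he, s, hs, heq⟩ := hm
    exact he.2 (unit_eq_of_mul_eq hd1 he.1.1 ht hs heq).2.symm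
  obtain ⟨ε, hε, hball⟩ := Metric.isOpen_iff.1 hCc.isOpen_compl _ htC
  refine ⟨min ε (min t (R - t)), by have := sub_pos.2 htR; positivity, fun z hz => ?_⟩
  have hz1 : ‖z‖ < ε := hz.trans_le (min_le_left _ _)
  have hz2 : ‖z‖ < t := hz.trans_le ((min_le_right _ _).trans (min_le_left _ _))
  have hz3 : ‖z‖ < R - t := hz.trans_le ((min_le_right _ _).trans (min_le_right _ _))
  have hzR : ‖t * d + z‖ < R := by
    refine (norm_add_le _ _).trans_lt ?_
    rw [norm_ofReal_mul_unit hd1 ht.le]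
    linarith
  have hcr : cross d (t * d + z) = cross d z := by
    simp [cross]; ring
  have hdt : dot d (t * d + z) = t + dot d z := by
    have := norm_eq_one_iff.1 hd1
    simp [dot]
    linear_combination t * this
  rw [add_assoc, hRD _ hzR]
  constructor
  · rintro ⟨e, he, s, hs, heq⟩
    by_cases hed : e = d
    · rw [← hcr]
      rw [hed] at heq
      exact ((mem_ray_iff hd1).1 ⟨s, hs, heq⟩).1
    · exfalso
      have hmem' : t * d + z ∈ C := by
        simp only [hC, mem_iUnion]
        exact ⟨e, ⟨he, hed⟩, s, hs, heq⟩
      have hzb : t * d + z ∈ Metric.ball ((t : ℂ) * d) ε := by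
        rw [Metric.mem_ball, dist_eq_norm, add_sub_cancel_left]
        exact hz1
      exact hball hzb hmem'
  · intro h0
    refine ⟨d, hd, (mem_ray_iff hd1).2 ⟨by rw [hcr, h0], ?_⟩⟩
    rw [hdt]
    linarith [abs_le.1 (abs_dot_le (z := z) hd1)]

lemma convex_halfDisc (q d : ℂ) (r : ℝ) :
    IsPreconnected ((fun z => q + z) '' ({z | ‖z‖ < r} ∩ {z | 0 < cross d z})) := by
  have h1 : Convex ℝ {z : ℂ | ‖z‖ < r} := by
    have : {z : ℂ | ‖z‖ < r} = Metric.ball 0 r := by ext z; simp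
    rw [this]
    exact convex_ball (0 : ℂ) r
  have h2 : Convex ℝ {z : ℂ | 0 < cross d z} := by
    intro x hx y hy a b ha hb hab
    simp only [mem_ofPred_eq] at hx hy ⊢
    have : cross d (a • x + b • y) = a * cross d x + b * cross d y := by
      simp [cross]; ring
    rw [this]
    rcases ha.eq_or_lt with rfl | ha
    · have : b = 1 := by linarith
      subst this; linarith
    · have := mul_nonneg hb hy.le
      have := mul_pos ha hx
      linarith
  exact (h1.inter h2).isPreconnected.image _ (by fun_prop)

lemma ConicColoring.leftHalf (h : ConicColoring P N) {q d : ℂ} {r : ℝ} (hr : 0 < r)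
    (hd : ‖d‖ = 1) (hfree : ∀ z, ‖z‖ < r → 0 < cross d z → q + z ∉ bdry P N) :
    (∀ z, ‖z‖ < r → 0 < cross d z → q + z ∈ P) ∨ (∀ z, ‖z‖ < r → 0 < cross d z → q + z ∈ N) := by
  have hdis : Disjoint ((fun z => q + z) '' ({z | ‖z‖ < r} ∩ {z | 0 < cross d z}))
      (bdry P N) := by
    rw [Set.disjoint_left]
    rintro _ ⟨z, ⟨hz1, hz2⟩, rfl⟩
    exact hfree z hz1 hz2
  set z₀ : ℂ := ((r / 2 : ℝ) : ℂ) * (⟨-d.im, d.re⟩ : ℂ) with hz₀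
  have hn : ‖z₀‖ < r := by
    rw [hz₀, norm_ofReal_mul_unit _ (by linarith)]
    · linarith
    · rw [norm_eq_one_iff] at hd ⊢; simp only; linarith
  have hc : 0 < cross d z₀ := by
    rw [norm_eq_one_iff] at hd
    have : cross d z₀ = r / 2 := by
      simp only [hz₀, cross, Complex.mul_re, Complex.mul_im, Complex.ofReal_re, Complex.ofReal_im,
        zero_mul, sub_zero, add_zero]
      linear_combination r / 2 * hd
    rw [this]; linarith
  have hmem : q + z₀ ∈ (fun z => q + z) '' ({z | ‖z‖ < r} ∩ {z | 0 < cross d z}) :=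
    ⟨z₀, ⟨hn, hc⟩, rfl⟩
  rcases notMem_bdry.1 (hfree z₀ hn hc) with h1 | h1
  · left
    intro z hz1 hz2
    exact h.subset_of_isPreconnected (convex_halfDisc q d r) hdis hmem h1 ⟨z, ⟨hz1, hz2⟩, rfl⟩
  · right
    intro z hz1 hz2
    rw [bdry_comm] at hdis
    exact h.swap.subset_of_isPreconnected (convex_halfDisc q d r) hdis hmem h1
      ⟨z, ⟨hz1, hz2⟩, rfl⟩

/-- The two sides of a straight part of the boundary have different colors. -/
lemma ConicColoring.sided_or (h : ConicColoring P N) {q d : ℂ} (hd : ‖d‖ = 1)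
    (hq : q ∈ bdry P N) (hs : IsStraight (bdry P N) q d) : Sided P N q d ∨ Sided N P q d := by
  obtain ⟨r, hr, hs⟩ := hs
  have hd' : ‖-d‖ = 1 := by rwa [norm_neg]
  have hL := h.leftHalf hr hd (q := q) fun z hz hc hm => hc.ne' ((hs z hz).1 hm)
  have hR := h.leftHalf hr hd' (q := q) fun z hz hc hm => by
    rw [cross_neg_left, (hs z hz).1 hm] at hc
    simp at hc
  simp only [cross_neg_left, Left.neg_pos_iff] at hR
  -- If both sides were in `P`, then `q` would not be in the closure of `N`.
  have not_all : ∀ {P N : Set ℂ}, ConicColoring P N → q ∈ bdry P N →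
      (∀ z, ‖z‖ < r → (q + z ∈ bdry P N ↔ cross d z = 0)) →
      (∀ z, ‖z‖ < r → 0 < cross d z → q + z ∈ P) → (∀ z, ‖z‖ < r → cross d z < 0 → q + z ∈ P) →
      False := by
    intro P N h hq hs h1 h2
    obtain ⟨n, hn, hdn⟩ := Metric.mem_closure_iff.1 (h.right_dense hq) r hr
    rw [dist_comm, dist_eq_norm] at hdn
    have hqn : q + (n - q) = n := by ring
    rcases lt_trichotomy (cross d (n - q)) 0 with hc | hc | hc
    · exact h.notMem_of_mem (by simpa [hqn] using h2 _ hdn hc) hn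
    · have := (hs _ hdn).2 hc
      rw [hqn] at this
      exact this (Or.inr hn)
    · exact h.notMem_of_mem (by simpa [hqn] using h1 _ hdn hc) hn
  rcases hL with hL | hL <;> rcases hR with hR | hR
  · exact absurd (not_all h hq hs hL hR) id
  · exact Or.inl ⟨r, hr, fun z hz => ⟨hL z hz, hR z hz⟩⟩
  · exact Or.inr ⟨r, hr, fun z hz => ⟨hL z hz, hR z hz⟩⟩
  · exact absurd (not_all h.swap (mem_bdry_comm hq) (by rwa [bdry_comm]) hL hR) id

/-- For small angles the first-order term in `cross_mul_cis_sub` dominates the second-order one and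
decides on which side of the line a moving point lies. -/
lemma exists_pos_sin_gt {a : ℝ} (ha : 0 < a) (c : ℝ) :
    ∃ ε > 0, ∀ ψ : ℝ, 0 < ψ → ψ < ε → |c| * (1 - Real.cos ψ) < a * Real.sin ψ := by
  refine ⟨min 1 (a / (|c| + 1)), by positivity, fun ψ h0 h1 => ?_⟩
  have h2 : ψ < 1 := h1.trans_le (min_le_left _ _)
  have h3 : ψ * (|c| + 1) < a := (lt_div_iff₀ (by positivity)).1 (h1.trans_le (min_le_right _ _))
  have h4 := Real.sin_gt_sub_cube h0
  have h5 := Real.one_sub_sq_div_two_le_cos (x := ψ)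
  have h6 : ψ / 2 < Real.sin ψ := by nlinarith [mul_pos h0 h0]
  have h7 : |c| * (1 - Real.cos ψ) ≤ |c| * (ψ ^ 2 / 2) :=
    mul_le_mul_of_nonneg_left (by linarith) (abs_nonneg c)
  have h8 : a * (ψ / 2) < a * Real.sin ψ := mul_lt_mul_of_pos_left h6 ha
  nlinarith [abs_nonneg c]

/-- A unit circle that crosses a straight part of the boundary transversally switches there. -/
lemma Sided.switch {A u d : ℂ} (hu : ‖u‖ = 1) (hs : Sided P N (A + u) d)
    (hdot : 0 < dot d u) : Switch N P A u := by
  obtain ⟨r, hr, hs⟩ := hs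
  obtain ⟨ε, hε, hsin⟩ := exists_pos_sin_gt hdot (cross d u)
  refine ⟨hu, min ε r, lt_min hε hr, fun ψ h0 h1 => ?_⟩
  have h2 : ψ < ε := h1.trans_le (min_le_left _ _)
  have h3 : ψ < r := h1.trans_le (min_le_right _ _)
  have hb : ∀ ψ' : ℝ, |ψ'| = ψ → ‖u * cis ψ' - u‖ < r := fun ψ' he =>
    (norm_mul_cis_sub_le hu ψ').trans_lt (he ▸ h3)
  have hAu : ∀ ψ' : ℝ, A + u * cis ψ' = A + u + (u * cis ψ' - u) := fun _ => by ring
  have hc := hsin ψ h0 h2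
  have hcos : 0 ≤ 1 - Real.cos ψ := by linarith [Real.cos_le_one ψ]
  have hle : cross d u * (1 - Real.cos ψ) ≤ |cross d u| * (1 - Real.cos ψ) :=
    mul_le_mul_of_nonneg_right (le_abs_self _) hcos
  have hle' : -(cross d u) * (1 - Real.cos ψ) ≤ |cross d u| * (1 - Real.cos ψ) :=
    mul_le_mul_of_nonneg_right (neg_le_abs _) hcos
  constructor
  · rw [hAu]
    refine (hs _ (hb _ (by rw [abs_neg, abs_of_pos h0]))).2 ?_
    rw [cross_mul_cis_sub, Real.cos_neg, Real.sin_neg]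
    linarith
  · rw [hAu]
    refine (hs _ (hb _ (abs_of_pos h0))).1 ?_
    rw [cross_mul_cis_sub]
    linarith

lemma Sided.switch_of_neg {A u d : ℂ} (hu : ‖u‖ = 1) (hs : Sided P N (A + u) d)
    (hdot : dot d u < 0) : Switch P N A u :=
  hs.neg.switch hu (by rw [dot_neg_left]; linarith)

lemma ConicColoring.crossing_of_isStraight (h : ConicColoring P N) {A u d : ℂ} (hu : ‖u‖ = 1)
    (hd : ‖d‖ = 1) (hmem : A + u ∈ bdry P N) (hs : IsStraight (bdry P N) (A + u) d)
    (hdot : dot d u ≠ 0) : Crossing P N A u := by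
  rcases h.sided_or hd hmem hs with h1 | h1 <;> rcases lt_or_gt_of_ne hdot with h2 | h2
  · exact Or.inl (h1.switch_of_neg hu h2)
  · exact Or.inr (h1.switch hu h2)
  · exact Or.inr (h1.switch_of_neg hu h2)
  · exact Or.inl (h1.switch hu h2)

/-- While `A` moves along a ray of the boundary, `u` stays a crossing, so `A + u` moves along a
parallel ray of the boundary. -/
lemma Crossing.dirs_subset (h : ConicColoring P N) {A u : ℂ} (hA : A ∈ bdry P N)
    (hc : Crossing P N A u) : dirs (bdry P N) A ⊆ dirs (bdry P N) (A + u) := by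
  rintro d ⟨hd, r, hr, hdr⟩
  obtain ⟨δ, hδ, hloc⟩ := h.crossing_locally_constant (u := u) hA
  refine ⟨hd, min r δ, lt_min hr hδ, fun t h0 h1 => ?_⟩
  have h2 := hdr t h0 (h1.trans_le (min_le_left _ _))
  have h3 : Crossing P N (A + t * d) u := by
    refine (hloc _ h2 ?_).2 hc
    rw [add_sub_cancel_left, norm_ofReal_mul_unit hd h0.le]
    exact h1.trans_le (min_le_right _ _)
  have := h3.mem_bdry h
  rwa [add_right_comm] at this

/-- Unit circles about boundary points are not tangent to the boundary at crossings. -/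
lemma Crossing.dot_ne_zero (h : ConicColoring P N) {A u d : ℂ} (hA : A ∈ bdry P N)
    (hc : Crossing P N A u) (hd : d ∈ dirs (bdry P N) A) : dot d u ≠ 0 := by
  intro hdot
  have hu := hc.norm_eq
  have hcr : cross d u ^ 2 = 1 := by
    have := dot_sq_add_cross_sq_of_unit hd.1 hu
    rw [hdot] at this
    linarith
  obtain ⟨δ, hδ, hloc⟩ := h.crossing_locally_constant (u := u) hA
  obtain ⟨r, hr, hst⟩ := h.isStraight_of_mem_dirs (hc.dirs_subset h hA hd)
  obtain ⟨-, r', hr', hmem⟩ := id hd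
  obtain ⟨t, ht0, ht⟩ := exists_between (lt_min hδ (lt_min hr hr'))
  have ht1 := ht.trans_le (min_le_left _ _)
  have ht2 := ht.trans_le ((min_le_right _ _).trans (min_le_left _ _))
  have ht3 := ht.trans_le ((min_le_right _ _).trans (min_le_right _ _))
  have hA' := hmem t ht0 ht3
  have hc' : Crossing P N (A + t * d) u := by
    refine (hloc _ hA' ?_).2 hc
    rwa [add_sub_cancel_left, norm_ofReal_mul_unit hd.1 ht0.le]
  obtain ⟨hs, hsm⟩ := hst t ht0 ht2
  -- At a straight point the circle would touch its tangent line from one side: `cross e (u * cis ψ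
  -- - u) = cross e u * (cos ψ - 1)` has the same sign at `ψ` and `-ψ`. So the colors before and
  -- after would agree.
  have key : ∀ {P N : Set ℂ} (e : ℂ), ConicColoring P N → Sided P N (A + u + t * d) e →
      Switch P N (A + t * d) u → dot e u = 0 → cross e u ^ 2 = 1 → False := by
    intro P N e h hs hsw hdot hcr
    obtain ⟨ρ, hρ, hs⟩ := hs
    obtain ⟨-, ε, hε, hsw⟩ := hsw
    obtain ⟨ψ, h0, h1⟩ := exists_between (lt_min hε (lt_min hρ one_pos))
    have h2 := h1.trans_le (min_le_left _ _)
    have h3 := h1.trans_le ((min_le_right _ _).trans (min_le_left _ _))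
    have h4 := h1.trans_le ((min_le_right _ _).trans (min_le_right _ _))
    have hcos : Real.cos ψ < 1 := by
      refine lt_of_le_of_ne (Real.cos_le_one ψ) fun he => h0.ne' ?_
      have := (Real.cos_eq_one_iff_of_lt_of_lt (x := ψ) (by linarith [Real.pi_gt_three])
        (by linarith [Real.pi_gt_three])).1 he
      exact this
    obtain ⟨hp, hn⟩ := hsw ψ h0 h2
    have hn1 := norm_mul_cis_sub_le hu ψ
    have hn2 := norm_mul_cis_sub_le hu (-ψ)
    rw [abs_of_pos h0] at hn1
    rw [abs_neg, abs_of_pos h0] at hn2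
    have e1 : A + t * d + u * cis ψ = A + u + t * d + (u * cis ψ - u) := by ring
    have e2 : A + t * d + u * cis (-ψ) = A + u + t * d + (u * cis (-ψ) - u) := by ring
    have s1 := hs _ (hn1.trans_lt h3)
    have s2 := hs _ (hn2.trans_lt h3)
    rw [cross_mul_cis_sub, hdot, zero_mul, add_zero] at s1 s2
    rw [Real.cos_neg] at s2
    rw [e1] at hn
    rw [e2] at hp
    rcases mul_self_eq_one_iff.1 ((sq (cross e u)).symm.trans hcr) with hcr | hcr
    · rw [hcr] at s2
      exact h.notMem_of_mem hp (s2.2 (by linarith))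
    · rw [hcr] at s1
      exact h.notMem_of_mem (s1.1 (by linarith)) hn
  rcases h.sided_or hd.1 hsm hs with h1 | h1 <;> rcases hc' with h2 | h2
  · exact key d h h1 h2 hdot hcr
  · exact key (-d) h.swap h1.neg h2 (by rw [dot_neg_left, hdot, neg_zero])
      (by rw [cross_neg_left, neg_sq, hcr])
  · exact key (-d) h h1.neg h2 (by rw [dot_neg_left, hdot, neg_zero])
      (by rw [cross_neg_left, neg_sq, hcr])
  · exact key d h.swap h1 h2 hdot hcr

/-- Seen from `A + t * d + u`, the straight boundary point `A + t * d` lies in direction `-u` and is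
crossed transversally. The hexagon there also contains `u`, and local constancy carries this back to
`A + u`. -/
lemma Crossing.translate (h : ConicColoring P N) {A u : ℂ} (hA : A ∈ bdry P N)
    (hc : Crossing P N A u) : Crossing P N (A + u) u := by
  have hAu := hc.mem_bdry h
  obtain ⟨d, hd⟩ := h.dirs_nonempty hA
  obtain ⟨r, hr, hst⟩ := h.isStraight_of_mem_dirs hd
  obtain ⟨δ₁, hδ₁, hloc₁⟩ := h.crossing_locally_constant (u := u) hA
  obtain ⟨δ₂, hδ₂, hloc₂⟩ := h.crossing_locally_constant (u := u) hAu
  obtain ⟨t, ht0, ht⟩ := exists_between (lt_min hr (lt_min hδ₁ hδ₂))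
  have ht1 := ht.trans_le (min_le_left _ _)
  have ht2 := ht.trans_le ((min_le_right _ _).trans (min_le_left _ _))
  have ht3 := ht.trans_le ((min_le_right _ _).trans (min_le_right _ _))
  obtain ⟨hs, hA'⟩ := hst t ht0 ht1
  have hn : ‖(t : ℂ) * d‖ = t := norm_ofReal_mul_unit hd.1 ht0.le
  have hc' : Crossing P N (A + t * d) u :=
    (hloc₁ _ hA' (by rwa [add_sub_cancel_left, hn])).2 hc
  have hB := hc'.mem_bdry h
  have hdot := hc.dot_ne_zero h hA hd
  have hback : Crossing P N (A + t * d + u) (-u) := by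
    apply h.crossing_of_isStraight (d := d) (by rw [norm_neg]; exact hc.norm_eq) hd.1
    · rwa [add_neg_cancel_right]
    · rwa [add_neg_cancel_right]
    · rw [dot_neg_right]; exact neg_ne_zero.2 hdot
  have hfwd := hback.neg h hB
  rw [neg_neg] at hfwd
  refine (hloc₂ _ hB ?_).1 hfwd
  rwa [add_sub_add_right_eq_sub, add_sub_cancel_left, hn]

lemma Crossing.dirs_eq (h : ConicColoring P N) {A u : ℂ} (hA : A ∈ bdry P N)
    (hc : Crossing P N A u) : dirs (bdry P N) (A + u) = dirs (bdry P N) A := by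
  apply Subset.antisymm _ (hc.dirs_subset h hA)
  have hAu := hc.mem_bdry h
  have := ((hc.translate h hA).neg h hAu).dirs_subset h hAu
  rwa [add_neg_cancel_right] at this

lemma exists_eq_mul_cis {u w : ℂ} (hu : ‖u‖ = 1) (hw : ‖w‖ = 1) :
    ∃ ψ : ℝ, w = u * cis ψ ∧ |ψ| ≤ 2 * ‖w - u‖ := by
  have hu0 : u ≠ 0 := by rintro rfl; simp at hu
  have hv : ‖w / u‖ = 1 := by rw [norm_div, hu, hw, div_one]
  have hv0 : w / u ≠ 0 := by intro h0; rw [h0] at hv; simp at hv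
  refine ⟨Complex.arg (w / u), ?_, ?_⟩
  · have : cis (Complex.arg (w / u)) = w / u := by
      apply Complex.ext
      · rw [cis_re, Complex.cos_arg hv0, hv, div_one]
      · rw [cis_im, Complex.sin_arg, hv, div_one]
    rw [this, mul_div_cancel₀ _ hu0]
  · have h1 : ‖w - u‖ = ‖w / u - 1‖ := by
      rw [div_sub_one hu0, norm_div, hu, div_one]
    have hπ := Complex.abs_arg_le_pi (w / u)
    rw [h1]
    have hre : (w / u).re = Real.cos (Complex.arg (w / u)) := by
      rw [Complex.cos_arg hv0, hv, div_one]
    have him : (w / u).im = Real.sin (Complex.arg (w / u)) := by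
      rw [Complex.sin_arg, hv, div_one]
    set a := Complex.arg (w / u)
    have hq := Real.cos_le_one_sub_mul_cos_sq hπ
    apply abs_le_of_sq_le_sq _ (by positivity)
    rw [mul_pow, Complex.sq_norm, Complex.normSq_apply, Complex.sub_re, Complex.sub_im, hre, him,
      Complex.one_re, Complex.one_im]
    -- The factor 2 in the claim: `‖w - u‖² = 2 - 2 cos a ≥ 4 a² / π² ≥ a² / 4`, the last step
    -- because `π < 4`.
    have hpi4 : 1 / 8 ≤ 2 / Real.pi ^ 2 := by
      rw [div_le_div_iff₀ (by norm_num) (by positivity)]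
      nlinarith [Real.pi_lt_four, Real.pi_pos]
    have : 1 / 8 * a ^ 2 ≤ 2 / Real.pi ^ 2 * a ^ 2 :=
      mul_le_mul_of_nonneg_right hpi4 (sq_nonneg a)
    nlinarith [Real.sin_sq_add_cos_sq a]

/-- Two different directions of the boundary at a point lie on opposite sides of each line that is
perpendicular to a crossing. -/
lemma Crossing.dot_mul_dot_neg (h : ConicColoring P N) {A u d₁ d₂ : ℂ} (hA : A ∈ bdry P N)
    (hc : Crossing P N A u) (h1 : d₁ ∈ dirs (bdry P N) A) (h2 : d₂ ∈ dirs (bdry P N) A)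
    (hne : d₁ ≠ d₂) : dot d₁ u * dot d₂ u < 0 := by
  -- If both directions point forward along `u`, move `A` by `t • d₁` and then `A + u` by some `s •
  -- d₂` until the distance is again `1`. The new joining vector `w` is a crossing close to `u`,
  -- hence equal to `u`, and so `s • d₂ = t • d₁`.
  have main : ∀ v : ℂ, Crossing P N A v → 0 < dot d₁ v → 0 < dot d₂ v → False := by
    intro u hc ha1 ha2
    have hu := hc.norm_eq
    obtain ⟨ρ, hρ, hiso⟩ := h.crossing_isolated A hu
    obtain ⟨r₁, hr₁, hst₁⟩ := h.isStraight_of_mem_dirs h1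
    obtain ⟨r₂, hr₂, hst₂⟩ := h.isStraight_of_mem_dirs (hc.dirs_subset h hA h2)
    set a₁ := dot d₁ u with ha₁
    set a₂ := dot d₂ u with ha₂
    set C := a₁ / a₂ with hC
    have hC0 : 0 < C := div_pos ha1 ha2
    obtain ⟨t, ht0, ht⟩ : ∃ t : ℝ, 0 < t ∧ t < r₁ ∧ t < ρ ∧ t < 2 * a₁ ∧ C * t < r₂ ∧
        2 * ((C + 1) * t) < ρ ∧ (C + 1) * t < a₂ := by
      have : ∀ᶠ t : ℝ in 𝓝 0, t < r₁ ∧ t < ρ ∧ t < 2 * a₁ ∧ C * t < r₂ ∧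
        2 * ((C + 1) * t) < ρ ∧ (C + 1) * t < a₂ := by
        have c1 : Continuous fun t : ℝ => t := continuous_id
        have c2 : Continuous fun t : ℝ => C * t := by fun_prop
        have c3 : Continuous fun t : ℝ => 2 * ((C + 1) * t) := by fun_prop
        have c4 : Continuous fun t : ℝ => (C + 1) * t := by fun_prop
        have ev : ∀ {f : ℝ → ℝ} {b : ℝ}, Continuous f → f 0 < b → ∀ᶠ t in 𝓝 0, f t < b :=
          fun hf hb => hf.continuousAt.eventually_lt continuousAt_const hb
        exact (ev c1 hr₁).and ((ev c1 hρ).and ((ev c1 (by positivity)).and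
          ((ev c2 (by simpa using hr₂)).and ((ev c3 (by simpa using hρ)).and
            (ev c4 (by simpa using ha2))))))
      obtain ⟨ε, hε, hb⟩ := Metric.eventually_nhds_iff.1 this
      refine ⟨ε / 2, by positivity, hb ?_⟩
      rw [Real.dist_eq, sub_zero, abs_of_pos (by positivity)]
      linarith
    obtain ⟨ht1, ht2, ht3, ht4, ht5, ht6⟩ := ht
    -- This is `‖u + s • d₂ - t • d₁‖²`. It is below `1` at `s = 0`. At `s = C * t` with `C = a₁ /
    -- a₂` the first-order terms cancel and it is at least `1 + (C * t - t)²`.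
    set φ : ℝ → ℝ := fun s => (u.re + s * d₂.re - t * d₁.re) * (u.re + s * d₂.re - t * d₁.re) +
      (u.im + s * d₂.im - t * d₁.im) * (u.im + s * d₂.im - t * d₁.im) with hφ
    have n0 := norm_eq_one_iff.1 hu
    have n1 := norm_eq_one_iff.1 h1.1
    have n2 := norm_eq_one_iff.1 h2.1
    have hφ0 : φ 0 < 1 := by
      have : φ 0 = 1 + t * (t - 2 * a₁) := by
        simp only [hφ, ha₁, dot]
        linear_combination n0 + t ^ 2 * n1
      rw [this]
      nlinarith
    have hdle : dot d₁ d₂ ≤ 1 := by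
      have := dot_sq_add_cross_sq_of_unit h1.1 h2.1
      nlinarith [sq_nonneg (cross d₁ d₂)]
    have hφC : 1 ≤ φ (C * t) := by
      have e1 : φ (C * t) = 1 + 2 * (C * t) * a₂ - 2 * t * a₁ - 2 * (C * t) * t * dot d₁ d₂
          + (C * t) ^ 2 + t ^ 2 := by
        simp only [hφ, ha₁, ha₂, dot]
        linear_combination n0 + t ^ 2 * n1 + (C * t) ^ 2 * n2
      have e2 : C * a₂ = a₁ := div_mul_cancel₀ _ ha2.ne'
      have e3 : C * t * t * dot d₁ d₂ ≤ C * t * t * 1 :=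
        mul_le_mul_of_nonneg_left hdle (by positivity)
      have e4 : C * t * a₂ = t * a₁ := by rw [← e2]; ring
      nlinarith [sq_nonneg (C * t - t)]
    have hφc : ContinuousOn φ (Icc 0 (C * t)) := by
      apply Continuous.continuousOn
      simp only [hφ]
      fun_prop
    obtain ⟨s, ⟨hs0, hsC⟩, hs⟩ := intermediate_value_Icc (by positivity) hφc ⟨hφ0.le, hφC⟩
    have hs0' : 0 < s := lt_of_le_of_ne hs0 (by rintro rfl; linarith)
    set w : ℂ := u + s * d₂ - t * d₁ with hw
    have hw1 : ‖w‖ = 1 := by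
      rw [norm_eq_one_iff, ← hs]
      simp [hw, hφ]
    have hwu : ‖w - u‖ ≤ (C + 1) * t := by
      have : w - u = s * d₂ - t * d₁ := by rw [hw]; ring
      rw [this]
      refine (norm_sub_le _ _).trans ?_
      rw [norm_ofReal_mul_unit h1.1 ht0.le, norm_ofReal_mul_unit h2.1 hs0]
      linarith
    obtain ⟨hq, hqm⟩ := hst₂ s hs0' (by linarith)
    obtain ⟨-, hA'⟩ := hst₁ t ht0 ht1
    have hAw : A + t * d₁ + w = A + u + s * d₂ := by rw [hw]; ring
    have hdw : dot d₂ w ≠ 0 := by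
      have := abs_le.1 (abs_dot_sub_le h2.1 w u)
      have : 0 < dot d₂ w := by linarith
      exact this.ne'
    have hcw : Crossing P N (A + t * d₁) w :=
      h.crossing_of_isStraight hw1 h2.1 (by rwa [hAw]) (by rwa [hAw]) hdw
    obtain ⟨ψ, hψ, hψle⟩ := exists_eq_mul_cis hu hw1
    rw [hψ] at hcw
    have hψ0 := hiso _ hA' (by rwa [add_sub_cancel_left, norm_ofReal_mul_unit h1.1 ht0.le]) ψ
      (by linarith) hcw
    rw [hψ0, cis_zero, mul_one] at hψ
    have : (s : ℂ) * d₂ = t * d₁ := by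
      have h0 : u + s * d₂ - t * d₁ = u := hψ
      linear_combination h0
    exact hne (unit_eq_of_mul_eq h2.1 h1.1 hs0' ht0.le this).2.symm
  have hne1 := hc.dot_ne_zero h hA h1
  have hne2 := hc.dot_ne_zero h hA h2
  rcases lt_or_gt_of_ne hne1 with g1 | g1 <;> rcases lt_or_gt_of_ne hne2 with g2 | g2
  · exact absurd (main (-u) (hc.neg h hA) (by rw [dot_neg_right]; linarith)
      (by rw [dot_neg_right]; linarith)) id
  · exact mul_neg_of_neg_of_pos g1 g2
  · exact mul_neg_of_pos_of_neg g1 g2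
  · exact absurd (main u hc g1 g2) id

/-- The boundary has no loose ends. -/
lemma ConicColoring.exists_dirs_ne (h : ConicColoring P N) {A : ℂ} (hA : A ∈ bdry P N) (d : ℂ) :
    ∃ d' ∈ dirs (bdry P N) A, d' ≠ d := by
  by_contra! hall
  have hd : d ∈ dirs (bdry P N) A := by
    obtain ⟨e, he⟩ := h.dirs_nonempty hA
    exact hall e he ▸ he
  -- If `d` were the only direction at `A`, hence at `A + u`, then near `A + u` the half-disc facing
  -- `A` would contain no boundary point and have one color. The unit circle about `A` bends into it
  -- on both sides of `A + u`, so it could not switch there.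
  have main : ∀ v : ℂ, Crossing P N A v → 0 < dot d v → False := by
    intro u hc hdot
    have hu := hc.norm_eq
    have hdirs := hc.dirs_eq h hA
    obtain ⟨-, R, hR, hRD⟩ := h.exists_conic (A + u)
    rw [hdirs] at hRD
    have hcr : ∀ z, cross (Complex.I * u) z = -dot u z := by
      intro z; simp [cross, dot]; ring
    have hIu : ‖-(Complex.I * u)‖ = 1 := by simp [hu]
    have hfree : ∀ z, ‖z‖ < R → 0 < cross (Complex.I * u) z → A + u + z ∉ bdry P N := by
      intro z hz hpos hmem
      obtain ⟨e, he, s, hs, rfl⟩ := (hRD z hz).1 hmem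
      rw [hall e he, hcr] at hpos
      have : dot u (s * d) = s * dot d u := by simp [dot]; ring
      rw [this] at hpos
      nlinarith
    have hd' : ‖Complex.I * u‖ = 1 := by simp [hu]
    have key : ∀ {P N : Set ℂ}, ConicColoring P N →
        (∀ z, ‖z‖ < R → 0 < cross (Complex.I * u) z → A + u + z ∈ P) →
        Switch P N A u → False := by
      intro P N h hall hsw
      obtain ⟨-, ε, hε, hsw⟩ := hsw
      obtain ⟨ψ, h0, h1⟩ := exists_between (lt_min hε (lt_min hR one_pos))
      have h2 := h1.trans_le (min_le_left _ _)
      have h3 := h1.trans_le ((min_le_right _ _).trans (min_le_left _ _))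
      have h4 := h1.trans_le ((min_le_right _ _).trans (min_le_right _ _))
      have hcos : Real.cos ψ < 1 := by
        refine lt_of_le_of_ne (Real.cos_le_one ψ) fun he => h0.ne' ?_
        exact (Real.cos_eq_one_iff_of_lt_of_lt (by linarith [Real.pi_gt_three])
          (by linarith [Real.pi_gt_three])).1 he
      have hn1 := norm_mul_cis_sub_le hu ψ
      rw [abs_of_pos h0] at hn1
      have := hall (u * cis ψ - u) (hn1.trans_lt h3)
        (by rw [hcr, dot_mul_cis_sub hu]; linarith)
      rw [add_assoc, add_sub_cancel] at this
      exact h.notMem_of_mem this (hsw ψ h0 h2).2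
    have key' : ∀ {P N : Set ℂ}, ConicColoring P N →
        (∀ z, ‖z‖ < R → 0 < cross (Complex.I * u) z → A + u + z ∈ P) →
        Switch N P A u → False := by
      intro P N h hall hsw
      obtain ⟨-, ε, hε, hsw⟩ := hsw
      obtain ⟨ψ, h0, h1⟩ := exists_between (lt_min hε (lt_min hR one_pos))
      have h2 := h1.trans_le (min_le_left _ _)
      have h3 := h1.trans_le ((min_le_right _ _).trans (min_le_left _ _))
      have h4 := h1.trans_le ((min_le_right _ _).trans (min_le_right _ _))
      have hcos : Real.cos ψ < 1 := by
        refine lt_of_le_of_ne (Real.cos_le_one ψ) fun he => h0.ne' ?_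
        exact (Real.cos_eq_one_iff_of_lt_of_lt (by linarith [Real.pi_gt_three])
          (by linarith [Real.pi_gt_three])).1 he
      have hn1 := norm_mul_cis_sub_le hu (-ψ)
      rw [abs_neg, abs_of_pos h0] at hn1
      have := hall (u * cis (-ψ) - u) (hn1.trans_lt h3)
        (by rw [hcr, dot_mul_cis_sub hu, Real.cos_neg]; linarith)
      rw [add_assoc, add_sub_cancel] at this
      exact h.notMem_of_mem this (hsw ψ h0 h2).1
    rcases h.leftHalf hR hd' hfree with h1 | h1 <;> rcases hc with h2 | h2
    · exact key h h1 h2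
    · exact key' h h1 h2
    · exact key' h.swap h1 h2
    · exact key h.swap h1 h2
  obtain ⟨u, hc⟩ := h.exists_crossing hA
  rcases lt_or_gt_of_ne (hc.dot_ne_zero h hA hd) with g | g
  · exact main (-u) (hc.neg h hA) (by rw [dot_neg_right]; linarith)
  · exact main u hc g

/-! ### The crossing along the boundary -/

/-- The crossing `x` makes an angle of less than thirty degrees with the boundary at `A`. -/
def Near (P N : Set ℂ) (A x : ℂ) : Prop :=
  Crossing P N A x ∧ ∀ d ∈ dirs (bdry P N) A, 3 / 4 < dot d x ^ 2

lemma Near.swap {A x : ℂ} (hx : Near P N A x) : Near N P A x :=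
  ⟨hx.1.swap, by rw [bdry_comm]; exact hx.2⟩

lemma dot_rot (d u : ℂ) : dot d (rot * u) = dot d u / 2 - Real.sqrt 3 / 2 * cross d u := by
  simp [dot, cross]; ring

lemma dot_rot_rot (d u : ℂ) :
    dot d (rot * (rot * u)) = -(dot d u / 2) - Real.sqrt 3 / 2 * cross d u := by
  rw [← mul_assoc, rot_sq]
  simp [dot, cross]; ring

/-- This turns the thirty-degree condition of `Near` into a statement about the signs of the other
two crossings of the hexagon against `d`. -/
lemma dot_rot_mul_dot_rot_rot {d u : ℂ} (hd : ‖d‖ = 1) (hu : ‖u‖ = 1) :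
    dot d (rot * u) * dot d (rot * (rot * u)) = 3 / 4 - dot d u ^ 2 := by
  rw [dot_rot, dot_rot_rot]
  linear_combination (cross d u) ^ 2 / 4 * sqrt_three_sq +
    3 / 4 * dot_sq_add_cross_sq_of_unit hd hu

/-- Passing from `d₁` to a different direction `d₂` flips the signs of the products with both `rot *
u` and `rot * (rot * u)`. Their product, `3 / 4 - dot d u ^ 2`, keeps its sign. -/
lemma Crossing.near_dir_iff (h : ConicColoring P N) {A u d₁ d₂ : ℂ} (hA : A ∈ bdry P N)
    (hc : Crossing P N A u) (h1 : d₁ ∈ dirs (bdry P N) A) (h2 : d₂ ∈ dirs (bdry P N) A) :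
    3 / 4 < dot d₁ u ^ 2 → 3 / 4 < dot d₂ u ^ 2 := by
  by_cases hne : d₁ = d₂
  · rw [hne]; exact id
  · intro hlt
    have e1 := dot_rot_mul_dot_rot_rot h1.1 hc.norm_eq
    have e2 := dot_rot_mul_dot_rot_rot h2.1 hc.norm_eq
    have hr := hc.rot h hA
    have g1 := hr.dot_mul_dot_neg h hA h1 h2 hne
    have g2 := (hr.rot h hA).dot_mul_dot_neg h hA h1 h2 hne
    have g3 := mul_pos_of_neg_of_neg g1 g2
    have g4 : 0 < (3 / 4 - dot d₁ u ^ 2) * (3 / 4 - dot d₂ u ^ 2) := by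
      rw [← e1, ← e2]; linarith
    by_contra! hle
    nlinarith [mul_nonneg (sub_nonneg.2 hlt.le) (sub_nonneg.2 hle)]

lemma ConicColoring.near_iff (h : ConicColoring P N) {A x d : ℂ} (hA : A ∈ bdry P N)
    (hd : d ∈ dirs (bdry P N) A) :
    Near P N A x ↔ Crossing P N A x ∧ 3 / 4 < dot d x ^ 2 :=
  ⟨fun hx => ⟨hx.1, hx.2 d hd⟩, fun hx => ⟨hx.1, fun _ he => hx.1.near_dir_iff h hA hd he hx.2⟩⟩

/-- Let `a`, `b`, `c` be the inner products of `d` with the three crossings. If none were near, `b *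
c`, `-(c * a)` and `a * b` would all be nonnegative, but their product is `-(a * b * c)²`, which is
negative. -/
lemma Crossing.exists_near (h : ConicColoring P N) {A u : ℂ} (hA : A ∈ bdry P N)
    (hc : Crossing P N A u) :
    Near P N A u ∨ Near P N A (TwoColoring.rot * u) ∨
      Near P N A (TwoColoring.rot * (TwoColoring.rot * u)) := by
  obtain ⟨d, hd⟩ := h.dirs_nonempty hA
  have hc1 := hc.rot h hA
  have hc2 := hc1.rot h hA
  rw [h.near_iff hA hd, h.near_iff hA hd, h.near_iff hA hd]
  have e0 := dot_rot_mul_dot_rot_rot hd.1 hc.norm_eq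
  have e1 := dot_rot_mul_dot_rot_rot hd.1 hc1.norm_eq
  have e2 := dot_rot_mul_dot_rot_rot hd.1 hc2.norm_eq
  have e3 : TwoColoring.rot * (TwoColoring.rot * (TwoColoring.rot * u)) = -u := by
    rw [← mul_assoc, ← mul_assoc, mul_assoc TwoColoring.rot, rot_cube, neg_one_mul]
  rw [e3, dot_neg_right] at e1 e2
  rw [mul_neg, dot_neg_right] at e2
  have n0 := hc.dot_ne_zero h hA hd
  have n1 := hc1.dot_ne_zero h hA hd
  have n2 := hc2.dot_ne_zero h hA hd
  by_contra! hall
  obtain ⟨k0, k1, k2⟩ := hall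
  have k0 := k0 hc
  have k1 := k1 hc1
  have k2 := k2 hc2
  generalize dot d u = a at *
  generalize dot d (TwoColoring.rot * u) = b at *
  generalize dot d (TwoColoring.rot * (TwoColoring.rot * u)) = c at *
  have f0 : 0 ≤ b * c := by linarith
  have f1 : 0 ≤ c * -a := by linarith
  have f2 : 0 ≤ a * b := by linarith
  have f3 : 0 < (a * b * c) ^ 2 := by positivity
  nlinarith [mul_nonneg (mul_nonneg f0 f1) f2]

lemma mem_dirs_of_isStraight {E : Set ℂ} {q d : ℂ} (hd : ‖d‖ = 1) (hs : IsStraight E q d) :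
    d ∈ dirs E q := by
  obtain ⟨r, hr, hs⟩ := hs
  refine ⟨hd, r, hr, fun t h0 h1 => (hs _ (by rwa [norm_ofReal_mul_unit hd h0.le])).2 ?_⟩
  simp [cross]; ring

/-- A nearby boundary point other than `A` lies on one of the rays at `A` and has its direction `d`
among its own, so the angle with `x` can be measured there against the same `d`. -/
lemma ConicColoring.near_locally_constant (h : ConicColoring P N) {A x : ℂ}
    (hA : A ∈ bdry P N) : ∃ r > 0, ∀ A' ∈ bdry P N, ‖A' - A‖ < r →
      (Near P N A' x ↔ Near P N A x) := by
  obtain ⟨r, hr, h1⟩ := h.crossing_locally_constant (u := x) hA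
  obtain ⟨hD, R, hR, hRD⟩ := h.exists_conic A
  choose! ρ hρ hst using fun d (hd : d ∈ dirs (bdry P N) A) => h.isStraight_of_mem_dirs hd
  obtain ⟨δ, hδ, hδρ⟩ : ∃ δ > 0, ∀ d ∈ dirs (bdry P N) A, δ ≤ ρ d := by
    obtain ⟨e, he, hmin⟩ := Set.exists_min_image _ ρ hD (h.dirs_nonempty hA)
    exact ⟨ρ e, hρ e he, hmin⟩
  refine ⟨min r (min R δ), by positivity, fun A' hA' hd => ?_⟩
  have hd1 := hd.trans_le (min_le_left _ _)
  have hd2 := hd.trans_le ((min_le_right _ _).trans (min_le_left _ _))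
  have hd3 := hd.trans_le ((min_le_right _ _).trans (min_le_right _ _))
  have hA'' : A + (A' - A) ∈ bdry P N := by simpa using hA'
  obtain ⟨d, hdd, t, ht, hz⟩ := (hRD _ hd2).1 hA''
  rcases ht.eq_or_lt with rfl | ht
  · have : A' = A := by
      rw [Complex.ofReal_zero, zero_mul, sub_eq_zero] at hz
      exact hz
    rw [this]
  · have hAt : A' = A + t * d := by rw [← hz]; ring
    rw [hz, norm_ofReal_mul_unit hdd.1 ht.le] at hd3
    have hs := (hst d hdd t ht (hd3.trans_le (hδρ d hdd))).1
    rw [← hAt] at hs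
    rw [h.near_iff hA' (mem_dirs_of_isStraight hdd.1 hs), h.near_iff hA hdd, h1 A' hA' hd1]

lemma Near.translate (h : ConicColoring P N) {A x : ℂ} (hA : A ∈ bdry P N)
    (hx : Near P N A x) : Near P N (A + x) x := by
  refine ⟨hx.1.translate h hA, ?_⟩
  rw [hx.1.dirs_eq h hA]
  exact hx.2

lemma Near.neg (h : ConicColoring P N) {A x : ℂ} (hA : A ∈ bdry P N)
    (hx : Near P N A x) : Near P N A (-x) := by
  refine ⟨hx.1.neg h hA, fun d hd => ?_⟩
  rw [dot_neg_right, neg_sq]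
  exact hx.2 d hd

lemma Near.translate_rot (h : ConicColoring P N) {A x : ℂ} (hA : A ∈ bdry P N)
    (hx : Near P N A x) : Near P N (A + rot * x) x := by
  have h1 := hx.1.rot h hA
  have hm := h1.mem_bdry h
  have h2 := ((h1.translate h hA).rot h hm).rot h hm
  refine ⟨?_, ?_⟩
  · have h3 := h2.neg h hm
    have : -(rot * (rot * (rot * x))) = x := by
      rw [← mul_assoc, ← mul_assoc, mul_assoc rot, rot_cube, neg_one_mul, neg_neg]
    rwa [this] at h3
  · rw [h1.dirs_eq h hA]
    exact hx.2

/-! ### Colors on the two sides of the boundary -/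

/-- A rotation about `q` by `σ * ε` together with a shift by `y * sin ε` normal to `d` lifts `q + w`
over its boundary line by `(y + σ * dot d w) * sin ε`, up to second order. -/
lemma Sided.rotate_mem {q d w : ℂ} {y σ : ℝ} (hd : ‖d‖ = 1) (hw : ‖w‖ ≤ 1)
    (hσ : σ = 1 ∨ σ = -1) (hs : Sided P N (q + w) d) (hv : 0 < y + σ * dot d w) :
    ∃ ε₀ > 0, ∀ ε : ℝ, 0 < ε → ε < ε₀ →
      q + ((Real.sin ε * y : ℝ) : ℂ) * (Complex.I * d) + w * cis (σ * ε) ∈ P := by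
  obtain ⟨r, hr, hs⟩ := hs
  obtain ⟨ε₁, hε₁, hsin⟩ := exists_pos_sin_gt hv (cross d w)
  refine ⟨min ε₁ (r / (|y| + 1)), by positivity, fun ε h0 h1 => ?_⟩
  have h2 := h1.trans_le (min_le_left _ _)
  have h3 : ε * (|y| + 1) < r := (lt_div_iff₀ (by positivity)).1 (h1.trans_le (min_le_right _ _))
  have hσ1 : |σ * ε| = ε := by
    rcases hσ with rfl | rfl
    · rw [one_mul, abs_of_pos h0]
    · rw [neg_one_mul, abs_neg, abs_of_pos h0]
  have e1 : q + ((Real.sin ε * y : ℝ) : ℂ) * (Complex.I * d) + w * cis (σ * ε) =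
      q + w + (((Real.sin ε * y : ℝ) : ℂ) * (Complex.I * d) + w * (cis (σ * ε) - 1)) := by ring
  rw [e1]
  refine (hs _ ?_).1 ?_
  · refine (norm_add_le _ _).trans_lt ?_
    rw [norm_mul, norm_mul, norm_mul, hd, Complex.norm_I, mul_one, mul_one, Complex.norm_real,
      Real.norm_eq_abs, abs_mul]
    have g1 : |Real.sin ε| ≤ ε := by
      have := Real.abs_sin_le_abs (x := ε)
      rwa [abs_of_pos h0] at this
    have g2 : ‖w‖ * ‖cis (σ * ε) - 1‖ ≤ 1 * ε := by
      apply mul_le_mul hw _ (norm_nonneg _) zero_le_one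
      exact (norm_cis_sub_one_le _).trans hσ1.le
    have g3 : |Real.sin ε| * |y| ≤ ε * |y| := mul_le_mul_of_nonneg_right g1 (abs_nonneg y)
    linarith
  · have hd2 := norm_eq_one_iff.1 hd
    have hc : Real.cos (σ * ε) = Real.cos ε := by
      rcases hσ with rfl | rfl <;> simp
    have hs' : Real.sin (σ * ε) = σ * Real.sin ε := by
      rcases hσ with rfl | rfl <;> simp
    have e2 : cross d (((Real.sin ε * y : ℝ) : ℂ) * (Complex.I * d) + w * (cis (σ * ε) - 1)) =
        Real.sin ε * (y + σ * dot d w) - cross d w * (1 - Real.cos ε) := by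
      simp only [cross, dot, Complex.add_re, Complex.add_im, Complex.mul_re, Complex.mul_im,
        Complex.ofReal_re, Complex.ofReal_im, Complex.I_re, Complex.I_im, Complex.sub_re,
        Complex.sub_im, Complex.one_re, Complex.one_im, cis_re, cis_im, hc, hs']
      linear_combination Real.sin ε * y * hd2
    rw [e2]
    have := hsin ε h0 h2
    have hcos : 0 ≤ 1 - Real.cos ε := by linarith [Real.cos_le_one ε]
    have := mul_le_mul_of_nonneg_right (le_abs_self (cross d w)) hcos
    linarith

/-- Three straight pieces of the boundary with a common direction, through the vertices of a unit
triangle: no small motion of the triangle takes all of its vertices into the same class. -/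
lemma ConicColoring.not_sided_triangle (h : ConicColoring P N) {A d x : ℂ} {y σ : ℝ}
    (hd : ‖d‖ = 1) (hx : ‖x‖ = 1) (hσ : σ = 1 ∨ σ = -1)
    (H : ∀ w, w = 0 ∨ w = x ∨ w = rot * x →
      (0 < y + σ * dot d w ∧ Sided P N (A + w) d) ∨
      (y + σ * dot d w < 0 ∧ Sided N P (A + w) d)) : False := by
  have H' : ∀ w, w = 0 ∨ w = x ∨ w = rot * x → ∃ ε₀ > 0, ∀ ε : ℝ, 0 < ε → ε < ε₀ →
      A + ((Real.sin ε * y : ℝ) : ℂ) * (Complex.I * d) + w * cis (σ * ε) ∈ P := by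
    intro w hw
    have hw1 : ‖w‖ ≤ 1 := by rcases hw with rfl | rfl | rfl <;> simp [hx]
    rcases H w hw with ⟨hv, hs⟩ | ⟨hv, hs⟩
    · exact hs.rotate_mem hd hw1 hσ hv
    · have hd' : ‖-d‖ = 1 := by rwa [norm_neg]
      obtain ⟨ε₀, hε₀, hm⟩ := hs.neg.rotate_mem (y := -y) hd' hw1 hσ
        (by rw [dot_neg_left]; linarith)
      refine ⟨ε₀, hε₀, fun ε h0 h1 => ?_⟩
      convert hm ε h0 h1 using 3
      push_cast
      ring
  obtain ⟨ε₁, hε₁, h1⟩ := H' 0 (Or.inl rfl)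
  obtain ⟨ε₂, hε₂, h2⟩ := H' x (Or.inr (Or.inl rfl))
  obtain ⟨ε₃, hε₃, h3⟩ := H' (rot * x) (Or.inr (Or.inr rfl))
  obtain ⟨ε, h0, hlt⟩ := exists_between (lt_min hε₁ (lt_min hε₂ hε₃))
  have k1 := h1 ε h0 (hlt.trans_le (min_le_left _ _))
  have k2 := h2 ε h0 (hlt.trans_le ((min_le_right _ _).trans (min_le_left _ _)))
  have k3 := h3 ε h0 (hlt.trans_le ((min_le_right _ _).trans (min_le_right _ _)))
  rw [zero_mul, add_zero] at k1
  rw [mul_assoc] at k3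
  exact h.noTriangle_left _ (x * cis (σ * ε)) (by simp [hx]) k1 k2 k3

/-- The vertices `A`, `A + rot * x`, `A + x` have increasing coordinates `0 < m < M` along `d`, and
small motions lift them by any affine function of this coordinate with slope `±1`. The sign of such
a function can separate the first or the last vertex from the others, but never the middle one. So
every pattern of sides produces a triangle in one class, except that in which the middle vertex
alone is reversed. -/
lemma ConicColoring.sided_triangle (h : ConicColoring P N) {A d x : ℂ}
    (hd : ‖d‖ = 1) (hx : ‖x‖ = 1) (hm : 0 < dot d (rot * x))
    (hmM : dot d (rot * x) < dot d x) (h0 : Sided P N A d)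
    (h1 : Sided P N (A + x) d ∨ Sided N P (A + x) d)
    (h2 : Sided P N (A + rot * x) d ∨ Sided N P (A + rot * x) d) :
    Sided P N (A + x) d ∧ Sided N P (A + rot * x) d := by
  have hz : dot d 0 = 0 := by simp [dot]
  have k2 : Sided N P (A + rot * x) d := by
    rcases h2 with h2 | h2
    · exfalso
      rcases h1 with h1 | h1
      · refine h.not_sided_triangle (A := A) (y := 1) hd hx (Or.inl rfl) ?_
        rintro w (rfl | rfl | rfl)
        · exact Or.inl ⟨by rw [hz]; norm_num, by rwa [add_zero]⟩
        · exact Or.inl ⟨by linarith, h1⟩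
        · exact Or.inl ⟨by linarith, h2⟩
      · refine h.not_sided_triangle (A := A) (y := (dot d (rot * x) + dot d x) / 2) hd hx
          (Or.inr rfl) ?_
        rintro w (rfl | rfl | rfl)
        · exact Or.inl ⟨by rw [hz]; linarith, by rwa [add_zero]⟩
        · exact Or.inr ⟨by linarith, h1⟩
        · exact Or.inl ⟨by linarith, h2⟩
    · exact h2
  refine ⟨?_, k2⟩
  rcases h1 with h1 | h1
  · exact h1
  · exfalso
    refine h.swap.not_sided_triangle (A := A) (y := -(dot d (rot * x)) / 2) hd hx (Or.inl rfl) ?_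
    rintro w (rfl | rfl | rfl)
    · exact Or.inr ⟨by rw [hz]; linarith, by rwa [add_zero]⟩
    · exact Or.inl ⟨by linarith, h1⟩
    · exact Or.inl ⟨by linarith, k2⟩

/-- If `x` is less than thirty degrees away from `d`, then `rot * x` is between thirty and ninety
degrees away. -/
lemma dot_rot_bounds {d x : ℂ} (hd : ‖d‖ = 1) (hx : ‖x‖ = 1) (hpos : 0 < dot d x)
    (hn : 3 / 4 < dot d x ^ 2) : 0 < dot d (rot * x) ∧ dot d (rot * x) < dot d x := by
  have h1 := dot_sq_add_cross_sq_of_unit hd hx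
  have hs := sqrt_three_sq
  have hp := sqrt_three_pos
  rw [dot_rot]
  generalize dot d x = a at *
  generalize cross d x = b at *
  generalize Real.sqrt 3 = σ at *
  have hb : |b| < 1 / 2 := by
    apply abs_lt_of_sq_lt_sq _ (by norm_num)
    nlinarith
  have ha : σ / 2 < a := by
    by_contra! hle
    nlinarith
  obtain ⟨hb1, hb2⟩ := abs_lt.1 hb
  constructor <;> nlinarith

/-- At a boundary point, colors on the sides of the boundary, colors on the sides of its
translates, and the switch at the crossing along the boundary determine each other. -/
lemma Near.sided (h : ConicColoring P N) {A x d : ℂ} (hA : A ∈ bdry P N) (hx : Near P N A x)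
    (hd : d ∈ dirs (bdry P N) A) (hpos : 0 < dot d x) :
    ∃ r > 0, ∀ t : ℝ, 0 < t → t < r → A + t * d ∈ bdry P N ∧
      (Sided P N (A + t * d) d ↔ Switch N P A x) ∧
      (Sided P N (A + t * d) d ∨ Sided N P (A + t * d) d) ∧
      (Sided P N (A + t * d) d → Sided P N (A + x + t * d) d ∧
        Sided N P (A + rot * x + t * d) d) := by
  have hc := hx.1
  have hcr := hc.rot h hA
  have hx1 := hc.norm_eq
  obtain ⟨hm, hmM⟩ := dot_rot_bounds hd.1 hx1 hpos (hx.2 d hd)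
  obtain ⟨r₀, hr₀, s0⟩ := h.isStraight_of_mem_dirs hd
  obtain ⟨r₁, hr₁, s1⟩ := h.isStraight_of_mem_dirs (hc.dirs_subset h hA hd)
  obtain ⟨r₂, hr₂, s2⟩ := h.isStraight_of_mem_dirs (hcr.dirs_subset h hA hd)
  obtain ⟨r₃, hr₃, l3⟩ := h.switch_locally_constant (u := x) hA
  obtain ⟨r₄, hr₄, l4⟩ := h.swap.switch_locally_constant (u := x) (mem_bdry_comm hA)
  refine ⟨min (min r₀ r₁) (min r₂ (min r₃ r₄)), by positivity, fun t ht0 ht => ?_⟩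
  simp only [lt_min_iff] at ht
  obtain ⟨⟨t0, t1⟩, t2, t3, t4⟩ := ht
  obtain ⟨a0, b0⟩ := s0 t ht0 t0
  obtain ⟨a1, b1⟩ := s1 t ht0 t1
  obtain ⟨a2, b2⟩ := s2 t ht0 t2
  have hn : ‖A + t * d - A‖ = t := by rw [add_sub_cancel_left, norm_ofReal_mul_unit hd.1 ht0.le]
  have o0 := h.sided_or hd.1 b0 a0
  have o1 := h.sided_or hd.1 b1 a1
  have o2 := h.sided_or hd.1 b2 a2
  have e1 : A + x + t * d = A + t * d + x := by ring
  have e2 : A + rot * x + t * d = A + t * d + rot * x := by ring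
  have q3 := l3 _ b0 (by rwa [hn])
  have q4 := l4 _ (mem_bdry_comm b0) (by rwa [hn])
  have tri : Sided P N (A + t * d) d → Sided P N (A + x + t * d) d ∧
      Sided N P (A + rot * x + t * d) d := by
    intro hs
    rw [e1, e2]
    exact h.sided_triangle hd.1 hx1 hm hmM hs (by rwa [← e1]) (by rwa [← e2])
  refine ⟨b0, ⟨fun hs => ?_, fun hs => ?_⟩, o0, tri⟩
  · have := (tri hs).1
    rw [e1] at this
    exact q4.1 (this.switch hx1 hpos)
  · rcases o0 with o0 | o0
    · exact o0
    · exfalso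
      have := (h.swap.sided_triangle hd.1 hx1 hm hmM o0 (by rw [← e1]; exact o1.symm)
        (by rw [← e2]; exact o2.symm)).1
      exact (q3.1 (this.switch hx1 hpos)).not_swap h hs

/-! ### Plane isometries -/

lemma eq_rot_mul_or {v w : ℂ} (hv : ‖v‖ = 1) (hw : ‖w‖ = 1) (hvw : ‖w - v‖ = 1) :
    w = rot * v ∨ v = rot * w := by
  rw [norm_eq_one_iff] at hv hw hvw
  obtain ⟨a, b⟩ := v
  obtain ⟨c, d⟩ := w
  simp only [Complex.sub_re, Complex.sub_im] at hv hw hvw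
  have h1 : a * c + b * d = 1 / 2 := by linarith
  have h2 : (a * d - b * c) * (a * d - b * c) = Real.sqrt 3 / 2 * (Real.sqrt 3 / 2) := by
    linear_combination (a * a + b * b) * hw + hv - (a * c + b * d + 1 / 2) * h1
      - 1 / 4 * sqrt_three_sq
  rcases mul_self_eq_mul_self_iff.1 h2 with h3 | h3
  · left
    apply Complex.ext
    · simp only [Complex.mul_re, rot_re, rot_im]
      linear_combination (-c) * hv + a * h1 - b * h3
    · simp only [Complex.mul_im, rot_re, rot_im]
      linear_combination (-d) * hv + b * h1 + a * h3
  · right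
    apply Complex.ext
    · simp only [Complex.mul_re, rot_re, rot_im]
      linear_combination (-a) * hw + c * h1 + d * h3
    · simp only [Complex.mul_im, rot_re, rot_im]
      linear_combination (-b) * hw + d * h1 - c * h3

lemma ConicColoring.not_unit_triangle (h : ConicColoring P N) {A B C : ℂ} (hAB : ‖B - A‖ = 1)
    (hBC : ‖C - B‖ = 1) (hCA : ‖C - A‖ = 1) (hA : A ∈ P) (hB : B ∈ P) : C ∉ P := by
  intro hC
  rcases eq_rot_mul_or hAB hCA (by rwa [sub_sub_sub_cancel_right]) with h1 | h1
  · refine h.noTriangle_left A (B - A) hAB hA (by simpa using hB) ?_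
    rw [← h1]; simpa using hC
  · refine h.noTriangle_left A (C - A) hCA hA (by simpa using hC) ?_
    rw [← h1]; simpa using hB

lemma map_ofReal_mul (e : ℂ ≃ₗᵢ[ℝ] ℂ) (t : ℝ) (d : ℂ) : e (t * d) = t * e d := by
  rw [← Complex.real_smul, map_smul, Complex.real_smul]

lemma dot_map (e : ℂ ≃ₗᵢ[ℝ] ℂ) (z w : ℂ) : dot (e z) (e w) = dot z w := by
  have key : ∀ z w : ℂ, dot z w = inner ℝ z w := by
    intro z w
    rw [Complex.inner]
    simp [dot]; ring
  rw [key, key, e.inner_map_map]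

lemma bdry_preimage (e : ℂ ≃ₗᵢ[ℝ] ℂ) (P N : Set ℂ) :
    bdry (e ⁻¹' P) (e ⁻¹' N) = e ⁻¹' bdry P N := rfl

lemma closure_preimage (e : ℂ ≃ₗᵢ[ℝ] ℂ) (P : Set ℂ) : closure (e ⁻¹' P) = e ⁻¹' closure P :=
  (e.toHomeomorph.preimage_closure P).symm

lemma ConicColoring.preimage (h : ConicColoring P N) (e : ℂ ≃ₗᵢ[ℝ] ℂ) :
    ConicColoring (e ⁻¹' P) (e ⁻¹' N) where
  isOpen_left := h.isOpen_left.preimage e.continuous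
  isOpen_right := h.isOpen_right.preimage e.continuous
  disj := h.disj.preimage e
  left_dense := by
    rw [bdry_preimage, closure_preimage]
    exact preimage_mono h.left_dense
  right_dense := by
    rw [bdry_preimage, closure_preimage]
    exact preimage_mono h.right_dense
  conic := by
    intro p
    obtain ⟨D, hD, hD1, r, hr, hrD⟩ := h.conic (e p)
    refine ⟨e ⁻¹' D, hD.preimage e.injective.injOn, fun d hd => ?_, r, hr, fun z hz => ?_⟩
    · rw [← e.norm_map]; exact hD1 _ hd
    · rw [bdry_preimage, mem_preimage, map_add, hrD _ (by rwa [e.norm_map])]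
      constructor
      · rintro ⟨d, hd, t, ht, hzd⟩
        refine ⟨e.symm d, by simpa using hd, t, ht, e.injective ?_⟩
        rw [hzd, map_ofReal_mul, e.apply_symm_apply]
      · rintro ⟨d, hd, t, ht, rfl⟩
        exact ⟨e d, hd, t, ht, map_ofReal_mul e t d⟩
  noTriangle_left := by
    intro A u hu h1 h2 h3
    refine h.not_unit_triangle (A := e A) (B := e (A + u)) (C := e (A + rot * u)) ?_ ?_ ?_ h1 h2 h3
    · rw [← map_sub, e.norm_map, add_sub_cancel_left, hu]
    · rw [← map_sub, e.norm_map, add_sub_add_left_eq_sub]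
      have : rot * u - u = rot * (rot * u) := by rw [← mul_assoc, rot_sq]; ring
      rw [this]; simp [hu]
    · rw [← map_sub, e.norm_map, add_sub_cancel_left]; simp [hu]
  noTriangle_right := by
    intro A u hu h1 h2 h3
    refine h.swap.not_unit_triangle (A := e A) (B := e (A + u)) (C := e (A + rot * u)) ?_ ?_ ?_
      h1 h2 h3
    · rw [← map_sub, e.norm_map, add_sub_cancel_left, hu]
    · rw [← map_sub, e.norm_map, add_sub_add_left_eq_sub]
      have : rot * u - u = rot * (rot * u) := by rw [← mul_assoc, rot_sq]; ring
      rw [this]; simp [hu]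
    · rw [← map_sub, e.norm_map, add_sub_cancel_left]; simp [hu]

/-- The isometry `e` preserves or reverses the orientation of circles. -/
def CircleMap (e : ℂ ≃ₗᵢ[ℝ] ℂ) : Prop :=
  (∀ (u : ℂ) (ψ : ℝ), e (u * cis ψ) = e u * cis ψ) ∨
  (∀ (u : ℂ) (ψ : ℝ), e (u * cis ψ) = e u * cis (-ψ))

/-- A reflection exchanges the two kinds of switches, so only crossings are transported by both
kinds of isometry. -/
lemma Crossing.preimage {e : ℂ ≃ₗᵢ[ℝ] ℂ} (he : CircleMap e) {A u : ℂ}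
    (hc : Crossing P N (e A) (e u)) : Crossing (e ⁻¹' P) (e ⁻¹' N) A u := by
  have key : ∀ {P N : Set ℂ}, Switch P N (e A) (e u) →
      Crossing (e ⁻¹' P) (e ⁻¹' N) A u := by
    rintro P N ⟨hu, ε, hε, hs⟩
    rw [e.norm_map] at hu
    rcases he with he | he
    · left
      refine ⟨hu, ε, hε, fun ψ h0 h1 => ?_⟩
      obtain ⟨h2, h3⟩ := hs ψ h0 h1
      exact ⟨by rw [mem_preimage, map_add, he]; exact h2,
        by rw [mem_preimage, map_add, he]; exact h3⟩
    · right
      refine ⟨hu, ε, hε, fun ψ h0 h1 => ?_⟩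
      obtain ⟨h2, h3⟩ := hs ψ h0 h1
      exact ⟨by rw [mem_preimage, map_add, he, neg_neg]; exact h3,
        by rw [mem_preimage, map_add, he]; exact h2⟩
  rcases hc with hc | hc
  · exact key hc
  · exact (key hc).swap

lemma mem_dirs_preimage {e : ℂ ≃ₗᵢ[ℝ] ℂ} {E : Set ℂ} {A d : ℂ} :
    d ∈ dirs (e ⁻¹' E) A ↔ e d ∈ dirs E (e A) := by
  simp only [dirs, mem_ofPred_eq, e.norm_map, mem_preimage, map_add, map_ofReal_mul]

lemma Near.preimage {e : ℂ ≃ₗᵢ[ℝ] ℂ} (he : CircleMap e) {A x : ℂ}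
    (hx : Near P N (e A) (e x)) : Near (e ⁻¹' P) (e ⁻¹' N) A x := by
  refine ⟨hx.1.preimage he, fun d hd => ?_⟩
  rw [bdry_preimage, mem_dirs_preimage] at hd
  rw [← dot_map e]
  exact hx.2 _ hd

/-- Multiplication by a unit. -/
noncomputable def mulUnit (c : ℂ) (hc : ‖c‖ = 1) : ℂ ≃ₗᵢ[ℝ] ℂ :=
  rotation ⟨c, mem_sphere_zero_iff_norm.2 hc⟩

@[simp] lemma mulUnit_apply (c : ℂ) (hc : ‖c‖ = 1) (z : ℂ) : mulUnit c hc z = c * z := rfl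

lemma circleMap_mulUnit (c : ℂ) (hc : ‖c‖ = 1) : CircleMap (mulUnit c hc) :=
  Or.inl fun u ψ => by simp [mul_assoc]

/-- The reflection in the imaginary axis. -/
noncomputable def reflect : ℂ ≃ₗᵢ[ℝ] ℂ := Complex.conjLIE.trans (LinearIsometryEquiv.neg ℝ)

@[simp] lemma reflect_apply (z : ℂ) : reflect z = ⟨-z.re, z.im⟩ := by
  apply Complex.ext <;> simp [reflect]

lemma circleMap_reflect : CircleMap reflect :=
  Or.inr fun u ψ => by
    apply Complex.ext
    · simp; ring
    · simp

/-! ### Some topology -/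

/-- A locally constant predicate on a preconnected set is constant. -/
lemma isPreconnected_locally_constant {X : Type*} [PseudoMetricSpace X] {S : Set X}
    (hS : IsPreconnected S) {p : X → Prop}
    (hp : ∀ x ∈ S, ∃ r > 0, ∀ y ∈ S, dist y x < r → (p y ↔ p x)) {a b : X} (ha : a ∈ S)
    (hb : b ∈ S) (hpa : p a) : p b := by
  by_contra hpb
  choose! r hr hloc using hp
  set U : Set X := ⋃ x ∈ {x | x ∈ S ∧ p x}, Metric.ball x (r x) with hU
  set V : Set X := ⋃ x ∈ {x | x ∈ S ∧ ¬ p x}, Metric.ball x (r x) with hV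
  have hUo : IsOpen U := isOpen_biUnion fun _ _ => Metric.isOpen_ball
  have hVo : IsOpen V := isOpen_biUnion fun _ _ => Metric.isOpen_ball
  have hUm : ∀ x ∈ S, p x → x ∈ U := fun x hx hpx =>
    mem_iUnion₂.2 ⟨x, ⟨hx, hpx⟩, Metric.mem_ball_self (hr x hx)⟩
  have hVm : ∀ x ∈ S, ¬ p x → x ∈ V := fun x hx hpx =>
    mem_iUnion₂.2 ⟨x, ⟨hx, hpx⟩, Metric.mem_ball_self (hr x hx)⟩
  have hcov : S ⊆ U ∪ V := fun x hx => by
    by_cases hpx : p x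
    · exact Or.inl (hUm x hx hpx)
    · exact Or.inr (hVm x hx hpx)
  obtain ⟨y, hyS, hyU, hyV⟩ := hS U V hUo hVo hcov ⟨a, ha, hUm a ha hpa⟩ ⟨b, hb, hVm b hb hpb⟩
  obtain ⟨x, ⟨hx, hpx⟩, hxy⟩ := mem_iUnion₂.1 hyU
  obtain ⟨x', ⟨hx', hpx'⟩, hxy'⟩ := mem_iUnion₂.1 hyV
  exact hpx' ((hloc x' hx' y hyS hxy').1 ((hloc x hx y hyS hxy).2 hpx))

/-- The region between two continuous graphs over an interval is connected. -/
lemma isPreconnected_between {f g : ℝ → ℝ} (hf : Continuous f) (hg : Continuous g)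
    (hfg : ∀ t, f t < g t) {I : Set ℝ} (hI : IsPreconnected I) :
    IsPreconnected {z : ℂ | z.re ∈ I ∧ f z.re < z.im ∧ z.im < g z.re} := by
  have h1 : IsPreconnected ((fun q : ℝ × ℝ =>
      ((q.1 : ℝ) : ℂ) + (((1 - q.2) * f q.1 + q.2 * g q.1 : ℝ) : ℂ) * Complex.I) ''
      (I ×ˢ Ioo (0 : ℝ) 1)) := by
    apply (hI.prod isPreconnected_Ioo).image
    apply Continuous.continuousOn
    fun_prop
  convert h1 using 1
  ext z
  constructor
  · rintro ⟨hz, h2, h3⟩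
    have hpos : 0 < g z.re - f z.re := by linarith
    refine ⟨(z.re, (z.im - f z.re) / (g z.re - f z.re)), ⟨hz, ?_, ?_⟩, ?_⟩
    · exact div_pos (by linarith) hpos
    · show (z.im - f z.re) / (g z.re - f z.re) < 1
      rw [div_lt_one hpos]; linarith
    · have e : (1 - (z.im - f z.re) / (g z.re - f z.re)) * f z.re +
          (z.im - f z.re) / (g z.re - f z.re) * g z.re = z.im := by
        field_simp; ring
      apply Complex.ext
      · simp only [e]; simp
      · simp only [e]; simp
  · rintro ⟨⟨t, s⟩, ⟨ht, hs0, hs1⟩, rfl⟩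
    have := hfg t
    simp only at hs0 hs1 ht
    simp only [mem_ofPred_eq, Complex.add_re, Complex.ofReal_re, Complex.mul_re, Complex.I_re,
      mul_zero, Complex.ofReal_im, Complex.I_im, mul_one, sub_zero, add_zero, Complex.add_im,
      Complex.mul_im, zero_add]
    refine ⟨ht, ?_, ?_⟩ <;> nlinarith

lemma exists_last_zero {h : ℝ → ℝ} (hc : Continuous h) {a b : ℝ} (hab : a < b) (ha : h a ≤ 0)
    (hb : 0 < h b) : ∃ c ∈ Ico a b, h c = 0 ∧ ∀ x ∈ Ioc c b, 0 < h x := by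
  set S : Set ℝ := {x | x ∈ Icc a b ∧ h x ≤ 0} with hS
  have hSne : S.Nonempty := ⟨a, ⟨le_rfl, hab.le⟩, ha⟩
  have hSb : BddAbove S := ⟨b, fun x hx => hx.1.2⟩
  have hScl : IsClosed S := isClosed_Icc.inter (isClosed_le hc continuous_const)
  have hm := hScl.csSup_mem hSne hSb
  set c := sSup S
  have hpos : ∀ x ∈ Ioc c b, 0 < h x := by
    intro x hx
    by_contra! hle
    exact absurd (le_csSup hSb (show x ∈ S from ⟨⟨hm.1.1.trans hx.1.le, hx.2⟩, hle⟩))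
      (not_le.2 hx.1)
  have hcb : c < b := lt_of_le_of_ne hm.1.2 (by rintro h1; rw [h1] at hm; linarith [hm.2])
  refine ⟨c, ⟨hm.1.1, hcb⟩, le_antisymm hm.2 ?_, hpos⟩
  have hcl : c ∈ closure (Ioc c b) := by
    rw [closure_Ioc hcb.ne]; exact ⟨le_rfl, hcb.le⟩
  have : closure (Ioc c b) ⊆ {x | 0 ≤ h x} :=
    closure_minimal (fun x hx => (hpos x hx).le) (isClosed_le continuous_const hc)
  exact this hcl

lemma exists_first_zero {h : ℝ → ℝ} (hc : Continuous h) {a b : ℝ} (hab : a < b) (ha : h a < 0)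
    (hb : 0 ≤ h b) : ∃ c ∈ Ioc a b, h c = 0 ∧ ∀ x ∈ Ico a c, h x < 0 := by
  obtain ⟨c, hc1, hc2, hc3⟩ := exists_last_zero (h := fun x => -h (-x)) (a := -b) (b := -a)
    (by fun_prop) (by linarith) (by simpa using hb) (by simpa using ha)
  refine ⟨-c, ⟨by linarith [hc1.2], by linarith [hc1.1]⟩, by linarith, fun x hx => ?_⟩
  have := hc3 (-x) ⟨by linarith [hx.2], by linarith [hx.1]⟩
  rw [neg_neg] at this
  linarith

/-- A continuous function whose one-sided slopes are at least `k` grows at least with slope `k`. -/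
lemma mul_sub_le_of_right_slope {f : ℝ → ℝ} (hf : Continuous f) {k : ℝ}
    (hk : ∀ t, ∃ m, k ≤ m ∧ ∃ δ > 0, ∀ x, 0 ≤ x → x < δ → f (t + x) = f t + m * x) {a b : ℝ}
    (hab : a ≤ b) : k * (b - a) ≤ f b - f a := by
  set S : Set ℝ := {x | k * (x - a) ≤ f x - f a} with hS
  have hcl : IsClosed (S ∩ Icc a b) :=
    (isClosed_le (by fun_prop) (by fun_prop)).inter isClosed_Icc
  have hsub := hcl.Icc_subset_of_forall_exists_gt (by simp [hS]) (by
    rintro x ⟨hx, hxab⟩ y hy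
    obtain ⟨m, hm, δ, hδ, hfx⟩ := hk x
    have hxy : x < y := hy
    have hpos : 0 < min (δ / 2) (y - x) := lt_min (by positivity) (by linarith)
    refine ⟨x + min (δ / 2) (y - x), ?_, by linarith, by linarith [min_le_right (δ / 2) (y - x)]⟩
    have e := hfx _ hpos.le (by linarith [min_le_left (δ / 2) (y - x)])
    have hx' : k * (x - a) ≤ f x - f a := hx
    show k * (_ - a) ≤ _ - f a
    rw [e]
    nlinarith)
  exact hsub (right_mem_Icc.2 hab)

/-! ### Continuation of a local graph -/

lemma norm_mk_le (x y : ℝ) : ‖(⟨x, y⟩ : ℂ)‖ ≤ |x| + |y| := Complex.norm_le_abs_re_add_abs_im _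

lemma continuous_mk {f g : ℝ → ℝ} (hf : Continuous f) (hg : Continuous g) :
    Continuous fun t => (⟨f t, g t⟩ : ℂ) := by
  have : (fun t => (⟨f t, g t⟩ : ℂ)) = fun t => (f t : ℂ) + (g t : ℂ) * Complex.I := by
    funext t; apply Complex.ext <;> simp
  rw [this]
  fun_prop

/-- `G` is, to the right of each of its points and near it, a ray of slope at most one. -/
def RightRays (G : Set ℂ) : Prop :=
  ∀ A ∈ G, ∃ m δ : ℝ, |m| ≤ 1 ∧ 0 < δ ∧ ∀ z : ℂ, ‖z‖ < δ → 0 ≤ z.re →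
    (A + z ∈ G ↔ z.im = m * z.re)

/-- Wherever the two graphs meet, both must follow the single ray of `G` to the right; the Lipschitz
bound keeps them inside the disc where `G` is that ray. -/
lemma RightRays.unique {G : Set ℂ} (hG : RightRays G) {f g : ℝ → ℝ} (hf : LipschitzWith 1 f)
    (hg : LipschitzWith 1 g) {a b : ℝ} (hfa : f a = g a)
    (hfG : ∀ s ∈ Icc a b, (⟨s, f s⟩ : ℂ) ∈ G) (hgG : ∀ s ∈ Icc a b, (⟨s, g s⟩ : ℂ) ∈ G) :
    ∀ s ∈ Icc a b, f s = g s := by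
  have hcl : IsClosed ({s | f s = g s} ∩ Icc a b) :=
    (isClosed_eq hf.continuous hg.continuous).inter isClosed_Icc
  refine hcl.Icc_subset_of_forall_exists_gt hfa ?_
  rintro x ⟨hx, hxa, hxb⟩ y hy
  have hx : f x = g x := hx
  obtain ⟨m, δ, -, hδ, hloc⟩ := hG _ (hfG x ⟨hxa, hxb.le⟩)
  have hxy : x < y := hy
  obtain ⟨s, hxs, hs⟩ := exists_between (lt_min hxb (lt_min hxy
    (show x < x + δ / 2 by linarith)))
  have hsb := hs.trans_le (min_le_left _ _)
  have hsy := hs.trans_le ((min_le_right _ _).trans (min_le_left _ _))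
  have hsδ := hs.trans_le ((min_le_right _ _).trans (min_le_right _ _))
  refine ⟨s, ?_, hxs, hsy.le⟩
  have key : ∀ {φ : ℝ → ℝ}, LipschitzWith 1 φ → φ x = f x → (⟨s, φ s⟩ : ℂ) ∈ G →
      φ s = f x + m * (s - x) := by
    intro φ hφ hφx hmem
    have h1 : |φ s - φ x| ≤ |s - x| := by
      have := hφ.dist_le_mul s x
      rwa [Real.dist_eq, Real.dist_eq, NNReal.coe_one, one_mul] at this
    rw [abs_of_pos (by linarith : 0 < s - x), hφx] at h1
    have h2 : ‖(⟨s - x, φ s - f x⟩ : ℂ)‖ < δ := by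
      refine (norm_mk_le _ _).trans_lt ?_
      rw [abs_of_pos (by linarith : 0 < s - x)]
      linarith
    have h3 := (hloc ⟨s - x, φ s - f x⟩ h2 (by simp only; linarith)).1 (by
      convert hmem using 1
      apply Complex.ext <;> simp)
    simp only at h3
    linarith
  show f s = g s
  rw [key hf rfl (hfG s ⟨by linarith, hsb.le⟩), key hg hx.symm (hgG s ⟨by linarith, hsb.le⟩)]

/-- A closed set of that kind contains, to the right of each point, the graph of a Lipschitz
function. -/
lemma RightRays.exists_graph {G : Set ℂ} (hG : RightRays G) (hcl : IsClosed G) {A : ℂ}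
    (hA : A ∈ G) : ∃ f : ℝ → ℝ, LipschitzWith 1 f ∧ f A.re = A.im ∧
      ∀ s, A.re ≤ s → (⟨s, f s⟩ : ℂ) ∈ G := by
  set a := A.re with ha
  set T : Set ℝ := {t | a ≤ t ∧ ∃ f : ℝ → ℝ, LipschitzWith 1 f ∧ f a = A.im ∧
    ∀ s ∈ Icc a t, (⟨s, f s⟩ : ℂ) ∈ G} with hT
  have hdown : ∀ s t, a ≤ s → s ≤ t → t ∈ T → s ∈ T := by
    rintro s t hs hst ⟨-, f, h1, h2, h3⟩
    exact ⟨hs, f, h1, h2, fun x hx => h3 x ⟨hx.1, hx.2.trans hst⟩⟩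
  have haT : a ∈ T := by
    refine ⟨le_rfl, fun _ => A.im, LipschitzWith.const' _, rfl, fun s hs => ?_⟩
    have : s = a := le_antisymm hs.2 hs.1
    rw [this]; exact hA
  -- By uniqueness the solutions up to different endpoints agree, so the diagonal `s ↦ f s s` is
  -- Lipschitz on `I` and extends to the line.
  have hglue : ∀ I : Set ℝ, I ⊆ T → a ∈ I → ∃ g : ℝ → ℝ, LipschitzWith 1 g ∧ g a = A.im ∧
      ∀ s ∈ I, (⟨s, g s⟩ : ℂ) ∈ G := by
    intro I hI haI
    choose! f hf1 hf2 hf3 using fun t (ht : t ∈ T) => ht.2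
    have hlip : LipschitzOnWith 1 (fun s => f s s) I := by
      apply LipschitzOnWith.of_dist_le_mul
      have main : ∀ s ∈ I, ∀ t ∈ I, s ≤ t → dist (f s s) (f t t) ≤ dist s t := by
        intro s hs t ht hst
        have hsT := hI hs
        have htT := hI ht
        have := hG.unique (hf1 s hsT) (hf1 t htT) (by rw [hf2 s hsT, hf2 t htT]) (hf3 s hsT)
          (fun x hx => hf3 t htT x ⟨hx.1, hx.2.trans hst⟩) s ⟨hsT.1, le_rfl⟩
        rw [this]
        simpa using (hf1 t htT).dist_le_mul s t
      intro s hs t ht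
      rw [NNReal.coe_one, one_mul]
      rcases le_total s t with hst | hst
      · exact main s hs t ht hst
      · rw [dist_comm, dist_comm s t]; exact main t ht s hs hst
    obtain ⟨g, hg, hgI⟩ := hlip.extend_real
    refine ⟨g, hg, ?_, fun s hs => ?_⟩
    · rw [← hgI haI]; exact hf2 a (hI haI)
    · rw [← hgI hs]; exact hf3 s (hI hs) s ⟨(hI hs).1, le_rfl⟩
  have hTcl : IsClosed T := by
    refine isClosed_of_closure_subset fun c hc => ?_
    by_cases hex : ∃ t ∈ T, c ≤ t
    · obtain ⟨t, ht, hct⟩ := hex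
      have hac : a ≤ c := by
        have : closure T ⊆ Ici a := closure_minimal (fun x hx => hx.1) isClosed_Ici
        exact this hc
      exact hdown c t hac hct ht
    · push Not at hex
      have hac : a < c := hex a haT
      have hI : Ico a c ⊆ T := by
        intro s hs
        obtain ⟨t, ht, hd⟩ := Metric.mem_closure_iff.1 hc (c - s) (by linarith [hs.2])
        rw [Real.dist_eq, abs_lt] at hd
        exact hdown s t hs.1 (by linarith) ht
      obtain ⟨g, hg1, hg2, hg3⟩ := hglue (Ico a c) hI ⟨le_rfl, hac⟩
      refine ⟨hac.le, g, hg1, hg2, ?_⟩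
      have hcl' : IsClosed {s : ℝ | (⟨s, g s⟩ : ℂ) ∈ G} :=
        hcl.preimage (continuous_mk continuous_id hg1.continuous)
      have := closure_minimal (s := Ico a c) hg3 hcl'
      rwa [closure_Ico hac.ne] at this
  have hall : Ici a ⊆ T := by
    intro b hb
    refine (hTcl.inter isClosed_Icc).Icc_subset_of_forall_exists_gt haT ?_ (right_mem_Icc.2 hb)
    rintro x ⟨⟨hax, f, hf1, hf2, hf3⟩, -⟩ y hy
    have hxy : x < y := hy
    obtain ⟨m, δ, hm, hδ, hloc⟩ := hG _ (hf3 x ⟨hax, le_rfl⟩)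
    obtain ⟨s, hxs, hs⟩ := exists_between (lt_min hxy (show x < x + δ / 2 by linarith))
    have hsy := hs.trans_le (min_le_left _ _)
    have hsδ := hs.trans_le (min_le_right _ _)
    -- Freeze `f` at `x` and continue along the ray of slope `m`.
    refine ⟨s, ⟨by linarith, fun t => f (min t x) + m * max (t - x) 0, ?_, ?_, ?_⟩, hxs, hsy.le⟩
    · apply LipschitzWith.of_dist_le_mul
      intro p q
      rw [NNReal.coe_one, one_mul, Real.dist_eq, Real.dist_eq]
      have h1 : |f (min p x) - f (min q x)| ≤ |min p x - min q x| := by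
        have := hf1.dist_le_mul (min p x) (min q x)
        rwa [NNReal.coe_one, one_mul, Real.dist_eq, Real.dist_eq] at this
      have h2 : |m * (max (p - x) 0 - max (q - x) 0)| ≤ |max (p - x) 0 - max (q - x) 0| := by
        rw [abs_mul]
        exact mul_le_of_le_one_left (abs_nonneg _) hm
      have h3 : |min p x - min q x| + |max (p - x) 0 - max (q - x) 0| ≤ |p - q| := by
        rcases le_total p x with hp | hp <;> rcases le_total q x with hq | hq
        · rw [min_eq_left hp, min_eq_left hq, max_eq_right (by linarith),
            max_eq_right (by linarith)]
          simp
        · rw [min_eq_left hp, min_eq_right hq, max_eq_right (by linarith),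
            max_eq_left (by linarith), abs_of_nonpos (by linarith), abs_of_nonpos (by linarith),
            abs_of_nonpos (by linarith)]
          linarith
        · rw [min_eq_right hp, min_eq_left hq, max_eq_left (by linarith),
            max_eq_right (by linarith), abs_of_nonneg (by linarith), abs_of_nonneg (by linarith),
            abs_of_nonneg (by linarith)]
          linarith
        · rw [min_eq_right hp, min_eq_right hq, max_eq_left (by linarith),
            max_eq_left (by linarith)]
          simp
      calc |f (min p x) + m * max (p - x) 0 - (f (min q x) + m * max (q - x) 0)|
          = |(f (min p x) - f (min q x)) + m * (max (p - x) 0 - max (q - x) 0)| := by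
            congr 1; ring
        _ ≤ |f (min p x) - f (min q x)| + |m * (max (p - x) 0 - max (q - x) 0)| := abs_add_le _ _
        _ ≤ |p - q| := by linarith
    · show f (min a x) + m * max (a - x) 0 = A.im
      rw [min_eq_left hax, max_eq_right (by linarith), hf2]; ring
    · intro t ht
      show (⟨t, f (min t x) + m * max (t - x) 0⟩ : ℂ) ∈ G
      rcases le_total t x with htx | htx
      · rw [min_eq_left htx, max_eq_right (by linarith), mul_zero, add_zero]
        exact hf3 t ⟨ht.1, htx⟩
      · rw [min_eq_right htx, max_eq_left (by linarith)]
        have h2 : ‖(⟨t - x, m * (t - x)⟩ : ℂ)‖ < δ := by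
          refine (norm_mk_le _ _).trans_lt ?_
          rw [abs_mul, abs_of_nonneg (by linarith : 0 ≤ t - x)]
          have : |m| * (t - x) ≤ t - x := mul_le_of_le_one_left (by linarith) hm
          linarith [ht.2]
        have := (hloc ⟨t - x, m * (t - x)⟩ h2 (by simp only; linarith)).2 rfl
        convert this using 1
        apply Complex.ext <;> simp
  obtain ⟨g, h1, h2, h3⟩ := hglue (Ici a) hall (mem_Ici.2 le_rfl)
  exact ⟨g, h1, h2, h3⟩

lemma exists_graph_of_rays {G : Set ℂ} (hG : RightRays G) (hG' : RightRays (reflect ⁻¹' G))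
    (hcl : IsClosed G) {A : ℂ} (hA : A ∈ G) :
    ∃ f : ℝ → ℝ, Continuous f ∧ f A.re = A.im ∧ ∀ s, (⟨s, f s⟩ : ℂ) ∈ G := by
  obtain ⟨f, hf1, hf2, hf3⟩ := hG.exists_graph hcl hA
  have hrr : reflect (reflect A) = A := by apply Complex.ext <;> simp
  obtain ⟨g, hg1, hg2, hg3⟩ := hG'.exists_graph (hcl.preimage reflect.continuous)
    (A := reflect A) (by rw [mem_preimage, hrr]; exact hA)
  simp only [reflect_apply] at hg2 hg3
  -- On either side of `A.re` one of the two terms is constantly `A.im`.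
  refine ⟨fun t => f (max t A.re) + g (max (-t) (-A.re)) - A.im, ?_, ?_, fun s => ?_⟩
  · have := hf1.continuous
    have := hg1.continuous
    fun_prop
  · simp [hf2, hg2]
  · show (⟨s, f (max s A.re) + g (max (-s) (-A.re)) - A.im⟩ : ℂ) ∈ G
    rcases le_total s A.re with hs | hs
    · rw [max_eq_right hs, max_eq_left (by linarith), hf2, add_sub_cancel_left]
      have := hg3 (-s) (by linarith)
      rw [mem_preimage, reflect_apply] at this
      simpa using this
    · rw [max_eq_left hs, max_eq_right (by linarith), hg2, add_sub_cancel_right]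
      exact hf3 s hs

/-! ### Branches of the boundary -/

/-- At a boundary point with horizontal crossing, the boundary is locally the union of a ray to
the right and a ray to the left, both of slope less than thirty degrees. -/
lemma Near.rays (h : ConicColoring P N) {A : ℂ} (hA : A ∈ bdry P N) (hx : Near P N A 1) :
    ∃ dr ∈ dirs (bdry P N) A, ∃ dl ∈ dirs (bdry P N) A, 0 < dr.re ∧ dl.re < 0 ∧ ∃ δ > 0,
      ∀ z : ℂ, ‖z‖ < δ → (A + z ∈ bdry P N ↔
        (0 ≤ z.re ∧ z.im = dr.im / dr.re * z.re) ∨ (z.re ≤ 0 ∧ z.im = dl.im / dl.re * z.re)) := by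
  have hdot : ∀ d : ℂ, dot d 1 = d.re := by intro d; simp [dot]
  -- Different directions have real parts of opposite signs, so there are at most two; since there
  -- are no loose ends, there are exactly two.
  have hopp : ∀ d ∈ dirs (bdry P N) A, ∀ e ∈ dirs (bdry P N) A, d ≠ e → d.re * e.re < 0 := by
    intro d hd e he hne
    have := hx.1.dot_mul_dot_neg h hA hd he hne
    rwa [hdot, hdot] at this
  obtain ⟨dr, hdr, dl, hdl, h1, h2⟩ : ∃ dr ∈ dirs (bdry P N) A, ∃ dl ∈ dirs (bdry P N) A,
      0 < dr.re ∧ dl.re < 0 := by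
    obtain ⟨d, hd⟩ := h.dirs_nonempty hA
    obtain ⟨e, he, hne⟩ := h.exists_dirs_ne hA d
    have := hopp d hd e he hne.symm
    rcases lt_or_ge 0 d.re with h0 | h0
    · exact ⟨d, hd, e, he, h0, by nlinarith⟩
    · have h0' : d.re < 0 := lt_of_le_of_ne h0 (by intro h3; rw [h3] at this; linarith)
      exact ⟨e, he, d, hd, by nlinarith, h0'⟩
  obtain ⟨-, R, hR, hRD⟩ := h.exists_conic A
  refine ⟨dr, hdr, dl, hdl, h1, h2, R, hR, fun z hz => ?_⟩
  rw [hRD z hz]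
  constructor
  · rintro ⟨d, hd, t, ht, rfl⟩
    have hre : ((t : ℂ) * d).re = t * d.re := by simp
    have him : ((t : ℂ) * d).im = t * d.im := by simp
    rw [hre, him]
    by_cases hdd : d = dr
    · left
      rw [hdd]
      exact ⟨by positivity, by field_simp⟩
    · right
      have hdd' : d = dl := by
        by_contra hne
        have k1 := hopp d hd dr hdr hdd
        have k2 := hopp d hd dl hdl hne
        nlinarith
      rw [hdd']
      exact ⟨by nlinarith, by have := h2.ne; field_simp⟩
  · rintro (⟨h3, h4⟩ | ⟨h3, h4⟩)
    · refine ⟨dr, hdr, z.re / dr.re, by positivity, ?_⟩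
      apply Complex.ext
      · simp only [Complex.mul_re, Complex.ofReal_re, Complex.ofReal_im, zero_mul, sub_zero]
        field_simp
      · simp only [Complex.mul_im, Complex.ofReal_re, Complex.ofReal_im, zero_mul, add_zero]
        rw [h4]; ring
    · refine ⟨dl, hdl, z.re / dl.re, div_nonneg_of_nonpos h3 h2.le, ?_⟩
      have := h2.ne
      apply Complex.ext
      · simp only [Complex.mul_re, Complex.ofReal_re, Complex.ofReal_im, zero_mul, sub_zero]
        field_simp
      · simp only [Complex.mul_im, Complex.ofReal_re, Complex.ofReal_im, zero_mul, add_zero]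
        rw [h4]; ring

lemma Near.im_sq_lt {A d : ℂ} (hx : Near P N A 1) (hd : d ∈ dirs (bdry P N) A) :
    3 * d.im ^ 2 < d.re ^ 2 ∧ d.im ^ 2 < 1 / 4 := by
  have h1 := hx.2 d hd
  have h2 := norm_eq_one_iff.1 hd.1
  have : dot d 1 = d.re := by simp [dot]
  rw [this] at h1
  constructor <;> nlinarith

lemma abs_slope_le {d : ℂ} (hne : d.re ≠ 0) (hd : 3 * d.im ^ 2 < d.re ^ 2) :
    Real.sqrt 3 * |d.im / d.re| ≤ 1 ∧ |d.im / d.re| ≤ 1 := by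
  have h1 : 3 * (d.im / d.re) ^ 2 < 1 := by
    rw [div_pow, mul_div_assoc', div_lt_one (by positivity)]
    exact hd
  have h2 : Real.sqrt 3 * |d.im / d.re| ≤ 1 := by
    apply le_of_sq_le_sq _ zero_le_one
    rw [mul_pow, sq_abs, Real.sq_sqrt (by norm_num)]
    linarith
  refine ⟨h2, ?_⟩
  nlinarith [sqrt_three_bounds, abs_nonneg (d.im / d.re)]

/-- The graph of `f` is part of the boundary, with a horizontal crossing along it. -/
structure Branch (P N : Set ℂ) (f : ℝ → ℝ) : Prop where
  cont : Continuous f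
  mem : ∀ t, (⟨t, f t⟩ : ℂ) ∈ bdry P N
  near : ∀ t, Near P N ⟨t, f t⟩ 1

lemma Branch.swap {f : ℝ → ℝ} (hf : Branch P N f) : Branch N P f :=
  ⟨hf.cont, fun t => mem_bdry_comm (hf.mem t), fun t => (hf.near t).swap⟩

lemma ConicColoring.rightRays (h : ConicColoring P N) :
    RightRays {A | A ∈ bdry P N ∧ Near P N A 1} := by
  rintro A ⟨hA, hx⟩
  obtain ⟨dr, hdr, dl, hdl, h1, h2, δ, hδ, hloc⟩ := hx.rays h hA
  obtain ⟨r, hr, hnear⟩ := h.near_locally_constant (x := 1) hA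
  refine ⟨dr.im / dr.re, min δ r, (abs_slope_le h1.ne' (hx.im_sq_lt hdr).1).2, lt_min hδ hr,
    fun z hz hz0 => ?_⟩
  have hz1 := hz.trans_le (min_le_left _ _)
  have hz2 := hz.trans_le (min_le_right _ _)
  have hz3 : A + z ∈ bdry P N → Near P N (A + z) 1 := fun hm =>
    (hnear _ hm (by rwa [add_sub_cancel_left])).2 hx
  have : A + z ∈ {A | A ∈ bdry P N ∧ Near P N A 1} ↔ A + z ∈ bdry P N :=
    ⟨fun hm => hm.1, fun hm => ⟨hm, hz3 hm⟩⟩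
  rw [this, hloc z hz1]
  constructor
  · rintro (⟨-, h4⟩ | ⟨h3, h4⟩)
    · exact h4
    · have : z.re = 0 := le_antisymm h3 hz0
      rw [this, mul_zero] at h4 ⊢
      exact h4
  · intro h4
    exact Or.inl ⟨hz0, h4⟩

/-- The boundary points with near crossing `1` form a closed set, by local constancy. It continues
along a ray to the right of each of its points and, by reflection, to the left. -/
lemma ConicColoring.exists_branch (h : ConicColoring P N) {A : ℂ} (hA : A ∈ bdry P N)
    (hx : Near P N A 1) : ∃ f, Branch P N f ∧ f A.re = A.im := by
  set G : Set ℂ := {A | A ∈ bdry P N ∧ Near P N A 1} with hG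
  have hcl : IsClosed G := by
    refine isClosed_of_closure_subset fun p hp => ?_
    have hpb : p ∈ bdry P N := closure_minimal (fun x hx => hx.1) h.isClosed_bdry hp
    obtain ⟨r, hr, hnear⟩ := h.near_locally_constant (x := 1) hpb
    obtain ⟨q, hq, hd⟩ := Metric.mem_closure_iff.1 hp r hr
    rw [dist_comm, dist_eq_norm] at hd
    exact ⟨hpb, (hnear q hq.1 hd).1 hq.2⟩
  have hneg : ∀ {P N : Set ℂ}, ConicColoring P N → ∀ z, z ∈ bdry P N → Near P N z 1 →
      Near P N z (reflect 1) := by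
    intro P N h z hz hn
    have : reflect 1 = -1 := by apply Complex.ext <;> simp
    rw [this]
    exact hn.neg h hz
  have hrr : ∀ S : Set ℂ, reflect ⁻¹' (reflect ⁻¹' S) = S := by
    intro S; ext z
    have : reflect (reflect z) = z := by apply Complex.ext <;> simp
    rw [mem_preimage, mem_preimage, this]
  have hGr : reflect ⁻¹' G =
      {A | A ∈ bdry (reflect ⁻¹' P) (reflect ⁻¹' N) ∧
        Near (reflect ⁻¹' P) (reflect ⁻¹' N) A 1} := by
    ext z
    have h' := h.preimage reflect
    constructor
    · rintro ⟨h1, h2⟩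
      exact ⟨h1, (hneg h _ h1 h2).preimage circleMap_reflect⟩
    · rintro ⟨h1, h2⟩
      refine ⟨h1, ?_⟩
      have hrz : reflect (reflect z) = z := by apply Complex.ext <;> simp
      have := (show Near (reflect ⁻¹' P) (reflect ⁻¹' N) (reflect (reflect z)) (reflect 1) by
        rw [hrz]; exact hneg h' z h1 h2).preimage circleMap_reflect
      rwa [hrr, hrr] at this
  obtain ⟨f, hf1, hf2, hf3⟩ := exists_graph_of_rays h.rightRays
    (by rw [hGr]; exact (h.preimage reflect).rightRays) hcl (A := A) ⟨hA, hx⟩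
  exact ⟨f, ⟨hf1, fun t => (hf3 t).1, fun t => (hf3 t).2⟩, hf2⟩

lemma Branch.right_slope (h : ConicColoring P N) {f : ℝ → ℝ} (hf : Branch P N f) (t : ℝ) :
    ∃ d ∈ dirs (bdry P N) ⟨t, f t⟩, 0 < d.re ∧ ∃ δ > 0, ∀ x, 0 ≤ x → x < δ →
      f (t + x) = f t + d.im / d.re * x := by
  obtain ⟨dr, hdr, dl, hdl, h1, h2, δ, hδ, hloc⟩ := (hf.near t).rays h (hf.mem t)
  obtain ⟨η, hη, hcont⟩ := Metric.continuousAt_iff.1 (hf.cont.continuousAt (x := t)) (δ / 2)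
    (by positivity)
  refine ⟨dr, hdr, h1, min η (δ / 2), by positivity, fun x hx0 hx => ?_⟩
  have hx1 := hx.trans_le (min_le_left _ _)
  have hx2 := hx.trans_le (min_le_right _ _)
  have hd := hcont (show dist (t + x) t < η by
    rw [Real.dist_eq, add_sub_cancel_left, abs_of_nonneg hx0]; exact hx1)
  rw [Real.dist_eq] at hd
  have hn : ‖(⟨x, f (t + x) - f t⟩ : ℂ)‖ < δ := by
    refine (norm_mk_le _ _).trans_lt ?_
    rw [abs_of_nonneg hx0]
    linarith
  have := (hloc ⟨x, f (t + x) - f t⟩ hn).1 (by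
    convert hf.mem (t + x) using 1
    apply Complex.ext <;> simp)
  simp only at this
  rcases this with ⟨-, h3⟩ | ⟨h3, h4⟩
  · linarith
  · have : x = 0 := le_antisymm h3 hx0
    rw [this]; simp

lemma Branch.lipschitz (h : ConicColoring P N) {f : ℝ → ℝ} (hf : Branch P N f) (s t : ℝ) :
    Real.sqrt 3 * |f s - f t| ≤ |s - t| := by
  have hs3 := sqrt_three_pos
  have main : ∀ a b, a ≤ b → Real.sqrt 3 * |f b - f a| ≤ b - a := by
    intro a b hab
    have e1 : -(1 / Real.sqrt 3) * (b - a) ≤ f b - f a := by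
      refine mul_sub_le_of_right_slope hf.cont (fun t => ?_) hab
      obtain ⟨d, hd, hd0, δ, hδ, hx⟩ := hf.right_slope h t
      refine ⟨_, ?_, δ, hδ, hx⟩
      have := (abs_slope_le hd0.ne' ((hf.near t).im_sq_lt hd).1).1
      have h2 : |d.im / d.re| ≤ 1 / Real.sqrt 3 := by
        rw [le_div_iff₀ hs3]; linarith
      linarith [neg_abs_le (d.im / d.re)]
    have e2 : -(1 / Real.sqrt 3) * (b - a) ≤ -f b - -f a := by
      refine mul_sub_le_of_right_slope (f := fun t => -f t) hf.cont.neg (fun t => ?_) hab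
      obtain ⟨d, hd, hd0, δ, hδ, hx⟩ := hf.right_slope h t
      refine ⟨-(d.im / d.re), ?_, δ, hδ, fun x h0 h1 => by rw [hx x h0 h1]; ring⟩
      have := (abs_slope_le hd0.ne' ((hf.near t).im_sq_lt hd).1).1
      have h2 : |d.im / d.re| ≤ 1 / Real.sqrt 3 := by
        rw [le_div_iff₀ hs3]; linarith
      linarith [le_abs_self (d.im / d.re)]
    have e3 : |f b - f a| ≤ 1 / Real.sqrt 3 * (b - a) := by
      rw [abs_le]; constructor <;> linarith
    calc Real.sqrt 3 * |f b - f a| ≤ Real.sqrt 3 * (1 / Real.sqrt 3 * (b - a)) :=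
          mul_le_mul_of_nonneg_left e3 hs3.le
      _ = b - a := by field_simp
  rcases le_total s t with hst | hst
  · rw [abs_sub_comm, abs_sub_comm s t, abs_of_nonneg (by linarith : 0 ≤ t - s)]
    exact main s t hst
  · rw [abs_of_nonneg (by linarith : 0 ≤ s - t)]
    exact main t s hst

lemma Branch.eq_of_mem (h : ConicColoring P N) {f : ℝ → ℝ} (hf : Branch P N f) (t : ℝ) :
    ∃ δ > 0, ∀ z ∈ bdry P N, ‖z - ⟨t, f t⟩‖ < δ → z.im = f z.re := by
  obtain ⟨dr, hdr, dl, hdl, h1, h2, δ, hδ, hloc⟩ := (hf.near t).rays h (hf.mem t)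
  refine ⟨δ / 2, by positivity, fun z hz hzd => ?_⟩
  set x := z.re - t with hx
  have hs3 := sqrt_three_bounds
  have hxn : |x| < δ / 2 := by
    have := Complex.abs_re_le_norm (z - ⟨t, f t⟩)
    simp only [Complex.sub_re] at this
    exact this.trans_lt hzd
  have hn : ‖(⟨x, f z.re - f t⟩ : ℂ)‖ < δ := by
    refine (norm_mk_le _ _).trans_lt ?_
    have := hf.lipschitz h z.re t
    nlinarith [abs_nonneg (f z.re - f t)]
  have k1 := (hloc (z - ⟨t, f t⟩) (by linarith)).1 (by rwa [add_sub_cancel])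
  have k2 := (hloc ⟨x, f z.re - f t⟩ hn).1 (by
    convert hf.mem z.re using 1
    apply Complex.ext <;> simp [hx])
  simp only [Complex.sub_re, Complex.sub_im, ← hx] at k1 k2
  rcases k1 with ⟨a1, b1⟩ | ⟨a1, b1⟩ <;> rcases k2 with ⟨a2, b2⟩ | ⟨a2, b2⟩
  · linarith
  · have : x = 0 := le_antisymm a2 a1
    rw [this, mul_zero] at b1 b2; linarith
  · have : x = 0 := le_antisymm a1 a2
    rw [this, mul_zero] at b1 b2; linarith
  · linarith

/-- A branch is a connected component of the boundary. -/
lemma Branch.component_eq (h : ConicColoring P N) {f : ℝ → ℝ} (hf : Branch P N f)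
    (t : ℝ) : connectedComponentIn (bdry P N) ⟨t, f t⟩ = {z | z.im = f z.re} := by
  apply Subset.antisymm
  · intro z hz
    have hmem : (⟨t, f t⟩ : ℂ) ∈ connectedComponentIn (bdry P N) ⟨t, f t⟩ :=
      mem_connectedComponentIn (hf.mem t)
    refine isPreconnected_locally_constant isPreconnected_connectedComponentIn
      (p := fun z : ℂ => z.im = f z.re) (fun x hx => ?_) hmem hz rfl
    -- The graph is closed, and relatively open in the boundary by `Branch.eq_of_mem`.
    by_cases hp : x.im = f x.re
    · obtain ⟨δ, hδ, hloc⟩ := hf.eq_of_mem h x.re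
      refine ⟨δ, hδ, fun y hy hyx => ⟨fun _ => hp, fun _ => ?_⟩⟩
      refine hloc y (connectedComponentIn_subset _ _ hy) ?_
      have : (⟨x.re, f x.re⟩ : ℂ) = x := by apply Complex.ext <;> simp [hp]
      rwa [this, ← dist_eq_norm]
    · have hcl : IsClosed {z : ℂ | z.im = f z.re} :=
        isClosed_eq Complex.continuous_im (hf.cont.comp Complex.continuous_re)
      obtain ⟨δ, hδ, hball⟩ := Metric.isOpen_iff.1 hcl.isOpen_compl x hp
      exact ⟨δ, hδ, fun y _ hyx => ⟨fun hy => absurd hy (hball hyx), fun hx => absurd hx hp⟩⟩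
  · have : {z : ℂ | z.im = f z.re} = range fun t : ℝ => (⟨t, f t⟩ : ℂ) := by
      ext z
      constructor
      · intro hz
        exact ⟨z.re, by apply Complex.ext <;> simp [show z.im = f z.re from hz]⟩
      · rintro ⟨s, rfl⟩; rfl
    rw [this]
    refine (isPreconnected_range (continuous_mk continuous_id hf.cont)).subset_connectedComponentIn
      ⟨t, rfl⟩ ?_
    rintro _ ⟨s, rfl⟩
    exact hf.mem s

lemma Branch.eq_of_eq (h : ConicColoring P N) {f g : ℝ → ℝ} (hf : Branch P N f)
    (hg : Branch P N g) {t : ℝ} (ht : f t = g t) : f = g := by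
  have h1 := hf.component_eq h t
  rw [ht, hg.component_eq h t] at h1
  funext s
  have : (⟨s, g s⟩ : ℂ) ∈ {z : ℂ | z.im = g z.re} := rfl
  rw [h1] at this
  exact Eq.symm this

/-! ### Colors above and below a branch -/

/-- Near the point with abscissa `t`, the points above the graph of `f` are in `P` and those below
it are in `N`. -/
def Up (P N : Set ℂ) (f : ℝ → ℝ) (t : ℝ) : Prop :=
  ∃ δ > 0, ∀ z : ℂ, ‖z - ⟨t, f t⟩‖ < δ → (f z.re < z.im → z ∈ P) ∧ (z.im < f z.re → z ∈ N)

lemma Branch.abs_sub_le (h : ConicColoring P N) {f : ℝ → ℝ} (hf : Branch P N f) (s t : ℝ) :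
    |f s - f t| ≤ |s - t| := by
  nlinarith [hf.lipschitz h s t, sqrt_three_bounds, abs_nonneg (f s - f t)]

lemma Up.not_swap (h : ConicColoring P N) {f : ℝ → ℝ} {t : ℝ} (hu : Up P N f t) :
    ¬ Up N P f t := by
  rintro ⟨δ', hδ', h2⟩
  obtain ⟨δ, hδ, h1⟩ := hu
  have hpos : 0 < min δ δ' / 2 := by positivity
  have hn : ‖(⟨t, f t + min δ δ' / 2⟩ : ℂ) - ⟨t, f t⟩‖ < min δ δ' := by
    rw [norm_lt_iff (lt_min hδ hδ')]
    simp only [Complex.sub_re, Complex.sub_im, sub_self, add_sub_cancel_left]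
    nlinarith
  exact h.notMem_of_mem
    ((h1 _ (hn.trans_le (min_le_left _ _))).1 (by simp only; linarith))
    ((h2 _ (hn.trans_le (min_le_right _ _))).1 (by simp only; linarith))

lemma ConicColoring.one_color (h : ConicColoring P N) {S : Set ℂ} (hS : IsPreconnected S)
    (hSb : Disjoint S (bdry P N)) : S ⊆ P ∨ S ⊆ N := by
  rcases S.eq_empty_or_nonempty with rfl | ⟨p, hp⟩
  · exact Or.inl (empty_subset _)
  · rcases notMem_bdry.1 (Set.disjoint_left.1 hSb hp) with h1 | h1
    · exact Or.inl (h.subset_of_isPreconnected hS hSb hp h1)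
    · exact Or.inr (h.swap.subset_of_isPreconnected hS (by rwa [bdry_comm]) hp h1)

lemma Branch.up_or_up (h : ConicColoring P N) {f : ℝ → ℝ} (hf : Branch P N f) (t : ℝ) :
    Up P N f t ∨ Up N P f t := by
  obtain ⟨δ, hδ, hloc⟩ := hf.eq_of_mem h t
  -- A point within `η` of the abscissa and within `η` of the graph has vertical distance below `2 *
  -- η` from the center, so its distance is below `3 * η = δ`.
  set η := δ / 3 with hη
  have hη0 : 0 < η := by positivity
  have hclose : ∀ z : ℂ, z.re ∈ Ioo (t - η) (t + η) → |z.im - f z.re| < η →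
      ‖z - ⟨t, f t⟩‖ < δ := by
    intro z hz1 hz2
    refine (Complex.norm_le_abs_re_add_abs_im _).trans_lt ?_
    simp only [Complex.sub_re, Complex.sub_im]
    have h1 : |z.re - t| < η := by rw [abs_lt]; constructor <;> linarith [hz1.1, hz1.2]
    have h2 := hf.abs_sub_le h z.re t
    have h3 : |z.im - f t| ≤ |z.im - f z.re| + |f z.re - f t| := _root_.abs_sub_le _ _ _
    linarith
  have hU := h.one_color (isPreconnected_between hf.cont (hf.cont.add_const η)
    (fun s => by linarith) (isPreconnected_Ioo (a := t - η) (b := t + η))) (by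
      rw [Set.disjoint_left]
      rintro z ⟨h1, h2, h3⟩ hzb
      exact h2.ne' (hloc z hzb (hclose z h1 (by rw [abs_lt]; constructor <;> linarith))))
  have hL := h.one_color (isPreconnected_between (f := fun s => f s - η)
    (by have := hf.cont; fun_prop) hf.cont
    (fun s => by linarith) (isPreconnected_Ioo (a := t - η) (b := t + η))) (by
      rw [Set.disjoint_left]
      rintro z ⟨h1, h2, h3⟩ hzb
      exact h3.ne (hloc z hzb (hclose z h1 (by rw [abs_lt]; constructor <;> linarith))))
  have hsmall : ∀ z : ℂ, ‖z - ⟨t, f t⟩‖ < η / 3 →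
      z.re ∈ Ioo (t - η) (t + η) ∧ |z.im - f z.re| < η := by
    intro z hz
    have h1 := (Complex.abs_re_le_norm _).trans_lt hz
    have h2 := (Complex.abs_im_le_norm _).trans_lt hz
    simp only [Complex.sub_re, Complex.sub_im] at h1 h2
    have h3 := hf.abs_sub_le h t z.re
    rw [abs_sub_comm t] at h3
    have h4 : |z.im - f z.re| ≤ |z.im - f t| + |f t - f z.re| := _root_.abs_sub_le _ _ _
    obtain ⟨h5, h6⟩ := abs_lt.1 h1
    exact ⟨⟨by linarith, by linarith⟩, by linarith⟩
  have up : ∀ {P N : Set ℂ},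
      {z : ℂ | z.re ∈ Ioo (t - η) (t + η) ∧ f z.re < z.im ∧ z.im < f z.re + η} ⊆ P →
      {z : ℂ | z.re ∈ Ioo (t - η) (t + η) ∧ f z.re - η < z.im ∧ z.im < f z.re} ⊆ N →
      Up P N f t := by
    intro P N h1 h2
    refine ⟨η / 3, by positivity, fun z hz => ?_⟩
    obtain ⟨h3, h4⟩ := hsmall z hz
    obtain ⟨h5, h6⟩ := abs_lt.1 h4
    exact ⟨fun h7 => h1 ⟨h3, h7, by linarith⟩, fun h7 => h2 ⟨h3, by linarith, h7⟩⟩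
  have bad : ∀ {P N : Set ℂ}, ConicColoring P N → Branch P N f →
      {z : ℂ | z.re ∈ Ioo (t - η) (t + η) ∧ f z.re < z.im ∧ z.im < f z.re + η} ⊆ P →
      {z : ℂ | z.re ∈ Ioo (t - η) (t + η) ∧ f z.re - η < z.im ∧ z.im < f z.re} ⊆ P →
      (∀ z ∈ bdry P N, ‖z - ⟨t, f t⟩‖ < δ → z.im = f z.re) → False := by
    intro P N h hf h1 h2 hloc
    obtain ⟨n, hn, hd⟩ := Metric.mem_closure_iff.1 (h.right_dense (hf.mem t)) (η / 3)
      (by positivity)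
    rw [dist_comm, dist_eq_norm] at hd
    obtain ⟨h3, h4⟩ := hsmall n hd
    obtain ⟨h5, h6⟩ := abs_lt.1 h4
    rcases lt_trichotomy n.im (f n.re) with h7 | h7 | h7
    · exact h.notMem_of_mem (h2 ⟨h3, by linarith, h7⟩) hn
    · have hb := hf.mem n.re
      have : (⟨n.re, f n.re⟩ : ℂ) = n := by apply Complex.ext <;> simp [h7]
      rw [this] at hb
      exact hb (Or.inr hn)
    · exact h.notMem_of_mem (h1 ⟨h3, h7, by linarith⟩) hn
  rcases hU with hU | hU <;> rcases hL with hL | hL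
  · exact absurd (bad h hf hU hL hloc) id
  · exact Or.inl (up hU hL)
  · exact Or.inr (up hU hL)
  · exact absurd (bad h.swap hf.swap hU hL (by rwa [bdry_comm])) id

lemma Up.eventually {f : ℝ → ℝ} (hf : Continuous f) {t : ℝ} (hu : Up P N f t) :
    ∃ r > 0, ∀ s, dist s t < r → Up P N f s := by
  obtain ⟨δ, hδ, hu⟩ := hu
  obtain ⟨r, hr, hc⟩ := Metric.continuousAt_iff.1
    ((continuous_mk continuous_id hf).continuousAt (x := t)) (δ / 2) (by positivity)
  refine ⟨r, hr, fun s hs => ⟨δ / 2, by positivity, fun z hz => hu z ?_⟩⟩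
  have h1 := hc hs
  rw [dist_eq_norm] at h1
  calc ‖z - ⟨t, f t⟩‖ = ‖(z - ⟨s, f s⟩) + ((⟨s, f s⟩ : ℂ) - ⟨t, f t⟩)‖ := by congr 1; ring
    _ ≤ ‖z - ⟨s, f s⟩‖ + ‖(⟨s, f s⟩ : ℂ) - ⟨t, f t⟩‖ := norm_add_le _ _
    _ < δ := by
      have : ‖(⟨s, f s⟩ : ℂ) - ⟨t, f t⟩‖ < δ / 2 := h1
      linarith

lemma Branch.up_all_or (h : ConicColoring P N) {f : ℝ → ℝ} (hf : Branch P N f) :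
    (∀ t, Up P N f t) ∨ (∀ t, Up N P f t) := by
  have key : ∀ s t, Up P N f s → Up P N f t := by
    intro s t h0
    refine isPreconnected_locally_constant (p := fun t => Up P N f t) isPreconnected_univ
      (fun x _ => ?_) (mem_univ s) (mem_univ t) h0
    rcases hf.up_or_up h x with h1 | h1
    · obtain ⟨r, hr, h2⟩ := h1.eventually hf.cont
      exact ⟨r, hr, fun y _ hy => ⟨fun _ => h1, fun _ => h2 y hy⟩⟩
    · obtain ⟨r, hr, h2⟩ := h1.eventually hf.cont
      exact ⟨r, hr, fun y _ hy => ⟨fun h3 => absurd (h2 y hy) (h3.not_swap h),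
        fun h3 => absurd h1 (h3.not_swap h)⟩⟩
  by_cases h0 : Up P N f 0
  · exact Or.inl fun t => key 0 t h0
  · exact Or.inr fun t => (hf.up_or_up h t).resolve_left fun h1 => h0 (key t 0 h1)

/-- The straight pieces of a branch have the colors of the branch on their sides. -/
lemma Branch.sided (h : ConicColoring P N) {f : ℝ → ℝ} (hf : Branch P N f)
    (hu : ∀ t, Up P N f t) {t : ℝ} {d : ℂ} (hd : d ∈ dirs (bdry P N) ⟨t, f t⟩)
    (hd0 : 0 < d.re) : ∃ r > 0, ∀ s : ℝ, 0 < s → s < r → Sided P N (⟨t, f t⟩ + s * d) d := by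
  have hpos : 0 < dot d 1 := by simpa [dot] using hd0
  obtain ⟨r, hr, hs⟩ := (hf.near t).sided h (hf.mem t) hd hpos
  obtain ⟨δ, hδ, hloc⟩ := hf.eq_of_mem h t
  refine ⟨min r δ, lt_min hr hδ, fun s hs0 hs1 => ?_⟩
  obtain ⟨hq, -, ho, -⟩ := hs s hs0 (hs1.trans_le (min_le_left _ _))
  rcases ho with ho | ho
  · exact ho
  · exfalso
    set q : ℂ := ⟨t, f t⟩ + s * d with hqdef
    have hqf := hloc q hq (by
      rw [hqdef, add_sub_cancel_left, norm_ofReal_mul_unit hd.1 hs0.le]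
      exact hs1.trans_le (min_le_right _ _))
    have hq' : (⟨q.re, f q.re⟩ : ℂ) = q := by apply Complex.ext <;> simp [hqf]
    obtain ⟨ρ, hρ, hup⟩ := hu q.re
    rw [hq'] at hup
    obtain ⟨r', hr', hsd⟩ := ho
    have hε : 0 < min ρ r' / 2 := by positivity
    set z : ℂ := ⟨0, min ρ r' / 2⟩ with hz
    have hzn : ‖z‖ < min ρ r' := by
      rw [norm_lt_iff (lt_min hρ hr')]
      simp only [hz]
      nlinarith
    have h1 := (hup (q + z) (by
      rw [add_sub_cancel_left]; exact hzn.trans_le (min_le_left _ _))).1 (by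
        simp only [Complex.add_re, Complex.add_im, hz, add_zero]
        linarith)
    have h2 := (hsd z (hzn.trans_le (min_le_right _ _))).1 (by
      simp only [cross, hz]
      nlinarith)
    exact h.notMem_of_mem h1 h2

/-- Translation by `1` keeps the colors on the sides, so the circle, which moves upwards at its
rightmost point, passes there from the lower color `N` to the upper color `P`. -/
lemma Branch.switch (h : ConicColoring P N) {f : ℝ → ℝ} (hf : Branch P N f)
    (hu : ∀ t, Up P N f t) (t : ℝ) : Switch N P ⟨t, f t⟩ 1 := by
  obtain ⟨d, hd, hd0, -⟩ := hf.right_slope h t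
  have hpos : 0 < dot d 1 := by simpa [dot] using hd0
  obtain ⟨r, hr, hs⟩ := (hf.near t).sided h (hf.mem t) hd hpos
  obtain ⟨r', hr', hs'⟩ := hf.sided h hu hd hd0
  have h0 : 0 < min r r' / 2 := by positivity
  exact (hs _ h0 (by linarith [min_le_left r r'])).2.1.1
    (hs' _ h0 (by linarith [min_le_right r r']))

lemma Branch.translate {f : ℝ → ℝ} (hf : Branch P N f) {c : ℂ}
    (hc : ∀ A ∈ bdry P N, Near P N A 1 → A + c ∈ bdry P N ∧ Near P N (A + c) 1) :
    Branch P N fun t => f (t - c.re) + c.im := by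
  have e : ∀ t, (⟨t, f (t - c.re) + c.im⟩ : ℂ) = ⟨t - c.re, f (t - c.re)⟩ + c := by
    intro t; apply Complex.ext <;> simp
  refine ⟨?_, fun t => ?_, fun t => ?_⟩
  · have := hf.cont
    fun_prop
  · rw [e]; exact (hc _ (hf.mem _) (hf.near _)).1
  · rw [e]; exact (hc _ (hf.mem _) (hf.near _)).2

lemma Branch.translate_one (h : ConicColoring P N) {f : ℝ → ℝ} (hf : Branch P N f) :
    Branch P N fun t => f (t - 1) := by
  have := hf.translate (c := 1) fun A hA hn => ⟨hn.1.mem_bdry h, hn.translate h hA⟩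
  simpa using this

lemma Branch.translate_rot (h : ConicColoring P N) {f : ℝ → ℝ} (hf : Branch P N f) :
    Branch P N fun t => f (t - 1 / 2) + Real.sqrt 3 / 2 := by
  have := hf.translate (c := rot) fun A hA hn => by
    have h1 := (hn.1.rot h hA).mem_bdry h
    have h2 := hn.translate_rot h hA
    rw [mul_one] at h1 h2
    exact ⟨h1, h2⟩
  exact this

lemma Branch.translate_neg_rot (h : ConicColoring P N) {f : ℝ → ℝ} (hf : Branch P N f) :
    Branch P N fun t => f (t + 1 / 2) - Real.sqrt 3 / 2 := by
  have := hf.translate (c := -rot) fun A hA hn => by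
    have hn' := hn.neg h hA
    have h1 := (hn'.1.rot h hA).mem_bdry h
    have h2 := hn'.translate_rot h hA
    rw [mul_neg, mul_one] at h1 h2
    have h3 := h2.neg h h1
    rw [neg_neg] at h3
    exact ⟨h1, h3⟩
  simpa [sub_eq_add_neg] using this

/-- Translating a branch by sixty degrees reverses the colors. -/
lemma Branch.up_translate_rot (h : ConicColoring P N) {f : ℝ → ℝ} (hf : Branch P N f)
    (hu : ∀ t, Up P N f t) : ∀ t, Up N P (fun t => f (t - 1 / 2) + Real.sqrt 3 / 2) t := by
  have hg := hf.translate_rot h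
  obtain ⟨d, hd, hd0, -⟩ := hf.right_slope h 0
  have hpos : 0 < dot d 1 := by simpa [dot] using hd0
  obtain ⟨r, hr, hs⟩ := (hf.near 0).sided h (hf.mem 0) hd hpos
  obtain ⟨r', hr', hs'⟩ := hf.sided h hu hd hd0
  rcases hg.up_all_or h with h1 | h1
  · exfalso
    have e : (⟨1 / 2, f (1 / 2 - 1 / 2) + Real.sqrt 3 / 2⟩ : ℂ) = ⟨0, f 0⟩ + rot * 1 := by
      apply Complex.ext <;> simp
    have hd' : d ∈ dirs (bdry P N) ⟨1 / 2, f (1 / 2 - 1 / 2) + Real.sqrt 3 / 2⟩ := by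
      rw [e]
      exact ((hf.near 0).1.rot h (hf.mem 0)).dirs_subset h (hf.mem 0) hd
    obtain ⟨r'', hr'', hs''⟩ := hg.sided h h1 (t := 1 / 2) hd' hd0
    obtain ⟨s, hs0, hslt⟩ := exists_between (lt_min hr (lt_min hr' hr''))
    have k1 := hslt.trans_le (min_le_left _ _)
    have k2 := hslt.trans_le ((min_le_right _ _).trans (min_le_left _ _))
    have k3 := hslt.trans_le ((min_le_right _ _).trans (min_le_right _ _))
    have q1 := ((hs s hs0 k1).2.2.2 (hs' s hs0 k2)).2
    have q2 := hs'' s hs0 k3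
    rw [e] at q2
    obtain ⟨ρ, hρ, w1⟩ := q1
    obtain ⟨ρ', hρ', w2⟩ := q2
    have hpos' : 0 < min ρ ρ' / 2 := by positivity
    have hn : ‖(⟨0, min ρ ρ' / 2⟩ : ℂ)‖ < min ρ ρ' := by
      rw [norm_lt_iff (lt_min hρ hρ')]
      simp only
      nlinarith
    have hcr : 0 < cross d ⟨0, min ρ ρ' / 2⟩ := by
      simp only [cross]; nlinarith
    exact h.notMem_of_mem ((w2 _ (hn.trans_le (min_le_right _ _))).1 hcr)
      ((w1 _ (hn.trans_le (min_le_left _ _))).1 hcr)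
  · exact h1

/-! ### Comparison of a branch with its translate -/

/-- If `d`, which descends by less than thirty degrees, were no steeper upwards than the descending
vector `(c, -s)`, the latter would lie between `d` and the horizontal, less than thirty degrees from
`d`. -/
lemma dirs_cross_pos_of_far {c s : ℝ} (hc : 0 < c) (hs : 0 < s) (hcs : c * c + s * s = 1) {d : ℂ}
    (hd : ‖d‖ = 1) (hd0 : 0 < d.re) (hd1 : d.im ^ 2 < 1 / 4)
    (hfar : dot d ⟨c, -s⟩ ^ 2 ≤ 3 / 4) : 0 < c * d.im + s * d.re := by
  by_contra! hle
  have h1 := dot_sq_add_cross_sq_of_unit hd (w := ⟨c, -s⟩) (by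
    rw [norm_eq_one_iff]; simp only; linarith)
  have h2 : cross d ⟨c, -s⟩ = -(c * d.im + s * d.re) := by simp [cross]; ring
  have hc1 : c ≤ 1 := by nlinarith
  have h3 : d.im ≤ 0 := by
    by_contra! h4
    nlinarith [mul_pos hc h4, mul_pos hs hd0]
  have h4 : -(c * d.im + s * d.re) ≤ -d.im := by nlinarith [mul_pos hs hd0]
  rw [h2] at h1
  nlinarith

/-- A branch does not lie strictly below its translate. -/
lemma Branch.not_lt_translate (h : ConicColoring P N) {f : ℝ → ℝ} (hf : Branch P N f)
    (hu : ∀ t, Up P N f t) (hlt : ∀ t, f t < f (t - 1)) : False := by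
  set A : ℂ := ⟨0, f 0⟩ with hA
  have hAm : A ∈ bdry P N := hf.mem 0
  -- Height of the circle about `A` over the branch. It is `-1` at the lowest point and, by
  -- assumption, positive at the rightmost one. Just after its last zero `ψ₀` the circle is in `P`,
  -- and just before angle `0` it is in `N`, so there is a switch from `P` to `N` in between.
  set η : ℝ → ℝ := fun ψ => f 0 + Real.sin ψ - f (Real.cos ψ) with hη
  have hηc : Continuous η := by
    have := hf.cont
    fun_prop
  have hpi : (0 : ℝ) < Real.pi / 2 := by positivity
  obtain ⟨ψ₀, hψ₀, hz, hpos⟩ := exists_last_zero hηc (a := -(Real.pi / 2)) (b := 0)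
    (by linarith) (by simp [hη]) (by
      have := hlt 1
      simp only [hη, Real.sin_zero, Real.cos_zero]
      rw [sub_self] at this
      linarith)
  have hpt : ∀ ψ, A + 1 * cis ψ = ⟨Real.cos ψ, f 0 + Real.sin ψ⟩ := by
    intro ψ; apply Complex.ext <;> simp [hA]
  obtain ⟨δ, hδ, hup⟩ := hu (Real.cos ψ₀)
  have hz' : (⟨Real.cos ψ₀, f (Real.cos ψ₀)⟩ : ℂ) = A + 1 * cis ψ₀ := by
    rw [hpt]; simp only [hη] at hz
    congr 1; linarith
  rw [hz'] at hup
  obtain ⟨-, ε, hε, hsw⟩ := hf.switch h hu 0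
  obtain ⟨ψ₁, h01, h11⟩ := exists_between (lt_min (show ψ₀ < ψ₀ + δ by linarith) hψ₀.2)
  have h1δ := h11.trans_le (min_le_left _ _)
  have h10 := h11.trans_le (min_le_right _ _)
  have hP : A + 1 * cis ψ₁ ∈ P := by
    refine (hup _ ?_).1 ?_
    · have e : A + 1 * cis ψ₁ - (A + 1 * cis ψ₀) = cis ψ₀ * cis (ψ₁ - ψ₀) - cis ψ₀ := by
        rw [← cis_add]; ring_nf
      rw [e]
      refine (norm_mul_cis_sub_le (norm_cis _) _).trans_lt ?_
      rw [abs_of_pos (by linarith)]; linarith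
    · rw [hpt]
      have := hpos ψ₁ ⟨h01, h10.le⟩
      simp only [hη] at this
      simp only
      linarith
  obtain ⟨κ, hκ0, hκ⟩ := exists_between (lt_min hε (show 0 < -ψ₁ by linarith))
  have hκε := hκ.trans_le (min_le_left _ _)
  have hκψ := hκ.trans_le (min_le_right _ _)
  have hN : A + 1 * cis (-κ) ∈ N := (hsw κ hκ0 hκε).1
  obtain ⟨ψ, ⟨hψ1, hψ2⟩, hsψ⟩ := h.exists_switch (A := A) (u := 1) (by simp)
    (show ψ₁ < -κ by linarith) hP hN
  rw [one_mul] at hsψ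
  have hψ0 : ψ < 0 := by linarith
  have hψpi : -(Real.pi / 2) < ψ := by linarith [hψ₀.1]
  obtain ⟨c, hc⟩ : ∃ c, c = Real.cos ψ := ⟨_, rfl⟩
  obtain ⟨s, hs⟩ : ∃ s, s = -Real.sin ψ := ⟨_, rfl⟩
  have hc0 : 0 < c := by rw [hc]; exact Real.cos_pos_of_mem_Ioo ⟨hψpi, by linarith⟩
  have hs0 : 0 < s := by
    rw [hs]
    linarith [Real.sin_neg_of_neg_of_neg_pi_lt hψ0 (by linarith)]
  have hcs : c * c + s * s = 1 := by
    rw [hc, hs]; nlinarith [Real.sin_sq_add_cos_sq ψ]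
  have hu2 : cis ψ = ⟨c, -s⟩ := by rw [hc, hs, neg_neg]; rfl
  have habove : f c < f 0 - s := by
    have := hpos ψ ⟨by linarith, hψ0.le⟩
    simp only [hη] at this
    rw [← hc] at this
    linarith
  -- A near crossing would have to switch from `N` to `P`, by `Near.sided`. If it is not near, it is
  -- not near along the whole branch, so all slopes of `f` are at least `-(s / c)`; then `f c ≥ f 0
  -- - s`, whereas the circle is above the branch at `ψ`.
  by_cases hnear : Near P N A (cis ψ)
  · obtain ⟨d, hd, hd0, -⟩ := hf.right_slope h 0
    have him := ((hf.near 0).im_sq_lt hd).2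
    have h34 := hnear.2 d hd
    have hdd : 0 < dot d (cis ψ) := by
      by_contra! hle
      rw [hu2] at hle h34
      simp only [dot] at hle h34
      have hs1 : s ≤ 1 := by nlinarith
      have hcd : 0 < c * d.re := mul_pos hc0 hd0
      have him0 : 0 < d.im := by
        by_contra! hn
        nlinarith
      have : (d.re * c + d.im * -s) ^ 2 ≤ d.im ^ 2 := by
        apply sq_le_sq'
        · nlinarith
        · nlinarith
      linarith
    obtain ⟨r, hr, hsd⟩ := hnear.sided h hAm hd hdd
    obtain ⟨r', hr', hsd'⟩ := hf.sided h hu hd hd0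
    have h0 : 0 < min r r' / 2 := by positivity
    have := (hsd _ h0 (by linarith [min_le_left r r'])).2.1.1
      (hsd' _ h0 (by linarith [min_le_right r r']))
    exact this.not_swap h.swap hsψ
  · have hall : ∀ t, Crossing P N ⟨t, f t⟩ (cis ψ) ∧ ¬ Near P N ⟨t, f t⟩ (cis ψ) := by
      intro t
      refine isPreconnected_locally_constant (S := univ)
        (p := fun t : ℝ => Crossing P N ⟨t, f t⟩ (cis ψ) ∧ ¬ Near P N ⟨t, f t⟩ (cis ψ))
        isPreconnected_univ (fun x _ => ?_) (mem_univ 0) (mem_univ t) ⟨Or.inl hsψ, hnear⟩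
      obtain ⟨r₁, hr₁, l1⟩ := h.crossing_locally_constant (u := cis ψ) (hf.mem x)
      obtain ⟨r₂, hr₂, l2⟩ := h.near_locally_constant (x := cis ψ) (hf.mem x)
      obtain ⟨r, hr, hcont⟩ := Metric.continuousAt_iff.1
        ((continuous_mk continuous_id hf.cont).continuousAt (x := x)) (min r₁ r₂)
        (lt_min hr₁ hr₂)
      refine ⟨r, hr, fun y _ hy => ?_⟩
      have hd := hcont hy
      rw [dist_eq_norm] at hd
      rw [l1 _ (hf.mem y) (hd.trans_le (min_le_left _ _)),
        l2 _ (hf.mem y) (hd.trans_le (min_le_right _ _))]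
    have hsl := mul_sub_le_of_right_slope hf.cont (k := -(s / c)) (fun t => by
      obtain ⟨d, hd, hd0, δ, hδ, hx⟩ := hf.right_slope h t
      refine ⟨_, ?_, δ, hδ, hx⟩
      obtain ⟨hcr, hnn⟩ := hall t
      have hfar : dot d ⟨c, -s⟩ ^ 2 ≤ 3 / 4 := by
        by_contra! hgt
        rw [← hu2] at hgt
        exact hnn ((h.near_iff (hf.mem t) hd).2 ⟨hcr, hgt⟩)
      have := dirs_cross_pos_of_far hc0 hs0 hcs hd.1 hd0 ((hf.near t).im_sq_lt hd).2 hfar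
      rw [← neg_div, div_le_div_iff₀ hc0 hd0]
      linarith) hc0.le
    have : -(s / c) * (c - 0) = -s := by field_simp; ring
    linarith

/-! ### Periodic functions of small slope -/

/-- A 1-periodic function whose slopes are at most `1 / √3` in absolute value. -/
structure Profile (f : ℝ → ℝ) : Prop where
  lipschitz : ∀ s t, Real.sqrt 3 * |f s - f t| ≤ |s - t|
  periodic : Function.Periodic f 1

lemma Profile.sqrt_three_mul_abs_le {f : ℝ → ℝ} (hf : Profile f) (s t : ℝ) :
    Real.sqrt 3 * |f s - f t| ≤ 1 / 2 := by
  have h1 := hf.lipschitz (s - round (s - t) * 1) t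
  rw [hf.periodic.sub_int_mul_eq] at h1
  have h2 := abs_sub_round (s - t)
  rw [show s - round (s - t) * 1 - t = s - t - round (s - t) by ring] at h1
  exact h1.trans h2

lemma Profile.abs_sub_le_half {f : ℝ → ℝ} (hf : Profile f) (s t : ℝ) : |f s - f t| ≤ 1 / 2 := by
  have := hf.sqrt_three_mul_abs_le s t
  nlinarith [sqrt_three_bounds, abs_nonneg (f s - f t)]

lemma Profile.lt_translate_rot {f : ℝ → ℝ} (hf : Profile f) (t : ℝ) :
    f t < f (t - 1 / 2) + Real.sqrt 3 / 2 := by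
  have h1 := hf.abs_sub_le_half t (t - 1 / 2)
  have h2 := le_abs_self (f t - f (t - 1 / 2))
  linarith [sqrt_three_bounds]

lemma Profile.apply_sub_half {f : ℝ → ℝ} (hf : Profile f) (t : ℝ) :
    f (t - 1 / 2) = f (t + 1 / 2) := by
  have := hf.periodic (t - 1 / 2)
  rwa [show t - 1 / 2 + 1 = t + 1 / 2 by ring, eq_comm] at this

/-- The shift contributes `√3 * (√3 / 2) = 3 / 2`, and `√3 * f` varies by at most `1 / 2`. -/
lemma Profile.height {f : ℝ → ℝ} (hf : Profile f) (s t : ℝ) :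
    1 ≤ Real.sqrt 3 * (f (t - 1 / 2) + Real.sqrt 3 / 2 - f s) ∧
    Real.sqrt 3 * (f (t - 1 / 2) + Real.sqrt 3 / 2 - f s) ≤ 2 := by
  have h1 := hf.sqrt_three_mul_abs_le (t - 1 / 2) s
  have h2 := neg_abs_le (f (t - 1 / 2) - f s)
  have h3 := le_abs_self (f (t - 1 / 2) - f s)
  constructor <;> nlinarith [sqrt_three_sq, sqrt_three_pos]

lemma Profile.height_pos {f : ℝ → ℝ} (hf : Profile f) (s t : ℝ) :
    0 < f (t - 1 / 2) + Real.sqrt 3 / 2 - f s := by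
  have h1 := (hf.height s t).1
  by_contra! hle
  nlinarith [sqrt_three_pos]

/-- By periodicity `t - 1 / 2` may be replaced by `t + 1 / 2`. The one closer to `s` is at distance
`|t - s| - 1 / 2`, where the Lipschitz bound applies. -/
lemma Profile.height_le {f : ℝ → ℝ} (hf : Profile f) {s t : ℝ} (h1 : 1 / 2 ≤ |t - s|) :
    Real.sqrt 3 * (f (t - 1 / 2) + Real.sqrt 3 / 2 - f s) ≤ 1 + |t - s| := by
  have l0 := mul_le_mul_of_nonneg_left (le_abs_self (f (t - 1 / 2) - f s)) sqrt_three_pos.le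
  rcases le_abs.1 h1 with h2 | h2
  · have l1 := hf.lipschitz (t - 1 / 2) s
    rw [abs_of_nonneg (show 0 ≤ t - 1 / 2 - s by linarith)] at l1
    linarith [sqrt_three_sq, le_abs_self (t - s)]
  · have l1 := hf.lipschitz (t + 1 / 2) s
    rw [← hf.apply_sub_half, abs_of_nonpos (show t + 1 / 2 - s ≤ 0 by linarith)] at l1
    linarith [sqrt_three_sq, neg_le_abs (t - s)]

lemma Profile.le_height {f : ℝ → ℝ} (hf : Profile f) {s t : ℝ} (h1 : |t - s| ≤ 1 / 2) :
    1 + |t - s| ≤ Real.sqrt 3 * (f (t - 1 / 2) + Real.sqrt 3 / 2 - f s) := by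
  have l0 := mul_le_mul_of_nonneg_left (neg_abs_le (f (t - 1 / 2) - f s)) sqrt_three_pos.le
  obtain ⟨h2, h3⟩ := abs_le.1 h1
  have l1 := hf.lipschitz (t - 1 / 2) s
  have l2 := hf.lipschitz (t + 1 / 2) s
  rw [abs_of_nonpos (show t - 1 / 2 - s ≤ 0 by linarith)] at l1
  rw [← hf.apply_sub_half, abs_of_nonneg (show 0 ≤ t + 1 / 2 - s by linarith)] at l2
  rcases abs_cases (t - s) with ⟨e, -⟩ | ⟨e, -⟩ <;> rw [e] <;> linarith [sqrt_three_sq]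

/-- The direction from a point of the graph to a point of the next translate is less than sixty
degrees away from the horizontal exactly if their abscissas differ by more than one half. -/
lemma Profile.flat_iff {f : ℝ → ℝ} (hf : Profile f) (s t : ℝ) :
    (f (t - 1 / 2) + Real.sqrt 3 / 2 - f s) ^ 2 < 3 * (t - s) ^ 2 ↔ 1 / 2 < |t - s| := by
  have hh := hf.height s t
  rcases le_or_gt |t - s| (1 / 2) with h1 | h1
  · refine iff_of_false (not_lt.2 ?_) (not_lt.2 h1)
    -- The angle condition compares `√3` times the height with `3 * |t - s|`; the height estimates
    -- put `1 + |t - s|` in between, and `1 + r = 3 * r` at `r = 1 / 2`.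
    have h2 := hf.le_height h1
    have h3 : (3 * |t - s|) ^ 2 ≤
        (Real.sqrt 3 * (f (t - 1 / 2) + Real.sqrt 3 / 2 - f s)) ^ 2 :=
      pow_le_pow_left₀ (by positivity) (by linarith) 2
    rw [mul_pow, mul_pow, sq_abs, Real.sq_sqrt (by norm_num)] at h3
    linarith
  · refine iff_of_true ?_ h1
    have h2 := hf.height_le h1.le
    have h3 : (Real.sqrt 3 * (f (t - 1 / 2) + Real.sqrt 3 / 2 - f s)) ^ 2 < (3 * |t - s|) ^ 2 :=
      pow_lt_pow_left₀ (by linarith) (by linarith [hh.1]) two_ne_zero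
    rw [mul_pow, mul_pow, sq_abs, Real.sq_sqrt (by norm_num)] at h3
    linarith

/-! ### Periodicity of branches -/

lemma lt_of_forall_ne {X : Type*} [TopologicalSpace X] {S : Set X} (hS : IsPreconnected S)
    {f g : X → ℝ} (hf : Continuous f) (hg : Continuous g) (hne : ∀ s ∈ S, f s ≠ g s) {t : X}
    (ht : t ∈ S) (hlt : f t < g t) : ∀ s ∈ S, f s < g s := by
  intro s hs
  by_contra! hle
  obtain ⟨x, hx, he⟩ := hS.intermediate_value₂ ht hs hf.continuousOn hg.continuousOn hlt.le hle
  exact hne x hx he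

lemma Branch.reflect (h : ConicColoring P N) {f : ℝ → ℝ} (hf : Branch P N f) :
    Branch (reflect ⁻¹' P) (reflect ⁻¹' N) fun t => f (-t) := by
  have e1 : TwoColoring.reflect 1 = -1 := by apply Complex.ext <;> simp
  refine ⟨hf.cont.comp continuous_neg, fun t => ?_, fun t => ?_⟩
  · rw [bdry_preimage, mem_preimage, reflect_apply]
    exact hf.mem (-t)
  · apply Near.preimage circleMap_reflect
    rw [e1, reflect_apply]
    exact (hf.near (-t)).neg h (hf.mem (-t))

lemma Branch.not_forall_lt (h : ConicColoring P N) {f : ℝ → ℝ} (hf : Branch P N f)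
    (hlt : ∀ t, f t < f (t - 1)) : False := by
  rcases hf.up_all_or h with hu | hu
  · exact hf.not_lt_translate h hu hlt
  · exact hf.swap.not_lt_translate h.swap hu hlt

/-- Branches that meet coincide. Otherwise the branch lies strictly on one side of its translate,
which `Branch.not_lt_translate` excludes, after a reflection or an exchange of colors if necessary.
-/
lemma Branch.periodic (h : ConicColoring P N) {f : ℝ → ℝ} (hf : Branch P N f) :
    Function.Periodic f 1 := by
  have hc := hf.cont
  have key : ∀ t, f (t - 1) = f t := by
    intro t
    by_contra hne
    have hd : ∀ s, f (s - 1) ≠ f s := fun s hs =>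
      hne (congrFun ((hf.translate_one h).eq_of_eq h hf hs) t)
    rcases lt_or_gt_of_ne hne with h1 | h1
    · have hall := lt_of_forall_ne isPreconnected_univ (f := fun s => f (s - 1)) (g := f)
        (by fun_prop) hc (fun s _ => hd s) (mem_univ t) h1
      refine (hf.reflect h).not_forall_lt (h.preimage TwoColoring.reflect) fun s => ?_
      have := hall (1 - s) (mem_univ _)
      rw [show (1 : ℝ) - s - 1 = -s by ring] at this
      rwa [show -(s - 1) = 1 - s by ring]
    · have hall := lt_of_forall_ne isPreconnected_univ (f := f) (g := fun s => f (s - 1))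
        hc (by fun_prop) (fun s _ => (hd s).symm) (mem_univ t) h1
      exact hf.not_forall_lt h fun s => hall s (mem_univ s)
  intro t
  have := key (t + 1)
  rw [add_sub_cancel_right] at this
  exact this.symm

lemma Branch.profile (h : ConicColoring P N) {f : ℝ → ℝ} (hf : Branch P N f) : Profile f :=
  ⟨hf.lipschitz h, hf.periodic h⟩

/-! ### Translations of the components of the boundary -/

lemma mem_connectedComponentIn_preimage (e : ℂ ≃ₗᵢ[ℝ] ℂ) {E : Set ℂ} {A B : ℂ} (hA : e A ∈ E) :
    B ∈ connectedComponentIn (e ⁻¹' E) A ↔ e B ∈ connectedComponentIn E (e A) := by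
  have h1 := e.toHomeomorph.image_connectedComponentIn (s := e ⁻¹' E) (x := A) hA
  have h2 : e.toHomeomorph '' (e ⁻¹' E) = E := e.toHomeomorph.surjective.image_preimage E
  rw [h2] at h1
  change _ ↔ e.toHomeomorph B ∈ connectedComponentIn E (e.toHomeomorph A)
  rw [← h1]
  exact (e.toHomeomorph.injective.mem_set_image).symm

/-- In coordinates where `x` is `1`, the component is the graph of a periodic function. -/
lemma Near.add_mem_component (h : ConicColoring P N) {A x B : ℂ} (hA : A ∈ bdry P N)
    (hx : Near P N A x) (hB : B ∈ connectedComponentIn (bdry P N) A) :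
    B + x ∈ connectedComponentIn (bdry P N) A := by
  have hu := hx.1.norm_eq
  set e := mulUnit x hu with he
  have h' := h.preimage e
  obtain ⟨A, rfl⟩ := e.surjective A
  obtain ⟨B, rfl⟩ := e.surjective B
  have e1 : e 1 = x := by simp [he]
  rw [← e1] at hx ⊢
  have hx' := hx.preimage (circleMap_mulUnit x hu)
  obtain ⟨f, hf, hfA⟩ := h'.exists_branch (A := A) hA hx'
  have hc := hf.component_eq h' A.re
  rw [show (⟨A.re, f A.re⟩ : ℂ) = A from by rw [hfA]] at hc
  rw [← map_add, ← mem_connectedComponentIn_preimage e hA, ← bdry_preimage, hc]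
  rw [← mem_connectedComponentIn_preimage e hA, ← bdry_preimage, hc] at hB
  have : (B + 1).im = f (B + 1).re := by
    simp only [Complex.add_im, Complex.one_im, add_zero, Complex.add_re, Complex.one_re]
    rw [hf.periodic h']
    exact hB
  exact this

/-- The component contains `A + n * x` for all natural `n`, which is unbounded in height unless `x`
is horizontal. -/
lemma Near.im_eq_zero (h : ConicColoring P N) {A x : ℂ} (hA : A ∈ bdry P N)
    (hx : Near P N A x) {M : ℝ} (hM : ∀ z ∈ connectedComponentIn (bdry P N) A, |z.im| ≤ M) :
    x.im = 0 := by
  have hn : ∀ n : ℕ, A + n * x ∈ connectedComponentIn (bdry P N) A := by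
    intro n
    induction n with
    | zero => simpa using mem_connectedComponentIn hA
    | succ n ih =>
      have := hx.add_mem_component h hA ih
      rwa [show A + (n : ℂ) * x + x = A + ((n + 1 : ℕ) : ℂ) * x by push_cast; ring] at this
  by_contra hne
  have hpos : 0 < |x.im| := abs_pos.2 hne
  obtain ⟨n, hn'⟩ := exists_nat_gt ((M + |A.im|) / |x.im|)
  rw [div_lt_iff₀ hpos] at hn'
  have h1 := hM _ (hn n)
  have e : (A + n * x).im = A.im + n * x.im := by simp
  rw [e] at h1
  have h2 : |(n : ℝ) * x.im| = n * |x.im| := by rw [abs_mul, Nat.abs_cast]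
  have h3 := abs_sub_abs_le_abs_sub ((n : ℝ) * x.im) (-A.im)
  rw [abs_neg, sub_neg_eq_add, add_comm _ A.im] at h3
  linarith

lemma Near.one_of_im_bounded (h : ConicColoring P N) {A x : ℂ} (hA : A ∈ bdry P N)
    (hx : Near P N A x) {M : ℝ} (hM : ∀ z ∈ connectedComponentIn (bdry P N) A, |z.im| ≤ M) :
    Near P N A 1 := by
  have h0 := hx.im_eq_zero h hA hM
  have h1 := norm_eq_one_iff.1 hx.1.norm_eq
  rw [h0, mul_zero, add_zero, mul_self_eq_one_iff] at h1
  rcases h1 with h1 | h1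
  · have : x = 1 := Complex.ext (by simp [h1]) (by simp [h0])
    rwa [this] at hx
  · have : x = -1 := Complex.ext (by simp [h1]) (by simp [h0])
    rw [this] at hx
    simpa using hx.neg h hA

/-- One of the crossings at `ψ`, `ψ + π / 3`, `ψ + 2 * π / 3` would be near, hence horizontal, but
all three angles lie strictly between `0` and `π`. -/
lemma ConicColoring.not_crossing_cis (h : ConicColoring P N) {A : ℂ} (hA : A ∈ bdry P N) {M : ℝ}
    (hM : ∀ z ∈ connectedComponentIn (bdry P N) A, |z.im| ≤ M) {ψ : ℝ}
    (hψ : ψ ∈ Ioo 0 (Real.pi / 3)) : ¬ Crossing P N A (cis ψ) := by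
  intro hc
  have h0 := hψ.1
  have h1 := hψ.2
  have hs : ∀ a, 0 < a → a < Real.pi → (cis a).im ≠ 0 := fun a h0 h1 =>
    (Real.sin_pos_of_pos_of_lt_pi h0 h1).ne'
  rcases hc.exists_near h hA with hn | hn | hn
  · exact hs ψ h0 (by linarith [Real.pi_pos]) (hn.im_eq_zero h hA hM)
  · rw [rot_eq_cis, ← cis_add] at hn
    exact hs _ (by positivity) (by linarith [Real.pi_pos]) (hn.im_eq_zero h hA hM)
  · rw [rot_eq_cis, ← cis_add, ← cis_add] at hn
    exact hs _ (by positivity) (by linarith [Real.pi_pos]) (hn.im_eq_zero h hA hM)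

/-! ### The strips between the branches -/

lemma Branch.abs_im_le (h : ConicColoring P N) {f : ℝ → ℝ} (hf : Branch P N f) (t : ℝ) :
    ∀ z ∈ connectedComponentIn (bdry P N) ⟨t, f t⟩, |z.im| ≤ |f t| + 1 := by
  intro z hz
  rw [hf.component_eq h] at hz
  have hz : z.im = f z.re := hz
  rw [hz]
  have h1 := (hf.profile h).sqrt_three_mul_abs_le z.re t
  have h2 := abs_sub_abs_le_abs_sub (f z.re) (f t)
  nlinarith [sqrt_three_bounds, abs_nonneg (f z.re - f t)]

/-- The part of the unit circle with polar angles between zero and sixty degrees about a point of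
a branch has no point of the color below the branch. -/
lemma Branch.arc_notMem (h : ConicColoring P N) {f : ℝ → ℝ} (hf : Branch P N f)
    (hu : ∀ t, Up P N f t) (t : ℝ) {ψ : ℝ} (hψ : ψ ∈ Ioo 0 (Real.pi / 3)) :
    ⟨t, f t⟩ + cis ψ ∉ N := by
  intro hN
  obtain ⟨-, ε, hε, hs⟩ := hf.switch h hu t
  obtain ⟨κ, hκ0, hκ⟩ := exists_between (lt_min hε hψ.1)
  have h1 := (hs κ hκ0 (hκ.trans_le (min_le_left _ _))).2
  obtain ⟨φ, hφ, hsw⟩ := h.exists_switch (u := 1) (by simp)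
    (hκ.trans_le (min_le_right _ _)) h1 (by rwa [one_mul])
  rw [one_mul] at hsw
  exact h.not_crossing_cis (hf.mem t) (hf.abs_im_le h t)
    ⟨hκ0.trans hφ.1, hφ.2.trans hψ.2⟩ (Or.inl hsw)

/-- The part of the unit circle with polar angles between 60 and 120 degrees about a point of
a branch has no point of the color above the branch. -/
lemma Branch.top_arc_notMem (h : ConicColoring P N) {f : ℝ → ℝ} (hf : Branch P N f)
    (hu : ∀ t, Up P N f t) (t : ℝ) {ψ : ℝ} (hψ : ψ ∈ Ioo 0 (Real.pi / 3)) :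
    ⟨t, f t⟩ + rot * cis ψ ∉ P := by
  intro hP
  obtain ⟨hr, ε, hε, hs⟩ := (hf.switch h hu t).rot h.swap (mem_bdry_comm (hf.mem t))
  rw [mul_one] at hs hr
  obtain ⟨κ, hκ0, hκ⟩ := exists_between (lt_min hε hψ.1)
  have h1 := (hs κ hκ0 (hκ.trans_le (min_le_left _ _))).2
  obtain ⟨φ, hφ, hsw⟩ := h.swap.exists_switch (u := rot) hr
    (hκ.trans_le (min_le_right _ _)) h1 hP
  have hsw' := ((Crossing.rot h (hf.mem t) (Or.inr hsw)).rot h (hf.mem t)).neg h (hf.mem t)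
  rw [show -(rot * (rot * (rot * cis φ))) = -(rot * (rot * rot)) * cis φ by ring, rot_cube,
    neg_neg, one_mul] at hsw'
  exact h.not_crossing_cis (hf.mem t) (hf.abs_im_le h t)
    ⟨hκ0.trans hφ.1, hφ.2.trans hψ.2⟩ hsw'

lemma Up.arc {g : ℝ → ℝ} {a c : ℝ} (b : ℝ) (hu : Up P N g (a + Real.cos c))
    (hz : b + Real.sin c = g (a + Real.cos c)) : ∃ ε > 0, ∀ x, |x - c| < ε →
      (g (a + Real.cos x) < b + Real.sin x → ⟨a, b⟩ + cis x ∈ P) ∧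
      (b + Real.sin x < g (a + Real.cos x) → ⟨a, b⟩ + cis x ∈ N) := by
  obtain ⟨δ, hδ, hu⟩ := hu
  refine ⟨δ, hδ, fun x hx => ?_⟩
  have := hu (⟨a, b⟩ + cis x) ?_
  · simpa using this
  · have e : (⟨a + Real.cos c, g (a + Real.cos c)⟩ : ℂ) = ⟨a, b⟩ + cis c := by
      apply Complex.ext <;> simp [hz]
    have e2 : (⟨a, b⟩ + cis x : ℂ) - (⟨a, b⟩ + cis c) = cis c * cis (x - c) - cis c := by
      rw [← cis_add]; ring_nf
    rw [e, e2]
    exact (norm_mul_cis_sub_le (norm_cis _) _).trans_lt hx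

/-- No branch lies between a branch and its next translate. -/
lemma Branch.not_between (h : ConicColoring P N) {f g : ℝ → ℝ} (hf : Branch P N f)
    (hu : ∀ t, Up P N f t) (hg : Branch P N g) (hfg : ∀ t, f t < g t)
    (hgf : ∀ t, g t < f (t - 1 / 2) + Real.sqrt 3 / 2) : False := by
  have hgc := hg.cont
  set η : ℝ → ℝ := fun ψ => f 0 + Real.sin ψ - g (0 + Real.cos ψ) with hη
  have hηc : Continuous η := by fun_prop
  have hpi : (0 : ℝ) < Real.pi / 3 := by positivity
  have h0 : η 0 < 0 := by
    have := hfg 1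
    have h2 := (hf.periodic h) 0
    simp only [zero_add] at h2
    simp only [hη, Real.sin_zero, Real.cos_zero, zero_add]
    linarith
  have h1 : 0 < η (Real.pi / 3) := by
    have := hgf (1 / 2)
    simp only [hη, Real.sin_pi_div_three, Real.cos_pi_div_three, zero_add]
    rw [sub_self] at this
    linarith
  -- The arc from `A + 1`, below `g`, to `A + rot`, above `g`, meets `g`. Whichever side of `g` has
  -- the color `N`, the arc has a point there: just before its first meeting with `g` or just after
  -- its last one. `Branch.arc_notMem` forbids this.
  rcases hg.up_all_or h with hug | hug
  · obtain ⟨c, hc, hz, hneg⟩ := exists_first_zero hηc hpi h0 h1.le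
    have hcp : c < Real.pi / 3 := lt_of_le_of_ne hc.2 (by rintro rfl; linarith)
    obtain ⟨ε, hε, hx⟩ := (hug (0 + Real.cos c)).arc (f 0) (by simp only [hη] at hz; linarith)
    obtain ⟨x, hx1, hx2⟩ := exists_between (max_lt hc.1 (show c - ε < c by linarith))
    have hx3 := (le_max_left _ _).trans_lt hx1
    have hx4 := (le_max_right _ _).trans_lt hx1
    have h3 := hneg x ⟨hx3.le, hx2⟩
    refine hf.arc_notMem h hu 0 ⟨hx3, hx2.trans hcp⟩
      ((hx x (by rw [abs_lt]; constructor <;> linarith)).2 ?_)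
    simp only [hη] at h3
    linarith
  · obtain ⟨c, hc, hz, hpos⟩ := exists_last_zero hηc hpi h0.le h1
    obtain ⟨ε, hε, hx⟩ := (hug (0 + Real.cos c)).arc (f 0) (by simp only [hη] at hz; linarith)
    obtain ⟨x, hx1, hx2⟩ := exists_between (lt_min hc.2 (show c < c + ε by linarith))
    have hx3 := hx2.trans_le (min_le_left _ _)
    have hx4 := hx2.trans_le (min_le_right _ _)
    have h3 := hpos x ⟨hx1, hx3.le⟩
    refine hf.arc_notMem h hu 0 ⟨hc.1.trans_lt hx1, hx3⟩
      ((hx x (by rw [abs_lt]; constructor <;> linarith)).1 ?_)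
    simp only [hη] at h3
    linarith

/-- The component of such a boundary point cannot cross the two branches, so its height is bounded.
Its near crossing is therefore horizontal, and it lies on a branch between the two, against
`Branch.not_between`. -/
lemma Branch.notMem_bdry_strip (h : ConicColoring P N) {f : ℝ → ℝ} (hf : Branch P N f)
    {z : ℂ} (hz1 : f z.re < z.im) (hz2 : z.im < f (z.re - 1 / 2) + Real.sqrt 3 / 2) :
    z ∉ bdry P N := by
  intro hz
  have hg := hf.translate_rot h
  have hfc := hf.cont
  have hgc := hg.cont
  have hmem := mem_connectedComponentIn hz
  have hoff : ∀ {k : ℝ → ℝ}, Branch P N k → z.im ≠ k z.re →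
      ∀ w ∈ connectedComponentIn (bdry P N) z, w.im ≠ k w.re := by
    intro k hk hne w hw he
    have h1 := connectedComponentIn_eq hw
    rw [show w = ⟨w.re, k w.re⟩ by rw [← he], hk.component_eq h] at h1
    rw [h1] at hmem
    exact hne hmem
  have hc := isPreconnected_connectedComponentIn (x := z) (F := bdry P N)
  have k1 := lt_of_forall_ne hc (f := fun w => f w.re) (g := Complex.im)
    (hfc.comp Complex.continuous_re) Complex.continuous_im
    (fun w hw => (hoff hf hz1.ne' w hw).symm) hmem hz1
  have k2 := lt_of_forall_ne hc (f := Complex.im)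
    (g := fun w => f (w.re - 1 / 2) + Real.sqrt 3 / 2)
    Complex.continuous_im (hgc.comp Complex.continuous_re)
    (fun w hw => hoff hg hz2.ne w hw) hmem hz2
  have hM : ∀ w ∈ connectedComponentIn (bdry P N) z, |w.im| ≤ |f 0| + 2 := by
    intro w hw
    have l1 := k1 w hw
    have l2 := k2 w hw
    have m1 := (hf.profile h).sqrt_three_mul_abs_le w.re 0
    have m2 := (hf.profile h).sqrt_three_mul_abs_le (w.re - 1 / 2) 0
    have m3 := neg_abs_le (f w.re - f 0)
    have m4 := le_abs_self (f (w.re - 1 / 2) - f 0)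
    have b := sqrt_three_bounds
    have m5 := neg_abs_le (f 0)
    have m6 := le_abs_self (f 0)
    have m7 : |f w.re - f 0| ≤ 1 / 2 := by nlinarith [abs_nonneg (f w.re - f 0)]
    have m8 : |f (w.re - 1 / 2) - f 0| ≤ 1 / 2 := by
      nlinarith [abs_nonneg (f (w.re - 1 / 2) - f 0)]
    rw [abs_le]
    constructor <;> linarith
  obtain ⟨u, hcr⟩ := h.exists_crossing hz
  obtain ⟨x, hx⟩ : ∃ x, Near P N z x := by
    rcases hcr.exists_near h hz with hn | hn | hn <;> exact ⟨_, hn⟩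
  obtain ⟨g, hgb, hgz⟩ := h.exists_branch hz (hx.one_of_im_bounded h hz hM)
  have hne1 : ∀ t, f t ≠ g t := by
    intro t ht
    rw [hf.eq_of_eq h hgb ht, hgz] at hz1
    exact lt_irrefl _ hz1
  have hne2 : ∀ t, g t ≠ f (t - 1 / 2) + Real.sqrt 3 / 2 := by
    intro t ht
    have := congrFun (hgb.eq_of_eq h hg ht) z.re
    linarith
  have g1 : ∀ t, f t < g t := fun t => lt_of_forall_ne isPreconnected_univ hfc hgb.cont
    (fun s _ => hne1 s) (mem_univ z.re) (by rw [hgz]; exact hz1) t (mem_univ t)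
  have g2 : ∀ t, g t < f (t - 1 / 2) + Real.sqrt 3 / 2 := fun t =>
    lt_of_forall_ne isPreconnected_univ hgb.cont hgc
    (fun s _ => hne2 s) (mem_univ z.re) (by rw [hgz]; exact hz2) t (mem_univ t)
  rcases hf.up_all_or h with hu | hu
  · exact hf.not_between h hu hgb g1 g2
  · exact hf.swap.not_between h.swap hu hgb.swap g1 g2

lemma Branch.strip_subset (h : ConicColoring P N) {f : ℝ → ℝ} (hf : Branch P N f)
    (hu : ∀ t, Up P N f t) {z : ℂ} (hz1 : f z.re < z.im)
    (hz2 : z.im < f (z.re - 1 / 2) + Real.sqrt 3 / 2) : z ∈ P := by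
  have hg := hf.translate_rot h
  set S : Set ℂ := {z : ℂ | z.re ∈ univ ∧ f z.re < z.im ∧
    z.im < f (z.re - 1 / 2) + Real.sqrt 3 / 2} with hS
  have hpre : IsPreconnected S :=
    isPreconnected_between hf.cont hg.cont ((hf.profile h).lt_translate_rot) isPreconnected_univ
  have hdisj : Disjoint S (bdry P N) :=
    Set.disjoint_left.2 fun w hw => hf.notMem_bdry_strip h hw.2.1 hw.2.2
  obtain ⟨δ, hδ, hu⟩ := hu 0
  have hlt := (hf.profile h).lt_translate_rot 0
  set κ := min (δ / 2) ((f (0 - 1 / 2) + Real.sqrt 3 / 2 - f 0) / 2) with hκ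
  have hκ0 : 0 < κ := lt_min (by positivity) (by linarith)
  have hκ1 : κ ≤ δ / 2 := min_le_left _ _
  have hκ2 : κ ≤ (f (0 - 1 / 2) + Real.sqrt 3 / 2 - f 0) / 2 := min_le_right _ _
  refine h.subset_of_isPreconnected hpre hdisj (p := ⟨0, f 0 + κ⟩) ⟨mem_univ _, ?_, ?_⟩
    ((hu _ ?_).1 ?_) ⟨mem_univ _, hz1, hz2⟩
  · simp only; linarith
  · simp only; linarith
  · rw [norm_lt_iff hδ]
    simp only [Complex.sub_re, Complex.sub_im, sub_self, add_sub_cancel_left]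
    nlinarith
  · simp only; linarith

/-! ### The family of all translates of a branch -/

/-- The function whose graph is the graph of `f`, translated by `n` times the unit vector with
polar angle sixty degrees. -/
noncomputable def shift (f : ℝ → ℝ) (n : ℤ) (t : ℝ) : ℝ := f (t - n / 2) + n * (Real.sqrt 3 / 2)

@[simp] lemma shift_zero (f : ℝ → ℝ) : shift f 0 = f := by
  funext t; simp [shift]

lemma shift_add_one (f : ℝ → ℝ) (n : ℤ) (t : ℝ) :
    shift f (n + 1) t = shift f n (t - 1 / 2) + Real.sqrt 3 / 2 := by
  simp only [shift, Int.cast_add, Int.cast_one]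
  rw [show t - ((n : ℝ) + 1) / 2 = t - 1 / 2 - n / 2 by ring]
  ring

lemma shift_sub_one (f : ℝ → ℝ) (n : ℤ) (t : ℝ) :
    shift f (n - 1) t = shift f n (t + 1 / 2) - Real.sqrt 3 / 2 := by
  simp only [shift, Int.cast_sub, Int.cast_one]
  rw [show t - ((n : ℝ) - 1) / 2 = t + 1 / 2 - n / 2 by ring]
  ring

lemma Branch.shift (h : ConicColoring P N) {f : ℝ → ℝ} (hf : Branch P N f) (n : ℤ) :
    Branch P N (shift f n) := by
  induction n using Int.induction_on with
  | zero => simpa using hf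
  | succ n ih =>
    have : TwoColoring.shift f (n + 1) = _ := funext (shift_add_one f n)
    rw [this]
    exact ih.translate_rot h
  | pred n ih =>
    have : TwoColoring.shift f (-n - 1) = _ := funext (shift_sub_one f (-n))
    rw [this]
    exact ih.translate_neg_rot h

/-- Every point lies in exactly one of the half-open strips between the consecutive translates. -/
lemma exists_shift_le {f : ℝ → ℝ} {M : ℝ} (hM : ∀ s t, |f s - f t| ≤ M) (x y : ℝ) :
    ∃ n : ℤ, shift f n x ≤ y ∧ y < shift f (n + 1) x := by
  have hs := sqrt_three_bounds
  have hb : ∀ n : ℤ, |shift f n x - n * (Real.sqrt 3 / 2) - f x| ≤ M := by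
    intro n
    simp only [shift, add_sub_cancel_right]
    exact hM _ _
  have hpos : 0 < Real.sqrt 3 / 2 := by linarith
  obtain ⟨n, hn, hmax⟩ := Int.exists_greatest_of_bdd (P := fun n : ℤ => shift f n x ≤ y) (by
    refine ⟨⌈(y - f x + M) / (Real.sqrt 3 / 2)⌉, fun n hn => ?_⟩
    have h1 := (abs_le.1 (hb n)).1
    have h2 : (n : ℝ) ≤ (y - f x + M) / (Real.sqrt 3 / 2) := by
      rw [le_div_iff₀ hpos]; linarith
    exact_mod_cast h2.trans (Int.le_ceil _)) (by
    refine ⟨⌊(y - f x - M) / (Real.sqrt 3 / 2)⌋, ?_⟩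
    have h1 := (abs_le.1 (hb ⌊(y - f x - M) / (Real.sqrt 3 / 2)⌋)).2
    have h2 := Int.floor_le ((y - f x - M) / (Real.sqrt 3 / 2))
    rw [le_div_iff₀ hpos] at h2
    linarith)
  refine ⟨n, hn, ?_⟩
  by_contra! hle
  have := hmax _ hle
  linarith

/-- The boundary consists of the translates of one branch. -/
lemma Branch.mem_bdry_iff (h : ConicColoring P N) {f : ℝ → ℝ} (hf : Branch P N f) (z : ℂ) :
    z ∈ bdry P N ↔ ∃ n : ℤ, z.im = TwoColoring.shift f n z.re := by
  constructor
  · intro hz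
    obtain ⟨n, h1, h2⟩ := exists_shift_le (hf.profile h).abs_sub_le_half z.re z.im
    refine ⟨n, ?_⟩
    by_contra hne
    rw [shift_add_one] at h2
    exact (hf.shift h n).notMem_bdry_strip h (lt_of_le_of_ne h1 (Ne.symm hne)) h2 hz
  · rintro ⟨n, hn⟩
    have := (hf.shift h n).mem z.re
    rwa [← hn] at this

/-- Consecutive strips have different colors. -/
lemma Branch.strips_subset (h : ConicColoring P N) {f : ℝ → ℝ} (hf : Branch P N f) :
    ((∀ z : ℂ, f z.re < z.im → z.im < TwoColoring.shift f 1 z.re → z ∈ P) ∧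
      ∀ z : ℂ, TwoColoring.shift f (-1) z.re < z.im → z.im < f z.re → z ∈ N) ∨
    ((∀ z : ℂ, f z.re < z.im → z.im < TwoColoring.shift f 1 z.re → z ∈ N) ∧
      ∀ z : ℂ, TwoColoring.shift f (-1) z.re < z.im → z.im < f z.re → z ∈ P) := by
  have hg := hf.shift h (-1)
  have key : ∀ {P N : Set ℂ}, ConicColoring P N → Branch P N f →
      Branch P N (TwoColoring.shift f (-1)) → (∀ t, Up N P (TwoColoring.shift f (-1)) t) →
      (∀ z : ℂ, f z.re < z.im → z.im < TwoColoring.shift f 1 z.re → z ∈ P) ∧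
      ∀ z : ℂ, TwoColoring.shift f (-1) z.re < z.im → z.im < f z.re → z ∈ N := by
    intro P N h hf hg hu
    have e0 : ∀ t, f t = TwoColoring.shift f (-1) (t - 1 / 2) + Real.sqrt 3 / 2 := by
      intro t
      rw [← shift_add_one, neg_add_cancel, shift_zero]
    have e1 : ∀ t, TwoColoring.shift f 1 t = f (t - 1 / 2) + Real.sqrt 3 / 2 := by
      intro t
      have := shift_add_one f 0 t
      rwa [zero_add, shift_zero] at this
    have hu' := hg.swap.up_translate_rot h.swap hu
    rw [← show f = _ from funext e0] at hu'
    refine ⟨fun z hz1 hz2 => ?_, fun z hz1 hz2 => ?_⟩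
    · rw [e1] at hz2
      exact hf.strip_subset h hu' hz1 hz2
    · rw [e0] at hz2
      exact hg.swap.strip_subset h.swap hu hz1 hz2
  rcases hg.up_all_or h with hu | hu
  · exact Or.inr (key h.swap hf.swap hg.swap hu)
  · exact Or.inl (key h hf hg hu)

/-! ### Distances and angles between consecutive branches -/

lemma exists_cis_eq {a b : ℝ} (hab : a * a + b * b = 1) (h1 : 1 / 2 < a) (hb : 0 < b) :
    ∃ ψ ∈ Ioo 0 (Real.pi / 3), cis ψ = ⟨a, b⟩ := by
  have ha1 : a < 1 := by nlinarith
  refine ⟨Real.arccos a, ⟨Real.arccos_pos.2 ha1, ?_⟩, ?_⟩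
  · have : Real.arccos (1 / 2) = Real.pi / 3 := by
      rw [← Real.cos_pi_div_three]
      exact Real.arccos_cos (by positivity) (by linarith [Real.pi_pos])
    rw [← this]
    exact Real.arccos_lt_arccos (by norm_num) h1 ha1.le
  · apply Complex.ext
    · exact Real.cos_arccos (by linarith) ha1.le
    · simp only [cis_im, Real.sin_arccos]
      rw [show 1 - a ^ 2 = b ^ 2 by nlinarith, Real.sqrt_sq hb.le]

/-- If the distance were below `1`, the arc between 0 and 60 degrees about the point over `s` would
reach abscissa `t` above the next branch. It is still below the following one there, so that point
would be in `N`. -/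
lemma Branch.one_le_of_flat (h : ConicColoring P N) {f : ℝ → ℝ} (hf : Branch P N f)
    (hu : ∀ t, Up P N f t) {s t : ℝ} (h1 : 1 / 2 < t - s) :
    1 ≤ (t - s) ^ 2 + (f (t - 1 / 2) + Real.sqrt 3 / 2 - f s) ^ 2 := by
  have hy0 := (hf.profile h).height_pos s t
  set ρ := t - s with hρ
  set y := f (t - 1 / 2) + Real.sqrt 3 / 2 - f s with hy
  have hs3 := sqrt_three_pos
  by_contra! hlt
  have hρ1 : ρ < 1 := by nlinarith
  set b := Real.sqrt (1 - ρ ^ 2) with hb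
  have hbb : b * b = 1 - ρ ^ 2 := Real.mul_self_sqrt (by nlinarith)
  have hb0 : 0 < b := Real.sqrt_pos.2 (by nlinarith)
  have hyb : y < b := by nlinarith
  have hb3 : 2 * b < Real.sqrt 3 := by nlinarith [sqrt_three_sq]
  obtain ⟨ψ, hψ, hc⟩ := exists_cis_eq (a := ρ) (b := b) (by linarith) h1 hb0
  refine hf.arc_notMem h hu s hψ ?_
  rw [hc]
  have hg := hf.translate_rot h
  have hug := hf.up_translate_rot h hu
  refine hg.swap.strip_subset h.swap hug (z := ⟨s, f s⟩ + ⟨ρ, b⟩) ?_ ?_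
  · simp only [Complex.add_re, Complex.add_im]
    rw [show s + ρ = t by ring]
    linarith
  · simp only [Complex.add_re, Complex.add_im]
    rw [show s + ρ - 1 / 2 - 1 / 2 = t - 1 by ring]
    have hp := hf.periodic h (t - 1)
    rw [sub_add_cancel] at hp
    have h2 := (hf.profile h).sqrt_three_mul_abs_le s t
    have h3 := le_abs_self (f s - f t)
    rw [← hp]
    nlinarith [sqrt_three_bounds]

/-- Moving `s` towards `t` by half of the excess `ρ - 1 / 2` decreases the distance, as the height
changes by at most `ε / √3`. Equality at `s` would thus contradict the weak bound at `s + ε`. -/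
lemma Branch.one_lt_of_flat (h : ConicColoring P N) {f : ℝ → ℝ} (hf : Branch P N f) {s t : ℝ}
    (h1 : 1 / 2 < t - s) :
    1 < (t - s) ^ 2 + (f (t - 1 / 2) + Real.sqrt 3 / 2 - f s) ^ 2 := by
  have hle : ∀ s, 1 / 2 < t - s →
      1 ≤ (t - s) ^ 2 + (f (t - 1 / 2) + Real.sqrt 3 / 2 - f s) ^ 2 := by
    intro s hs
    rcases hf.up_all_or h with hu | hu
    · exact hf.one_le_of_flat h hu hs
    · exact hf.swap.one_le_of_flat h.swap hu hs
  have hy0 := (hf.profile h).height_pos s t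
  by_contra! hle1
  set ρ := t - s with hρ
  set y := f (t - 1 / 2) + Real.sqrt 3 / 2 - f s with hy
  have hs3 := sqrt_three_pos
  have hρ1 : ρ < 1 := by nlinarith
  have hyρ : Real.sqrt 3 * y ≤ 1 + ρ := by
    have := (hf.profile h).height_le (h1.le.trans (le_abs_self _))
    rwa [abs_of_pos (by linarith)] at this
  set ε := (ρ - 1 / 2) / 2 with hε
  have hε0 : 0 < ε := by linarith
  have k := hle (s + ε) (by linarith)
  set Δ := f s - f (s + ε) with hΔ
  have l := hf.lipschitz h s (s + ε)
  rw [sub_add_cancel_left, abs_neg, abs_of_pos hε0] at l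
  have l1 := le_abs_self Δ
  have l2 : 3 * Δ ^ 2 ≤ ε ^ 2 := by
    have : (Real.sqrt 3 * |Δ|) ^ 2 ≤ ε ^ 2 := by
      apply pow_le_pow_left₀ (by positivity) l
    rw [mul_pow, sq_abs, Real.sq_sqrt (by norm_num)] at this
    exact this
  rw [show t - (s + ε) = ρ - ε by ring,
    show f (t - 1 / 2) + Real.sqrt 3 / 2 - f (s + ε) = y + Δ by rw [hy, hΔ]; ring] at k
  have k2 : 3 * (y * Δ) ≤ (1 + ρ) * ε := by
    have a1 : Real.sqrt 3 * Δ ≤ ε := by nlinarith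
    have a2 : (Real.sqrt 3 * y) * (Real.sqrt 3 * Δ) ≤ (1 + ρ) * ε :=
      (mul_le_mul_of_nonneg_left a1 (by positivity)).trans
        (mul_le_mul_of_nonneg_right hyρ hε0.le)
    have a3 : (Real.sqrt 3 * y) * (Real.sqrt 3 * Δ) = 3 * (y * Δ) := by
      linear_combination (y * Δ) * sqrt_three_sq
    linarith
  nlinarith

/-- Otherwise the arc between 60 and 120 degrees would pass at abscissa `t` below the next branch
and have a point in the color above the first one. For `|t - s| = 1 / 2` the distance is exactly
`1`, by periodicity. -/
lemma Branch.le_one_of_steep (h : ConicColoring P N) {f : ℝ → ℝ} (hf : Branch P N f) {s t : ℝ}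
    (h1 : |t - s| ≤ 1 / 2) :
    (t - s) ^ 2 + (f (t - 1 / 2) + Real.sqrt 3 / 2 - f s) ^ 2 ≤ 1 := by
  have hp := (hf.profile h).apply_sub_half t
  have hy0 := (hf.profile h).height_pos s t
  set ρ := t - s with hρ
  set y := f (t - 1 / 2) + Real.sqrt 3 / 2 - f s with hy
  have hs3 := sqrt_three_pos
  rcases h1.lt_or_eq with hlt | heq
  · by_contra! hgt
    obtain ⟨hρ1, hρ2⟩ := abs_lt.1 hlt
    have hρq : ρ ^ 2 < 1 / 4 := by nlinarith
    set b := Real.sqrt (1 - ρ ^ 2) with hb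
    have hbb : b * b = 1 - ρ ^ 2 := Real.mul_self_sqrt (by nlinarith)
    have hb0 : 0 < b := Real.sqrt_pos.2 (by nlinarith)
    have hyb : b < y := by nlinarith
    have hb3 : Real.sqrt 3 < 2 * b := by nlinarith [sqrt_three_sq]
    -- The coordinates of `(ρ, b)` turned back by sixty degrees.
    obtain ⟨ψ, hψ, hc⟩ := exists_cis_eq (a := ρ / 2 + Real.sqrt 3 / 2 * b)
      (b := b / 2 - Real.sqrt 3 / 2 * ρ)
      (by linear_combination (ρ * ρ / 4 + b * b / 4) * sqrt_three_sq + hbb)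
      (by nlinarith [sqrt_three_sq]) (by nlinarith [sqrt_three_sq])
    have hrc : rot * cis ψ = ⟨ρ, b⟩ := by
      rw [hc]
      apply Complex.ext
      · simp only [Complex.mul_re, rot_re, rot_im]
        linear_combination ρ / 4 * sqrt_three_sq
      · simp only [Complex.mul_im, rot_re, rot_im]
        linear_combination b / 4 * sqrt_three_sq
    have key : ∀ {P N : Set ℂ}, ConicColoring P N → Branch P N f → (∀ t, Up P N f t) →
        False := by
      intro P N h hf hu
      refine hf.top_arc_notMem h hu s hψ ?_
      rw [hrc]
      refine hf.strip_subset h hu (z := ⟨s, f s⟩ + ⟨ρ, b⟩) ?_ ?_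
      · simp only [Complex.add_re, Complex.add_im]
        have h2 := (hf.profile h).sqrt_three_mul_abs_le (s + ρ) s
        have h3 := le_abs_self (f (s + ρ) - f s)
        nlinarith [sqrt_three_bounds]
      · simp only [Complex.add_re, Complex.add_im]
        rw [show s + ρ = t by ring]
        linarith
    rcases hf.up_all_or h with hu | hu
    · exact key h hf hu
    · exact key h.swap hf.swap hu
  · have hρq : ρ ^ 2 = 1 / 4 := by rw [← sq_abs, heq]; norm_num
    have hys : y = Real.sqrt 3 / 2 := by
      rcases abs_cases ρ with ⟨e, -⟩ | ⟨e, -⟩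
      · rw [hy, show t - 1 / 2 = s by linarith]; ring
      · rw [hy, hp, show t + 1 / 2 = s by linarith]; ring
    rw [hρq, hys]
    nlinarith [sqrt_three_sq]

/-- Points of consecutive branches are more than a unit apart exactly if their abscissas differ by
more than one half. -/
lemma Branch.one_lt_iff (h : ConicColoring P N) {f : ℝ → ℝ} (hf : Branch P N f) (s t : ℝ) :
    1 < (t - s) ^ 2 + (f (t - 1 / 2) + Real.sqrt 3 / 2 - f s) ^ 2 ↔ 1 / 2 < |t - s| := by
  rcases le_or_gt |t - s| (1 / 2) with h1 | h1
  · exact iff_of_false (not_lt.2 (hf.le_one_of_steep h h1)) (not_lt.2 h1)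
  · refine iff_of_true ?_ h1
    rcases lt_abs.1 h1 with h2 | h2
    · exact hf.one_lt_of_flat h h2
    · have k1 := (hf.reflect h).one_lt_of_flat (h.preimage TwoColoring.reflect) (s := -s)
        (t := -t) (by linarith)
      rwa [show -(-t - 1 / 2) = t + 1 / 2 by ring, ← (hf.profile h).apply_sub_half, neg_neg,
        show (-t - -s) ^ 2 = (t - s) ^ 2 by ring] at k1

/-! ### Alternately colored strips -/

/-- Points of the graph and of its next translate are more than a unit apart exactly if their
abscissas differ by more than one half. -/
def Separated (f : ℝ → ℝ) : Prop :=
  ∀ s t, 1 < (t - s) ^ 2 + (f (t - 1 / 2) + Real.sqrt 3 / 2 - f s) ^ 2 ↔ 1 / 2 < |t - s|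

lemma Profile.shift {f : ℝ → ℝ} (hf : Profile f) (n : ℤ) : Profile (shift f n) := by
  refine ⟨fun s t => ?_, fun t => ?_⟩
  · have := hf.lipschitz (s - n / 2) (t - n / 2)
    simpa [TwoColoring.shift] using this
  · simp only [TwoColoring.shift]
    rw [show t + 1 - (n : ℝ) / 2 = t - n / 2 + 1 by ring, hf.periodic]

lemma Separated.shift {f : ℝ → ℝ} (hf : Separated f) (n : ℤ) : Separated (shift f n) := by
  intro s t
  have := hf (s - n / 2) (t - n / 2)
  simp only [TwoColoring.shift]
  rw [show t - (n : ℝ) / 2 - 1 / 2 = t - 1 / 2 - n / 2 by ring] at this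
  rwa [sub_sub_sub_cancel_right, show ∀ a b c : ℝ, a + c - b = a + n * (Real.sqrt 3 / 2) + c -
    (b + n * (Real.sqrt 3 / 2)) by intros; ring] at this

lemma Profile.shift_strictMono {f : ℝ → ℝ} (hf : Profile f) (x : ℝ) :
    StrictMono fun n => TwoColoring.shift f n x :=
  strictMono_int_of_lt_succ fun n => by
    rw [shift_add_one]
    exact (hf.shift n).lt_translate_rot x

/-- The point `p` lies in the half-open strip above the graph with index `n`. -/
def InStrip (f : ℝ → ℝ) (n : ℤ) (p : ℂ) : Prop :=
  shift f n p.re ≤ p.im ∧ p.im < shift f (n + 1) p.re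

lemma Profile.lt_of_le_of_lt {f : ℝ → ℝ} (hf : Profile f) {m n : ℤ} {x y : ℝ}
    (h1 : TwoColoring.shift f m x ≤ y) (h2 : y < TwoColoring.shift f n x) : m < n :=
  (hf.shift_strictMono x).lt_iff_lt.1 (h1.trans_lt h2)

lemma InStrip.unique {f : ℝ → ℝ} (hf : Profile f) {m n : ℤ} {p : ℂ} (hm : InStrip f m p)
    (hn : InStrip f n p) : m = n := by
  have h1 := hf.lt_of_le_of_lt hm.1 hn.2
  have h2 := hf.lt_of_le_of_lt hn.1 hm.2
  omega

/-- By separation a steep unit step from the curve `n` reaches at least the curve `n + 1`. Its rise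
is at most `1`, too little to pass from below the curve `n + 1` to the curve `n + 3`, which is `√3`
higher. -/
lemma InStrip.add_steep {f : ℝ → ℝ} (hf : Profile f) (hs : Separated f) {m n : ℤ} {p u : ℂ}
    (hn : InStrip f n p) (hm : InStrip f m (p + u)) (hu : ‖u‖ = 1) (h0 : 0 ≤ u.im)
    (hr : |u.re| < 1 / 2) : m = n + 1 ∨ m = n + 2 := by
  have hu' := norm_eq_one_iff.1 hu
  have h1 : TwoColoring.shift f (n + 1) (p + u).re ≤ (p + u).im := by
    have k := (hs.shift n p.re (p.re + u.re)).not.2 (by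
      rw [add_sub_cancel_left]; exact not_lt.2 hr.le)
    rw [add_sub_cancel_left, ← shift_add_one] at k
    have k1 : TwoColoring.shift f (n + 1) (p.re + u.re) - TwoColoring.shift f n p.re ≤ u.im := by
      by_contra! hlt
      exact k (by nlinarith)
    simp only [Complex.add_re, Complex.add_im]
    linarith [hn.1]
  have h2 : (p + u).im < TwoColoring.shift f (n + 1 + 1 + 1) (p + u).re := by
    simp only [Complex.add_re, Complex.add_im]
    rw [shift_add_one, shift_add_one, sub_sub, add_halves, (hf.shift (n + 1)).periodic.sub_eq]
    have k1 := (hf.shift (n + 1)).abs_sub_le_half p.re (p.re + u.re)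
    have k2 := le_abs_self (TwoColoring.shift f (n + 1) p.re -
      TwoColoring.shift f (n + 1) (p.re + u.re))
    have k3 : u.im ≤ 1 := by nlinarith
    linarith [hn.2, sqrt_three_bounds]
  have h3 := hf.lt_of_le_of_lt h1 hm.2
  have h4 := hf.lt_of_le_of_lt hm.1 h2
  omega

lemma InStrip.add_flat {f : ℝ → ℝ} (hf : Profile f) (hs : Separated f) {m n : ℤ} {p u : ℂ}
    (hn : InStrip f n p) (hm : InStrip f m (p + u)) (hu : ‖u‖ = 1) (h0 : 0 ≤ u.im)
    (hr : 1 / 2 < |u.re|) : m = n - 1 ∨ m = n ∨ m = n + 1 := by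
  have hu' := norm_eq_one_iff.1 hu
  have h1 : (p + u).im < TwoColoring.shift f (n + 1 + 1) (p + u).re := by
    have k := (hs.shift (n + 1) p.re (p.re + u.re)).2 (by rwa [add_sub_cancel_left])
    have k0 := (hf.shift (n + 1)).height_pos p.re (p.re + u.re)
    rw [← shift_add_one] at k k0
    rw [add_sub_cancel_left] at k
    have k1 : u.im < TwoColoring.shift f (n + 1 + 1) (p.re + u.re) -
        TwoColoring.shift f (n + 1) p.re := by
      by_contra! hle
      nlinarith
    simp only [Complex.add_re, Complex.add_im]
    linarith [hn.2]
  have h2 : TwoColoring.shift f (n - 1) (p + u).re ≤ (p + u).im := by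
    simp only [Complex.add_re, Complex.add_im]
    rw [shift_sub_one]
    have k1 := (hf.shift n).abs_sub_le_half (p.re + u.re + 1 / 2) p.re
    have k2 := le_abs_self (TwoColoring.shift f n (p.re + u.re + 1 / 2) -
      TwoColoring.shift f n p.re)
    linarith [hn.1, sqrt_three_bounds]
  have h3 := hf.lt_of_le_of_lt h2 hm.2
  have h4 := hf.lt_of_le_of_lt hm.1 h1
  omega

lemma InStrip.add_critical {f : ℝ → ℝ} (hf : Profile f) {m n : ℤ} {p u : ℂ}
    (hn : InStrip f n p) (hm : InStrip f m (p + u)) (hu : ‖u‖ = 1) (h0 : 0 ≤ u.im)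
    (hr : |u.re| = 1 / 2) : m = n + 1 := by
  have hu' := norm_eq_one_iff.1 hu
  have hrr : u.re * u.re = 1 / 4 := by rw [← sq, ← sq_abs, hr]; norm_num
  have hi : u.im = Real.sqrt 3 / 2 := by
    have : u.im ^ 2 = (Real.sqrt 3 / 2) ^ 2 := by nlinarith [sqrt_three_sq]
    exact (pow_left_inj₀ h0 (by positivity) two_ne_zero).1 this
  have key : ∀ k : ℤ, TwoColoring.shift f (k + 1) (p + u).re =
      TwoColoring.shift f k p.re + Real.sqrt 3 / 2 := by
    intro k
    rw [shift_add_one, Complex.add_re]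
    rcases abs_cases u.re with ⟨e, -⟩ | ⟨e, -⟩
    · rw [show p.re + u.re - 1 / 2 = p.re by linarith]
    · rw [show p.re + u.re - 1 / 2 = p.re - 1 by linarith, (hf.shift k).periodic.sub_eq]
  refine hm.unique hf ⟨?_, ?_⟩
  · rw [key, Complex.add_im, hi]; linarith [hn.1]
  · rw [key, Complex.add_im, hi]; linarith [hn.2]

/-- Parity selects from the possible strip differences; the critical steps always change the strip
by exactly one and drop out. -/
lemma InStrip.add_of_even {f : ℝ → ℝ} (hf : Profile f) (hs : Separated f) {m n : ℤ} {p u : ℂ}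
    (hn : InStrip f n p) (hm : InStrip f m (p + u)) (hu : ‖u‖ = 1) (he : Even (m - n)) :
    (1 / 2 < |u.re| ∧ m = n) ∨ (|u.re| < 1 / 2 ∧ (m = n + 2 ∨ m = n - 2)) := by
  obtain ⟨k, hk⟩ := he
  rcases le_or_gt 0 u.im with h0 | h0
  · rcases lt_trichotomy |u.re| (1 / 2) with h | h | h
    · have := hn.add_steep hf hs hm hu h0 h
      exact Or.inr ⟨h, by omega⟩
    · have := hn.add_critical hf hm hu h0 h
      omega
    · have := hn.add_flat hf hs hm hu h0 h
      exact Or.inl ⟨h, by omega⟩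
  · have hn' : InStrip f n (p + u + -u) := by rwa [add_neg_cancel_right]
    have hu' : ‖-u‖ = 1 := by rwa [norm_neg]
    have h0' : 0 ≤ (-u).im := by rw [Complex.neg_im]; linarith
    have e : |(-u).re| = |u.re| := by rw [Complex.neg_re, abs_neg]
    rcases lt_trichotomy |u.re| (1 / 2) with h | h | h
    · have := hm.add_steep hf hs hn' hu' h0' (e.trans_lt h)
      exact Or.inr ⟨h, by omega⟩
    · have := hm.add_critical hf hn' hu' h0' (e.trans h)
      omega
    · have := hm.add_flat hf hs hn' hu' h0' (h.trans_eq e.symm)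
      exact Or.inl ⟨h, by omega⟩

lemma sq_add_mul_add_sq_lt {a c : ℝ} (ha : |a| < 1 / 2) (hc : |c| < 1 / 2) :
    a ^ 2 + a * c + c ^ 2 < 3 / 4 := by
  obtain ⟨a1, a2⟩ := abs_lt.1 ha
  obtain ⟨c1, c2⟩ := abs_lt.1 hc
  nlinarith

lemma lt_sq_add_mul_add_sq {a c : ℝ} (ha : 1 / 2 < |a|) (hc : 1 / 2 < |c|) (h : 0 ≤ a * c) :
    3 / 4 < a ^ 2 + a * c + c ^ 2 := by
  have h1 : 1 / 4 < |a| * |c| := by nlinarith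
  rw [← abs_mul, abs_of_nonneg h] at h1
  have h2 : 1 / 4 < a ^ 2 := by rw [← sq_abs]; nlinarith
  have h3 : 1 / 4 < c ^ 2 := by rw [← sq_abs]; nlinarith
  linarith

/-- The vertices of a unit triangle lie in strips whose indices are not all congruent mod two. -/
lemma InStrip.not_even_triangle {f : ℝ → ℝ} (hf : Profile f) (hs : Separated f) {l m n : ℤ}
    {p u : ℂ} (hu : ‖u‖ = 1) (hl : InStrip f l p) (hm : InStrip f m (p + u))
    (hn : InStrip f n (p + rot * u)) (h1 : Even (m - l)) (h2 : Even (n - l)) : False := by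
  have hu' := norm_eq_one_iff.1 hu
  have hru : ‖rot * u‖ = 1 := by simp [hu]
  have hd : ‖rot * u - u‖ = 1 := by
    rw [show rot * u - u = rot * (rot * u) by rw [← mul_assoc, rot_sq]; ring]
    simp [hu]
  have h3 : Even (n - m) := by
    have := h2.sub h1
    rwa [sub_sub_sub_cancel_right] at this
  have k1 := hl.add_of_even hf hs hm hu h1
  have k2 := hl.add_of_even hf hs hn hru h2
  have k3 := hm.add_of_even hf hs (u := rot * u - u) (by
    rwa [show p + u + (rot * u - u) = p + rot * u by ring]) hd h3
  obtain ⟨a, ha⟩ : ∃ a, a = u.re := ⟨_, rfl⟩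
  obtain ⟨c, hc⟩ : ∃ c, c = (rot * u - u).re := ⟨_, rfl⟩
  have hac : (rot * u).re = a + c := by rw [ha, hc, Complex.sub_re]; ring
  -- The abscissa differences `a`, `c`, `a + c` of the sides of a unit triangle satisfy this
  -- identity, whose form is symmetric in `a`, `c`, `-(a + c)`. Two steep sides make it smaller than
  -- `3 / 4`, three flat ones larger, and exactly one steep side contradicts the strip indices.
  have hq : a ^ 2 + a * c + c ^ 2 = 3 / 4 := by
    rw [hc, ha]
    simp only [Complex.sub_re, Complex.mul_re, rot_re, rot_im]
    linear_combination u.im * u.im / 4 * sqrt_three_sq + 3 / 4 * hu'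
  rw [← ha] at k1
  rw [hac] at k2
  rw [← hc] at k3
  rcases k1 with ⟨a1, b1⟩ | ⟨a1, b1⟩ <;> rcases k2 with ⟨a2, b2⟩ | ⟨a2, b2⟩ <;>
    rcases k3 with ⟨a3, b3⟩ | ⟨a3, b3⟩
  · rcases le_or_gt 0 (a * c) with h0 | h0
    · linarith [lt_sq_add_mul_add_sq a1 a3 h0]
    · rcases le_or_gt 0 (a * (a + c)) with h5 | h5
      · have := lt_sq_add_mul_add_sq (a := -c) (c := a + c) (by rwa [abs_neg]) a2
        by_cases h6 : 0 ≤ -c * (a + c)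
        · linarith [this h6]
        · have := lt_sq_add_mul_add_sq (a := -a) (c := a + c) (by rwa [abs_neg]) a2
          by_cases h7 : 0 ≤ -a * (a + c)
          · linarith [this h7]
          · nlinarith
      · have := lt_sq_add_mul_add_sq (a := -a) (c := a + c) (by rwa [abs_neg]) a2 (by linarith)
        linarith
  · omega
  · omega
  · have := sq_add_mul_add_sq_lt (a := a + c) (c := -c) a2 (by rwa [abs_neg])
    linarith
  · omega
  · linarith [sq_add_mul_add_sq_lt a1 a3]
  · have := sq_add_mul_add_sq_lt (a := a + c) (c := -a) a2 (by rwa [abs_neg])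
    linarith
  · linarith [sq_add_mul_add_sq_lt a1 a3]

lemma iff_even_sub {c : ℤ → Prop} (hc : ∀ n, c (n + 1) ↔ ¬ c n) (m n : ℤ) (hmn : c m ↔ c n) :
    Even (m - n) := by
  have key : ∀ k : ℤ, (c (n + k) ↔ c n) ↔ Even k := by
    intro k
    induction k using Int.induction_on with
    | zero => simp
    | succ k ih =>
      rw [← add_assoc, hc, Int.even_add_one, ← ih]
      tauto
    | pred k ih =>
      have h1 := hc (n + (-k - 1))
      rw [show n + (-(k : ℤ) - 1) + 1 = n + -k by ring] at h1
      rw [Int.even_sub_one, ← ih, h1]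
      tauto
  rw [← key, add_sub_cancel]
  exact hmn

/-! ### Curves with the separation property are graphs -/

/-- The estimate that makes curves with the separation property into graphs. -/
lemma sqrt_three_mul_le_of_near {a b : ℝ} (hb : 0 ≤ b)
    (h1 : 3 * (a - 1 / 2) ^ 2 ≤ (b + Real.sqrt 3 / 2) ^ 2 →
      (a - 1 / 2) ^ 2 + (b + Real.sqrt 3 / 2) ^ 2 ≤ 1)
    (ha0 : 0 ≤ a) (ha1 : a ≤ 1) : Real.sqrt 3 * b ≤ a := by
  -- The premise holds since `3 * (a - 1 / 2)² ≤ 3 / 4`. The conclusion expands to `√3 * b ≤ a - a²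
  -- - b²`.
  have h2 := h1 (by nlinarith [sqrt_three_sq, sqrt_three_pos])
  nlinarith [sqrt_three_sq]

/-- A periodic curve with the separation property is the graph of a profile. -/
lemma exists_profile {K : Set ℂ} (hK : IsPreconnected K) (hne : K.Nonempty)
    (hper : ∀ z, z + 1 ∈ K ↔ z ∈ K)
    (hsep : ∀ A ∈ K, ∀ B ∈ K, 1 < ‖B + rot - A‖ ↔
      (B + rot - A).im ^ 2 < 3 * (B + rot - A).re ^ 2) :
    ∃ f, Profile f ∧ Separated f ∧ K = {z | z.im = f z.re} := by
  have hsep' : ∀ A ∈ K, ∀ B ∈ K, 1 < (B + rot - A).re ^ 2 + (B + rot - A).im ^ 2 ↔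
      (B + rot - A).im ^ 2 < 3 * (B + rot - A).re ^ 2 := by
    intro A hA B hB
    rw [← hsep A hA B hB, ← one_lt_sq_iff₀ (norm_nonneg _), Complex.sq_norm,
      Complex.normSq_apply, sq, sq]
  have hadd : ∀ n : ℤ, ∀ z ∈ K, z + n ∈ K := by
    intro n z hz
    induction n using Int.induction_on with
    | zero => simpa using hz
    | succ n ih =>
      rw [← hper, add_assoc] at ih
      simpa using ih
    | pred n ih =>
      rw [← hper]
      rw [show z + ((-(n : ℤ) - 1 : ℤ) : ℂ) + 1 = z + ((-(n : ℤ) : ℤ) : ℂ) by push_cast; ring]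
      exact ih
  -- From the lower point `B` look at the point `A + rot`, or `A - 1 + rot` if `A` is to the right.
  -- Its abscissa differs from that of `B` by `||A.re - B.re| - 1 / 2|`, and it is too high for a
  -- flat direction, so its distance is at most `1`.
  have haux : ∀ A ∈ K, ∀ B ∈ K, B.im ≤ A.im → |A.re - B.re| ≤ 1 →
      Real.sqrt 3 * (A.im - B.im) ≤ |A.re - B.re| := by
    intro A hA B hB him hre
    obtain ⟨h1, h2⟩ := abs_le.1 hre
    rcases le_or_gt 0 (A.re - B.re) with h0 | h0
    · rw [abs_of_nonneg h0]
      refine sqrt_three_mul_le_of_near (by linarith) (fun h3 => ?_) h0 h2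
      have h4 := (hsep' B hB (A + (-1 : ℤ)) (hadd _ _ hA)).not.2 (by
        simp only [Complex.add_re, Complex.add_im, Complex.sub_re, Complex.sub_im, rot_re, rot_im,
          Complex.intCast_re, Complex.intCast_im]
        push_cast
        refine not_lt.2 (le_trans (le_of_eq ?_) (h3.trans (le_of_eq ?_))) <;> ring)
      simp only [Complex.add_re, Complex.add_im, Complex.sub_re, Complex.sub_im, rot_re, rot_im,
          Complex.intCast_re, Complex.intCast_im] at h4
      push_cast at h4
      refine le_trans (le_of_eq ?_) (not_lt.1 h4)
      ring
    · rw [abs_of_neg h0]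
      refine sqrt_three_mul_le_of_near (by linarith) (fun h3 => ?_) (by linarith) (by linarith)
      have h4 := (hsep' B hB A hA).not.2 (by
        simp only [Complex.add_re, Complex.add_im, Complex.sub_re, Complex.sub_im, rot_re, rot_im]
        refine not_lt.2 (le_trans (le_of_eq ?_) (h3.trans (le_of_eq ?_))) <;> ring)
      simp only [Complex.add_re, Complex.add_im, Complex.sub_re, Complex.sub_im, rot_re,
        rot_im] at h4
      refine le_trans (le_of_eq ?_) (not_lt.1 h4)
      ring
  have hlip : ∀ A ∈ K, ∀ B ∈ K, |A.re - B.re| ≤ 1 →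
      Real.sqrt 3 * |A.im - B.im| ≤ |A.re - B.re| := by
    intro A hA B hB hre
    rcases le_total B.im A.im with h | h
    · rw [abs_of_nonneg (sub_nonneg.2 h)]
      exact haux A hA B hB h hre
    · rw [abs_sub_comm A.im, abs_of_nonneg (sub_nonneg.2 h), abs_sub_comm A.re]
      exact haux B hB A hA h (by rwa [abs_sub_comm])
  have heq : ∀ A ∈ K, ∀ B ∈ K, A.re = B.re → A.im = B.im := by
    intro A hA B hB he
    have := hlip A hA B hB (by rw [he, sub_self, abs_zero]; exact zero_le_one)
    rw [he, sub_self, abs_zero] at this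
    have h2 : |A.im - B.im| ≤ 0 := by nlinarith [sqrt_three_pos]
    exact sub_eq_zero.1 (abs_nonpos_iff.1 h2)
  obtain ⟨A, hA⟩ := hne
  -- The projection of `K` is an interval that is unbounded in both directions, by periodicity.
  have hsurj : ∀ t : ℝ, ∃ y : ℝ, (⟨t, y⟩ : ℂ) ∈ K := by
    intro t
    have hc := (hK.image _ Complex.continuous_re.continuousOn).ordConnected
    have h1 := hadd ⌊t - A.re⌋ A hA
    have h2 := hadd ⌈t - A.re⌉ A hA
    obtain ⟨z, hz, hzt⟩ := hc.out (mem_image_of_mem _ h1) (mem_image_of_mem _ h2)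
      (show t ∈ Icc _ _ by
        simp only [Complex.add_re, Complex.intCast_re]
        constructor
        · linarith [Int.floor_le (t - A.re)]
        · linarith [Int.le_ceil (t - A.re)])
    exact ⟨z.im, by rw [← hzt]; exact hz⟩
  choose f hf using hsurj
  have hK' : K = {z | z.im = f z.re} := by
    ext z
    constructor
    · intro hz
      exact heq z hz _ (hf z.re) rfl
    · intro hz
      have hz : z.im = f z.re := hz
      have := hf z.re
      rwa [← hz] at this
  have hperiod : Function.Periodic f 1 := by
    intro t
    have h1 : (⟨t, f t⟩ : ℂ) + 1 ∈ K := (hper _).2 (hf t)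
    have h2 := heq _ h1 _ (hf (t + 1)) (by simp)
    simpa using h2.symm
  have hprof : Profile f := by
    refine ⟨fun s t => ?_, hperiod⟩
    have h1 := hlip _ (hf (s - round (s - t) * 1)) _ (hf t)
    simp only at h1
    rw [hperiod.sub_int_mul_eq,
      show s - round (s - t) * 1 - t = s - t - round (s - t) by ring] at h1
    have h2 := abs_sub_round (s - t)
    have h3 := round_le (s - t) 0
    rw [Int.cast_zero, sub_zero] at h3
    exact (h1 (by linarith)).trans h3
  refine ⟨f, hprof, fun s t => ?_, hK'⟩
  have := hsep' _ (hf s) _ (hf (t - 1 / 2))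
  simp only [Complex.add_re, Complex.add_im, Complex.sub_re, Complex.sub_im, rot_re, rot_im,
    sub_add_cancel] at this
  rw [this, hprof.flat_iff]

/-! ### The region delimited by two graphs -/

lemma frontier_between {f g : ℝ → ℝ} (hf : Continuous f) (hg : Continuous g)
    (hfg : ∀ t, f t < g t) :
    frontier {z : ℂ | f z.re < z.im ∧ z.im < g z.re} =
      {z | z.im = f z.re} ∪ {z | z.im = g z.re} := by
  have hfc : Continuous fun z : ℂ => f z.re := hf.comp Complex.continuous_re
  have hgc : Continuous fun z : ℂ => g z.re := hg.comp Complex.continuous_re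
  have hop : IsOpen {z : ℂ | f z.re < z.im ∧ z.im < g z.re} :=
    (isOpen_lt hfc Complex.continuous_im).inter (isOpen_lt Complex.continuous_im hgc)
  rw [hop.frontier_eq]
  ext z
  constructor
  · rintro ⟨h1, h2⟩
    have hsub : {z : ℂ | f z.re < z.im ∧ z.im < g z.re} ⊆
        {z : ℂ | f z.re ≤ z.im ∧ z.im ≤ g z.re} := fun w hw => ⟨hw.1.le, hw.2.le⟩
    have h3 : z ∈ {z : ℂ | f z.re ≤ z.im ∧ z.im ≤ g z.re} :=
      closure_minimal hsub
        ((isClosed_le hfc Complex.continuous_im).inter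
          (isClosed_le Complex.continuous_im hgc)) h1
    by_contra hne
    simp only [mem_union, mem_ofPred_eq, not_or] at hne
    exact h2 ⟨lt_of_le_of_ne h3.1 (Ne.symm hne.1), lt_of_le_of_ne h3.2 hne.2⟩
  · intro hz
    have hgap := hfg z.re
    refine ⟨?_, ?_⟩
    · rw [Metric.mem_closure_iff]
      intro ε hε
      set κ := min (ε / 2) ((g z.re - f z.re) / 2) with hκ
      have hκ0 : 0 < κ := lt_min (by positivity) (by linarith)
      have hκ1 : κ ≤ ε / 2 := min_le_left _ _
      have hκ2 : κ ≤ (g z.re - f z.re) / 2 := min_le_right _ _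
      have hd : ∀ σ : ℝ, |σ| = κ → dist z ⟨z.re, z.im + σ⟩ < ε := by
        intro σ hσ
        rw [dist_eq_norm]
        refine (Complex.norm_le_abs_re_add_abs_im _).trans_lt ?_
        simp only [Complex.sub_re, Complex.sub_im, sub_self, abs_zero, sub_add_cancel_left, abs_neg,
          hσ]
        linarith
      rcases hz with hz | hz <;> have hz : z.im = _ := hz
      · refine ⟨⟨z.re, z.im + κ⟩, ⟨?_, ?_⟩, hd κ (abs_of_pos hκ0)⟩ <;> simp only <;> linarith
      · refine ⟨⟨z.re, z.im + -κ⟩, ⟨?_, ?_⟩, hd _ (by rw [abs_neg, abs_of_pos hκ0])⟩ <;>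
          simp only <;> linarith
    · rintro ⟨h1, h2⟩
      rcases hz with hz | hz <;> have hz : z.im = _ := hz <;> linarith

/-- A component below both graphs stays away from `g`, and one above both stays away from `f`, so
only the strip in between is bordered by both. -/
lemma component_bordered_iff {f g : ℝ → ℝ} (hf : Continuous f) (hg : Continuous g)
    (hfg : ∀ t, f t < g t) (p : ℂ) :
    (p ∉ {z : ℂ | z.im = f z.re} ∪ {z : ℂ | z.im = g z.re} ∧
      frontier (connectedComponentIn ({z : ℂ | z.im = f z.re} ∪ {z : ℂ | z.im = g z.re})ᶜ p) =
        {z : ℂ | z.im = f z.re} ∪ {z : ℂ | z.im = g z.re}) ↔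
      f p.re < p.im ∧ p.im < g p.re := by
  have hfc : Continuous fun z : ℂ => f z.re := hf.comp Complex.continuous_re
  have hgc : Continuous fun z : ℂ => g z.re := hg.comp Complex.continuous_re
  set E : Set ℂ := {z : ℂ | z.im = f z.re} ∪ {z : ℂ | z.im = g z.re} with hE
  have hpc : IsPreconnected (connectedComponentIn Eᶜ p) := isPreconnected_connectedComponentIn
  have hoff : ∀ z ∈ connectedComponentIn Eᶜ p, z.im ≠ f z.re ∧ z.im ≠ g z.re := by
    intro z hz
    have := connectedComponentIn_subset _ _ hz
    simpa only [hE, mem_compl_iff, mem_union, mem_ofPred_eq, not_or] using this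
  constructor
  · rintro ⟨hp, hfr⟩
    have hmem : p ∈ connectedComponentIn Eᶜ p := mem_connectedComponentIn hp
    have h0 := hoff p hmem
    refine ⟨lt_of_le_of_ne (not_lt.1 fun hlt => ?_) h0.1.symm,
      lt_of_le_of_ne (not_lt.1 fun hlt => ?_) h0.2⟩
    · have hall := lt_of_forall_ne hpc Complex.continuous_im hfc (fun z hz => (hoff z hz).1) hmem
        hlt
      have hcl : closure (connectedComponentIn Eᶜ p) ⊆ {z | z.im ≤ f z.re} :=
        closure_minimal (fun z hz => (hall z hz).le) (isClosed_le Complex.continuous_im hfc)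
      have h1 : (⟨0, g 0⟩ : ℂ) ∈ E := Or.inr rfl
      rw [← hfr] at h1
      have h2 : g 0 ≤ f 0 := hcl (frontier_subset_closure h1)
      exact absurd (hfg 0) (not_lt.2 h2)
    · have hall := lt_of_forall_ne hpc hgc Complex.continuous_im
        (fun z hz => (hoff z hz).2.symm) hmem hlt
      have hcl : closure (connectedComponentIn Eᶜ p) ⊆ {z | g z.re ≤ z.im} :=
        closure_minimal (fun z hz => (hall z hz).le) (isClosed_le hgc Complex.continuous_im)
      have h1 : (⟨0, f 0⟩ : ℂ) ∈ E := Or.inl rfl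
      rw [← hfr] at h1
      have h2 : g 0 ≤ f 0 := hcl (frontier_subset_closure h1)
      exact absurd (hfg 0) (not_lt.2 h2)
  · rintro ⟨h1, h2⟩
    have hp : p ∈ Eᶜ := by
      simp only [hE, mem_compl_iff, mem_union, mem_ofPred_eq, not_or]
      exact ⟨h1.ne', h2.ne⟩
    have hmem := mem_connectedComponentIn hp
    have hS : connectedComponentIn Eᶜ p = {z : ℂ | f z.re < z.im ∧ z.im < g z.re} := by
      apply Subset.antisymm
      · intro z hz
        exact ⟨lt_of_forall_ne hpc hfc Complex.continuous_im (fun z hz => (hoff z hz).1.symm) hmem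
          h1 z hz, lt_of_forall_ne hpc Complex.continuous_im hgc (fun z hz => (hoff z hz).2) hmem
          h2 z hz⟩
      · have hpre := isPreconnected_between hf hg hfg (I := univ) isPreconnected_univ
        simp only [mem_univ, true_and] at hpre
        refine hpre.subset_connectedComponentIn ⟨h1, h2⟩ ?_
        rintro z ⟨h3, h4⟩
        simp only [hE, mem_compl_iff, mem_union, mem_ofPred_eq, not_or]
        exact ⟨h3.ne', h4.ne⟩
    exact ⟨hp, by rw [hS, frontier_between hf hg hfg]⟩

/-! ### Coordinates in the plane -/

lemma delimitedRegion_preimage (φ : Plane ≃ₗᵢ[ℝ] ℂ) (K L : Set ℂ) :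
    delimitedRegion (φ ⁻¹' K) (φ ⁻¹' L) =
      φ ⁻¹' {p | p ∉ K ∪ L ∧ frontier (connectedComponentIn (K ∪ L)ᶜ p) = K ∪ L} := by
  ext p
  simp only [delimitedRegion, mem_ofPred_eq, mem_preimage, ← preimage_union]
  refine and_congr_right fun hp => ?_
  have h1 := φ.toHomeomorph.image_connectedComponentIn (s := (φ ⁻¹' (K ∪ L))ᶜ) (x := p) hp
  have h2 : φ.toHomeomorph '' (φ ⁻¹' (K ∪ L))ᶜ = (K ∪ L)ᶜ := by
    rw [← preimage_compl]
    exact φ.toHomeomorph.surjective.image_preimage _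
  rw [h2] at h1
  change _ ↔ frontier (connectedComponentIn (K ∪ L)ᶜ (φ.toHomeomorph p)) = K ∪ L
  rw [← h1, ← Homeomorph.image_frontier]
  have h3 : K ∪ L = φ.toHomeomorph '' (φ ⁻¹' (K ∪ L)) :=
    (φ.toHomeomorph.surjective.image_preimage _).symm
  exact ⟨fun e => (congrArg _ e).trans h3.symm,
    fun e => φ.toHomeomorph.injective.image_injective (e.trans h3)⟩

lemma delimitedRegion_graphs (φ : Plane ≃ₗᵢ[ℝ] ℂ) {f g : ℝ → ℝ} (hf : Continuous f)
    (hg : Continuous g) (hfg : ∀ t, f t < g t) :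
    delimitedRegion (φ ⁻¹' {z | z.im = f z.re}) (φ ⁻¹' {z | z.im = g z.re}) =
      φ ⁻¹' {z | f z.re < z.im ∧ z.im < g z.re} := by
  rw [delimitedRegion_preimage]
  congr 1
  ext p
  exact component_bordered_iff hf hg hfg p

lemma exists_linearIsometryEquiv {x y : Plane} (hx : ‖x‖ = 1) (hy : ‖y‖ = 1)
    (hxy : inner ℝ x y = 0) : ∃ φ : Plane ≃ₗᵢ[ℝ] ℂ, φ x = 1 ∧ φ y = Complex.I := by
  have ho : Orthonormal ℝ ![x, y] := by
    refine ⟨fun i => ?_, fun i j hij => ?_⟩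
    · fin_cases i <;> simp [hx, hy]
    · fin_cases i <;> fin_cases j <;> simp_all [real_inner_comm]
  have hcard : Fintype.card (Fin 2) = Module.finrank ℝ Plane := by simp
  set b := (basisOfOrthonormalOfCardEqFinrank ho hcard).toOrthonormalBasis (by
    rw [coe_basisOfOrthonormalOfCardEqFinrank]; exact ho) with hb
  have hb' : ∀ i, b i = ![x, y] i := by
    intro i
    simp [hb]
  refine ⟨b.equiv Complex.orthonormalBasisOneI (Equiv.refl _), ?_, ?_⟩
  · have := OrthonormalBasis.equiv_apply_basis b Complex.orthonormalBasisOneI (Equiv.refl _) 0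
    rw [hb'] at this
    simpa using this
  · have := OrthonormalBasis.equiv_apply_basis b Complex.orthonormalBasisOneI (Equiv.refl _) 1
    rw [hb'] at this
    simpa using this

lemma acuteAngle_lt_iff {v x : Plane} (hx : ‖x‖ = 1) :
    acuteAngle v x < Real.pi / 3 ↔ ‖v‖ < 2 * |inner ℝ v x| := by
  have h0 := InnerProductGeometry.angle_nonneg v x
  have h1 := InnerProductGeometry.angle_le_pi v x
  have hpi := Real.pi_pos
  -- The angle with the zero vector is `π / 2` by convention, so both sides are false.
  rcases eq_or_ne v 0 with rfl | hv
  · simp only [acuteAngle, InnerProductGeometry.angle_zero_left, inner_zero_left, abs_zero,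
      norm_zero, mul_zero, lt_irrefl, iff_false, not_lt, le_min_iff]
    constructor <;> linarith
  have hcos := InnerProductGeometry.cos_angle v x
  rw [hx, mul_one] at hcos
  have hvpos : 0 < ‖v‖ := norm_pos_iff.2 hv
  rw [acuteAngle, min_lt_iff]
  set θ := InnerProductGeometry.angle v x
  have e1 : θ < Real.pi / 3 ↔ 1 / 2 < Real.cos θ := by
    rw [← Real.cos_pi_div_three]
    exact (Real.strictAntiOn_cos.lt_iff_gt ⟨by positivity, by linarith⟩ ⟨h0, h1⟩).symm
  have e2 : Real.pi - θ < Real.pi / 3 ↔ 1 / 2 < -Real.cos θ := by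
    rw [← Real.cos_pi_div_three, ← Real.cos_pi_sub]
    exact (Real.strictAntiOn_cos.lt_iff_gt ⟨by positivity, by linarith⟩
      ⟨by linarith, by linarith⟩).symm
  rw [e1, e2, ← lt_abs, hcos, abs_div, abs_of_pos hvpos, lt_div_iff₀ hvpos]
  constructor <;> intro h <;> linarith

lemma acuteAngle_lt_iff_sq (φ : Plane ≃ₗᵢ[ℝ] ℂ) {v x : Plane} (hx : φ x = 1) :
    acuteAngle v x < Real.pi / 3 ↔ (φ v).im ^ 2 < 3 * (φ v).re ^ 2 := by
  have hx1 : ‖x‖ = 1 := by rw [← φ.norm_map, hx, norm_one]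
  have hin : inner ℝ v x = (φ v).re := by
    rw [← φ.inner_map_map, hx, Complex.inner]
    simp
  rw [acuteAngle_lt_iff hx1, hin, ← φ.norm_map,
    ← sq_lt_sq₀ (norm_nonneg _) (by positivity), mul_pow, sq_abs, Complex.sq_norm,
    Complex.normSq_apply]
  constructor <;> intro h <;> linarith

/-! ### Polygonal boundaries -/

/-- Near `p`, the set `E` is a finite union of rays with origin `p`. -/
def ConicAt {V : Type*} [NormedAddCommGroup V] [NormedSpace ℝ V] (E : Set V) (p : V) : Prop :=
  ∃ D : Set V, D.Finite ∧ (∀ d ∈ D, ‖d‖ = 1) ∧ ∃ r > 0, ∀ z : V, ‖z‖ < r →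
    (p + z ∈ E ↔ ∃ d ∈ D, ∃ t : ℝ, 0 ≤ t ∧ z = t • d)

section Conic

variable {V : Type*} [NormedAddCommGroup V] [NormedSpace ℝ V]

lemma conicAt_biUnion {ι : Type*} {T : Set ι} (hT : T.Finite) {E : ι → Set V} {p : V}
    (hE : ∀ i ∈ T, ConicAt (E i) p) : ConicAt (⋃ i ∈ T, E i) p := by
  induction T, hT using Set.Finite.induction_on with
  | empty => exact ⟨∅, finite_empty, by simp, 1, one_pos, by simp⟩
  | @insert i T _ _ ih =>
    obtain ⟨D₁, f₁, u₁, r₁, hr₁, h₁⟩ := hE i (mem_insert _ _)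
    obtain ⟨D₂, f₂, u₂, r₂, hr₂, h₂⟩ := ih fun j hj => hE j (mem_insert_of_mem _ hj)
    refine ⟨D₁ ∪ D₂, f₁.union f₂, ?_, min r₁ r₂, lt_min hr₁ hr₂, fun z hz => ?_⟩
    · rintro d (hd | hd)
      exacts [u₁ d hd, u₂ d hd]
    · rw [biUnion_insert, mem_union, h₁ z (hz.trans_le (min_le_left _ _)),
        h₂ z (hz.trans_le (min_le_right _ _))]
      constructor
      · rintro (⟨d, hd, h⟩ | ⟨d, hd, h⟩)
        exacts [⟨d, Or.inl hd, h⟩, ⟨d, Or.inr hd, h⟩]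
      · rintro ⟨d, hd | hd, h⟩
        exacts [Or.inl ⟨d, hd, h⟩, Or.inr ⟨d, hd, h⟩]

lemma conicAt_of_notMem {E : Set V} (hE : IsClosed E) {p : V} (hp : p ∉ E) : ConicAt E p := by
  obtain ⟨r, hr, hb⟩ := Metric.isOpen_iff.1 hE.isOpen_compl p hp
  refine ⟨∅, finite_empty, by simp, r, hr, fun z hz => ?_⟩
  simp only [mem_empty_iff_false, false_and, exists_false, iff_false]
  exact hb (by rw [Metric.mem_ball, dist_eq_norm, add_sub_cancel_left]; exact hz)

/-- An interval that reaches beyond `t₀` in a direction contains a whole piece in that direction.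
Nontriviality provides at least one direction, which is needed to represent `x = 0`. -/
lemma exists_rays_of_ordConnected {I : Set ℝ} (hI : I.OrdConnected) (hnt : I.Nontrivial) {t₀ : ℝ}
    (ht : t₀ ∈ I) : ∃ D : Set ℝ, D ⊆ {1, -1} ∧ ∃ ε > 0, ∀ x : ℝ, |x| < ε →
      (t₀ + x ∈ I ↔ ∃ σ ∈ D, ∃ s : ℝ, 0 ≤ s ∧ x = s * σ) := by
  have hex : ∀ σ : ℝ, ∃ s : ℝ, 0 < s ∧ ((∃ s' > 0, t₀ + s' * σ ∈ I) → t₀ + s * σ ∈ I) := by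
    intro σ
    by_cases h : ∃ s' > 0, t₀ + s' * σ ∈ I
    · obtain ⟨s, hs, hsI⟩ := h
      exact ⟨s, hs, fun _ => hsI⟩
    · exact ⟨1, one_pos, fun h' => absurd h' h⟩
  choose s hs hsI using hex
  set D : Set ℝ := {σ | σ ∈ ({1, -1} : Set ℝ) ∧ ∃ s' > 0, t₀ + s' * σ ∈ I} with hD
  have hmem : ∀ x ≠ 0, t₀ + x ∈ I → ∃ σ ∈ D, ∃ s : ℝ, 0 ≤ s ∧ x = s * σ := by
    intro x hx hxI
    rcases lt_or_gt_of_ne hx with h | h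
    · exact ⟨-1, ⟨Or.inr rfl, -x, by linarith, by simpa using hxI⟩, -x, by linarith, by ring⟩
    · exact ⟨1, ⟨Or.inl rfl, x, h, by simpa using hxI⟩, x, h.le, by ring⟩
  have hDne : D.Nonempty := by
    obtain ⟨t, htI, hne⟩ := hnt.exists_ne t₀
    obtain ⟨σ, hσ, -⟩ := hmem (t - t₀) (sub_ne_zero.2 hne) (by rwa [add_sub_cancel])
    exact ⟨σ, hσ⟩
  refine ⟨D, fun σ hσ => hσ.1, min (s 1) (s (-1)), lt_min (hs _) (hs _), fun x hx => ⟨?_, ?_⟩⟩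
  · intro hxI
    rcases eq_or_ne x 0 with rfl | hne
    · obtain ⟨σ, hσ⟩ := hDne
      exact ⟨σ, hσ, 0, le_rfl, by ring⟩
    · exact hmem x hne hxI
  · rintro ⟨σ, ⟨hσ, hσI⟩, a, ha, rfl⟩
    have hsσ := hsI σ hσI
    rcases hσ with rfl | rfl
    · have h1 := (le_abs_self _).trans_lt (hx.trans_le (min_le_left _ _))
      exact hI.out ht hsσ ⟨by linarith, by linarith⟩
    · have h1 := (neg_le_abs _).trans_lt (hx.trans_le (min_le_right _ _))
      exact hI.out hsσ ht ⟨by linarith, by linarith⟩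

lemma conicAt_line_part {I : Set ℝ} (hI : I.OrdConnected) (hnt : I.Nontrivial)
    (hcl : IsClosed I) (a : V) {v : V} (hv : v ≠ 0) (p : V) :
    ConicAt ((fun t : ℝ => a + t • v) '' I) p := by
  by_cases hp : p ∈ (fun t : ℝ => a + t • v) '' I
  swap
  · refine conicAt_of_notMem ?_ hp
    have h1 : IsClosedEmbedding fun t : ℝ => a + t • v :=
      (Homeomorph.addLeft a).isClosedEmbedding.comp (isClosedEmbedding_smul_left hv)
    exact h1.isClosedMap _ hcl
  obtain ⟨t₀, ht₀, rfl⟩ := hp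
  obtain ⟨D, hD, ε, hε, hloc⟩ := exists_rays_of_ordConnected hI hnt ht₀
  have hv0 : 0 < ‖v‖ := norm_pos_iff.2 hv
  have hsub : ∀ x : ℝ, ∀ z : V, z = x • v → ‖z‖ < ε * ‖v‖ → |x| < ε := by
    rintro x z rfl hz
    rw [norm_smul, Real.norm_eq_abs] at hz
    exact lt_of_mul_lt_mul_right hz hv0.le
  refine ⟨(fun σ : ℝ => σ • (‖v‖⁻¹ • v)) '' D, ((Set.toFinite _).subset hD).image _, ?_,
    ε * ‖v‖, by positivity, fun z hz => ⟨?_, ?_⟩⟩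
  · rintro _ ⟨σ, hσ, rfl⟩
    simp only
    rw [norm_smul, norm_smul, norm_inv, norm_norm, inv_mul_cancel₀ hv0.ne', mul_one]
    rcases hD hσ with rfl | rfl <;> simp
  · rintro ⟨t, ht, he⟩
    have hz' : z = (t - t₀) • v := by
      simp only at he
      rw [sub_smul, add_left_cancel (he.trans (add_assoc _ _ _)), add_sub_cancel_left]
    obtain ⟨σ, hσ, s, hs, hx⟩ := (hloc _ (hsub _ z hz' hz)).1 (by rwa [add_sub_cancel])
    refine ⟨_, ⟨σ, hσ, rfl⟩, s * ‖v‖, by positivity, ?_⟩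
    rw [hz', hx, smul_smul, smul_smul]
    congr 1
    field_simp
  · rintro ⟨_, ⟨σ, hσ, rfl⟩, s, hs, he⟩
    have hz' : z = (s / ‖v‖ * σ) • v := by
      rw [he, smul_smul, smul_smul]
      congr 1
      field_simp
    refine ⟨t₀ + s / ‖v‖ * σ, (hloc _ (hsub _ z hz' hz)).2 ⟨σ, hσ, s / ‖v‖, by positivity, rfl⟩, ?_⟩
    simp only
    rw [add_smul, ← hz', add_assoc]

end Conic

lemma conicAt_carrier (s : StraightSegment) (p : Plane) : ConicAt s.carrier p := by
  cases s with
  | bounded a b hab =>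
    have := conicAt_line_part (ordConnected_Icc (a := (0 : ℝ)) (b := 1))
      ⟨0, ⟨le_rfl, zero_le_one⟩, 1, ⟨zero_le_one, le_rfl⟩, zero_ne_one⟩ isClosed_Icc a
      (sub_ne_zero.2 hab.symm) p
    rwa [← segment_eq_image'] at this
  | halfLine a v hv =>
    have := conicAt_line_part (ordConnected_Ici (a := (0 : ℝ)))
      ⟨0, self_mem_Ici, 1, mem_Ici.2 zero_le_one, zero_ne_one⟩ isClosed_Ici a hv p
    convert this using 1
    ext q
    exact ⟨fun ⟨t, h1, h2⟩ => ⟨t, h1, h2.symm⟩, fun ⟨t, h1, h2⟩ => ⟨t, h1, h2.symm⟩⟩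
  | line a v hv =>
    have := conicAt_line_part (ordConnected_univ (α := ℝ)) nontrivial_univ isClosed_univ a hv p
    convert this using 1
    ext q
    exact ⟨fun ⟨t, h2⟩ => ⟨t, mem_univ _, h2.symm⟩, fun ⟨t, _, h2⟩ => ⟨t, h2.symm⟩⟩

lemma conicAt_boundary {χ : PlaneColoring} (hχ : χ.IsPolygonal) (p : Plane) :
    ConicAt χ.boundary p := by
  obtain ⟨-, -, S, hS, -, hfin⟩ := hχ
  have hT := hfin (Metric.ball p 1) Metric.isBounded_ball
  obtain ⟨D, hD, hD1, r, hr, hloc⟩ := conicAt_biUnion hT (E := StraightSegment.carrier) (p := p)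
    fun s _ => conicAt_carrier s p
  refine ⟨D, hD, hD1, min r 1, lt_min hr one_pos, fun z hz => ?_⟩
  rw [← hloc z (hz.trans_le (min_le_left _ _)), hS]
  have hzb : p + z ∈ Metric.ball p 1 := by
    rw [Metric.mem_ball, dist_eq_norm, add_sub_cancel_left]
    exact hz.trans_le (min_le_right _ _)
  simp only [mem_iUnion, exists_prop]
  exact ⟨fun ⟨s, hs, hsz⟩ => ⟨s, ⟨hs, _, hsz, hzb⟩, hsz⟩, fun ⟨s, hs, hsz⟩ => ⟨s, hs.1, hsz⟩⟩

/-! ### Colorings of the plane -/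

lemma white_eq (χ : PlaneColoring) : χ.white = χ.blackᶜ :=
  (compl_unique χ.disjoint.inter_eq χ.cover).symm

lemma boundary_eq (χ : PlaneColoring) : χ.boundary = frontier χ.black := by
  rw [PlaneColoring.boundary, white_eq, frontier_compl, inter_self]

lemma boundary_eq_compl (χ : PlaneColoring) :
    χ.boundary = (interior χ.black ∪ interior χ.white)ᶜ := by
  rw [boundary_eq, white_eq, interior_compl, compl_union, compl_compl, inter_comm]
  exact sdiff_eq _ _

/-- The color classes without the boundary, in coordinates. -/
lemma conicColoring {χ : PlaneColoring} (hχ : χ.IsPolygonal)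
    (hC : ∀ A B C : Plane, IsUnitTriangle A B C → χ.Monochromatic {A, B, C} →
      A ∈ χ.boundary ∨ B ∈ χ.boundary ∨ C ∈ χ.boundary) (φ : Plane ≃ₗᵢ[ℝ] ℂ) :
    ConicColoring (φ.symm ⁻¹' interior χ.black) (φ.symm ⁻¹' interior χ.white) := by
  have hb : bdry (φ.symm ⁻¹' interior χ.black) (φ.symm ⁻¹' interior χ.white) =
      φ.symm ⁻¹' χ.boundary := by rw [boundary_eq_compl]; rfl
  have hnot : ∀ p, p ∈ interior χ.black ∨ p ∈ interior χ.white → p ∉ χ.boundary := by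
    intro p hp
    rw [boundary_eq_compl]
    exact fun h => h hp
  have htri : ∀ A u : ℂ, ‖u‖ = 1 →
      IsUnitTriangle (φ.symm A) (φ.symm (A + u)) (φ.symm (A + rot * u)) := by
    intro A u hu
    refine ⟨?_, ?_, ?_⟩ <;> rw [φ.symm.dist_map, dist_eq_norm]
    · rw [sub_add_cancel_left, norm_neg, hu]
    · rw [show A + u - (A + rot * u) = -(rot * (rot * u)) by rw [← mul_assoc, rot_sq]; ring]
      simp [hu]
    · rw [add_sub_cancel_left]
      simp [hu]
  have hcl : ∀ X : Set Plane, closure (φ.symm ⁻¹' X) = φ.symm ⁻¹' closure X := fun X =>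
    (φ.symm.toHomeomorph.preimage_closure X).symm
  refine ⟨isOpen_interior.preimage φ.symm.continuous, isOpen_interior.preimage φ.symm.continuous,
    (χ.disjoint.mono interior_subset interior_subset).preimage _, ?_, ?_, fun p => ?_, ?_, ?_⟩
  · rw [hb, hcl]
    exact preimage_mono fun p hp =>
      closure_minimal hχ.1 isClosed_closure (frontier_subset_closure hp.1)
  · rw [hb, hcl]
    exact preimage_mono fun p hp =>
      closure_minimal hχ.2.1 isClosed_closure (frontier_subset_closure hp.2)
  · obtain ⟨D, hD, hD1, r, hr, hloc⟩ := conicAt_boundary hχ (φ.symm p)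
    refine ⟨φ '' D, hD.image _, ?_, r, hr, fun z hz => ?_⟩
    · rintro _ ⟨d, hd, rfl⟩
      rw [φ.norm_map, hD1 d hd]
    · rw [hb, mem_preimage, map_add, hloc _ (by rwa [φ.symm.norm_map])]
      simp only [exists_mem_image]
      refine exists_congr fun d => and_congr_right fun _ => exists_congr fun t =>
        and_congr_right fun _ => ?_
      rw [← Complex.real_smul, ← map_smul]
      exact φ.symm_apply_eq
  · intro A u hu h1 h2 h3
    rcases hC _ _ _ (htri A u hu) (Or.inl (by
      rintro p (rfl | rfl | rfl)
      exacts [interior_subset h1, interior_subset h2, interior_subset h3])) with h | h | h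
    exacts [hnot _ (Or.inl h1) h, hnot _ (Or.inl h2) h, hnot _ (Or.inl h3) h]
  · intro A u hu h1 h2 h3
    rcases hC _ _ _ (htri A u hu) (Or.inr (by
      rintro p (rfl | rfl | rfl)
      exacts [interior_subset h1, interior_subset h2, interior_subset h3])) with h | h | h
    exacts [hnot _ (Or.inr h1) h, hnot _ (Or.inr h2) h, hnot _ (Or.inr h3) h]

lemma Profile.continuous {f : ℝ → ℝ} (hf : Profile f) : Continuous f := by
  refine (LipschitzWith.of_dist_le_mul (K := 1) fun s t => ?_).continuous
  rw [NNReal.coe_one, one_mul, Real.dist_eq, Real.dist_eq]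
  nlinarith [hf.lipschitz s t, sqrt_three_bounds, abs_nonneg (f s - f t)]

lemma shift_shift (f : ℝ → ℝ) (m n : ℤ) : shift (shift f m) n = shift f (m + n) := by
  funext t
  simp only [shift, Int.cast_add]
  rw [show t - ((m : ℝ) + n) / 2 = t - n / 2 - m / 2 by ring]
  ring

/-! ### Colorings that avoid the unit triangle are zebra-like -/

lemma ConicColoring.bdry_nonempty (h : ConicColoring P N) : (bdry P N).Nonempty := by
  by_contra hne
  rw [not_nonempty_iff_eq_empty] at hne
  rcases h.one_color (isPreconnected_univ (α := ℂ)) (by rw [hne]; exact disjoint_empty _) with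
    h1 | h1
  · exact h.noTriangle_left 0 1 norm_one (h1 trivial) (h1 trivial) (h1 trivial)
  · exact h.noTriangle_right 0 1 norm_one (h1 trivial) (h1 trivial) (h1 trivial)

lemma ConicColoring.exists_near (h : ConicColoring P N) : ∃ A ∈ bdry P N, ∃ x, Near P N A x := by
  obtain ⟨A, hA⟩ := h.bdry_nonempty
  obtain ⟨u, hu⟩ := h.exists_crossing hA
  rcases hu.exists_near h hA with hn | hn | hn <;> exact ⟨A, hA, _, hn⟩

lemma Branch.isZebraLike {χ : PlaneColoring} (φ : Plane ≃ₗᵢ[ℝ] ℂ)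
    (h : ConicColoring (φ.symm ⁻¹' interior χ.black) (φ.symm ⁻¹' interior χ.white)) {f : ℝ → ℝ}
    (hf : Branch (φ.symm ⁻¹' interior χ.black) (φ.symm ⁻¹' interior χ.white) f) :
    χ.IsZebraLike := by
  have hp := hf.profile h
  have hc : ∀ i, Continuous (TwoColoring.shift f i) := fun i => (hp.shift i).continuous
  have hlt : ∀ i t, TwoColoring.shift f i t < TwoColoring.shift f (i + 1) t := fun i t =>
    hp.shift_strictMono t (lt_add_one i)
  have hreg : ∀ i, delimitedRegion (φ ⁻¹' {z | z.im = TwoColoring.shift f i z.re})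
      (φ ⁻¹' {z | z.im = TwoColoring.shift f (i + 1) z.re}) =
      φ ⁻¹' {z | TwoColoring.shift f i z.re < z.im ∧ z.im < TwoColoring.shift f (i + 1) z.re} :=
    fun i => delimitedRegion_graphs φ (hc i) (hc (i + 1)) (hlt i)
  have hrot : φ ((1 / 2 : ℝ) • φ.symm 1 + (Real.sqrt 3 / 2 : ℝ) • φ.symm Complex.I) = rot := by
    rw [map_add, map_smul, map_smul, φ.apply_symm_apply, φ.apply_symm_apply]
    apply Complex.ext <;> simp
  refine ⟨fun i t => φ.symm ⟨t, TwoColoring.shift f i t⟩,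
    fun i => φ ⁻¹' {z | z.im = TwoColoring.shift f i z.re}, φ.symm 1, φ.symm Complex.I,
    fun i => ⟨φ.symm.continuous.comp (continuous_mk continuous_id (hc i)), fun s t hst => ?_, ?_⟩,
    fun i j hij => ?_, ?_, ?_, ?_, ?_, fun i => ?_, fun i => ?_, fun i => ?_, fun i A hA B hB => ?_⟩
  · exact congrArg Complex.re (φ.symm.injective hst)
  · ext p
    constructor
    · intro hpi
      refine ⟨(φ p).re, φ.symm_apply_eq.2 ?_⟩
      exact Complex.ext rfl (Eq.symm hpi)
    · rintro ⟨t, rfl⟩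
      simp
  · rw [Set.disjoint_left]
    intro p hi hj
    exact hij ((hp.shift_strictMono (φ p).re).injective (hi.symm.trans hj))
  · ext p
    have h1 := hf.mem_bdry_iff h (φ p)
    have h2 : φ p ∈ bdry (φ.symm ⁻¹' interior χ.black) (φ.symm ⁻¹' interior χ.white) ↔
        p ∈ χ.boundary := by
      rw [boundary_eq_compl]
      simp [bdry]
    rw [← h2, h1, mem_iUnion]
    rfl
  · rw [φ.symm.norm_map, norm_one]
  · rw [φ.symm.norm_map, Complex.norm_I]
  · rw [φ.symm.inner_map_map, Complex.inner]
    simp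
  · ext p
    have hper := (hp.shift i).periodic
    constructor
    · rintro ⟨q, hq, rfl⟩
      have hq : (φ q).im = _ := hq
      simp [hq, hper _]
    · intro hpi
      have hpi : (φ p).im = _ := hpi
      refine ⟨p - φ.symm 1, ?_, sub_add_cancel _ _⟩
      simp [hpi, hper.sub_eq]
  · ext p
    constructor
    · intro hpi
      have hpi : (φ p).im = _ := hpi
      refine ⟨_, ?_, sub_add_cancel _ _⟩
      rw [mem_preimage, map_sub, hrot]
      simp [hpi, shift_add_one]
    · rintro ⟨q, hq, rfl⟩
      have hq : (φ q).im = _ := hq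
      rw [mem_preimage, map_add, hrot]
      simp [hq, shift_add_one]
  · have hi := hf.shift h i
    have hr' := hreg (i - 1)
    rw [sub_add_cancel] at hr'
    rw [hreg, hr']
    have hs := hi.strips_subset h
    rw [shift_shift, shift_shift, ← sub_eq_add_neg] at hs
    have hsub : ∀ {X : Set Plane} {p : Plane}, φ p ∈ φ.symm ⁻¹' interior X → p ∈ X := by
      intro X p hX
      rw [mem_preimage, φ.symm_apply_apply] at hX
      exact interior_subset hX
    rcases hs with ⟨h1, h2⟩ | ⟨h1, h2⟩
    · exact Or.inl ⟨fun p hq => hsub (h1 _ hq.1 hq.2), fun p hq => hsub (h2 _ hq.1 hq.2)⟩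
    · exact Or.inr ⟨fun p hq => hsub (h1 _ hq.1 hq.2), fun p hq => hsub (h2 _ hq.1 hq.2)⟩
  · have hA : (φ A).im = _ := hA
    have hB : (φ B).im = _ := hB
    have k1 := (hf.shift h i).one_lt_iff h (φ A).re (φ B).re
    have k2 := (hp.shift i).flat_iff (φ A).re (φ B).re
    rw [← shift_add_one, ← hA, ← hB] at k1 k2
    rw [acuteAngle_lt_iff_sq φ (φ.apply_symm_apply 1), map_sub, Complex.sub_re, Complex.sub_im, k2,
      ← k1, dist_comm, ← φ.dist_map, dist_eq_norm, ← one_lt_sq_iff₀ (norm_nonneg _),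
      Complex.sq_norm, Complex.normSq_apply, Complex.sub_re, Complex.sub_im, sq, sq]

/-- A near crossing exists in any coordinates; rotating it to `1` yields a branch. -/
lemma isZebraLike_of_triangles {χ : PlaneColoring} (hχ : χ.IsPolygonal)
    (hC : ∀ A B C : Plane, IsUnitTriangle A B C → χ.Monochromatic {A, B, C} →
      A ∈ χ.boundary ∨ B ∈ χ.boundary ∨ C ∈ χ.boundary) : χ.IsZebraLike := by
  set φ₀ : Plane ≃ₗᵢ[ℝ] ℂ := Complex.orthonormalBasisOneI.repr.symm
  obtain ⟨A, hA, x, hx⟩ := (conicColoring hχ hC φ₀).exists_near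
  have hu := hx.1.norm_eq
  set e := mulUnit x hu with he
  obtain ⟨A, rfl⟩ := e.surjective A
  have hx' : Near (φ₀.symm ⁻¹' interior χ.black) (φ₀.symm ⁻¹' interior χ.white) (e A)
      (e 1) := by
    rw [show e 1 = x by simp [he]]; exact hx
  have h := conicColoring hχ hC (φ₀.trans e.symm)
  obtain ⟨f, hf, -⟩ := h.exists_branch (A := A) hA (hx'.preimage (circleMap_mulUnit x hu))
  exact hf.isZebraLike _ h

/-! ### Zebra-like colorings have a twin that avoids the unit triangle -/

/-- Agreement off the frontier gives that the interiors of `B` and of its complement lie in those of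
`A` and of its complement. They are dense in `B` and its complement, so recoloring the frontier
cannot change it. -/
lemma frontier_eq_of_agree {X : Type*} [TopologicalSpace X] {A B : Set X}
    (h1 : B ⊆ closure (interior B)) (h2 : Bᶜ ⊆ closure (interior Bᶜ))
    (hA : ∀ p ∉ frontier B, (p ∈ A ↔ p ∈ B)) : frontier A = frontier B := by
  have hi : interior B ⊆ interior A := by
    refine interior_maximal (fun p hp => (hA p fun hf => ?_).2 (interior_subset hp))
      isOpen_interior
    exact hf.2 hp
  have he : interior Bᶜ ⊆ interior Aᶜ := by
    refine interior_maximal (fun p hp hpA => ?_) isOpen_interior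
    refine interior_subset hp ((hA p fun hf => ?_).1 hpA)
    rw [← frontier_compl] at hf
    exact hf.2 hp
  apply Subset.antisymm
  · intro p hp
    refine ⟨?_, fun hpi => hp.2 (hi hpi)⟩
    by_contra hcl
    rw [← mem_compl_iff, ← interior_compl] at hcl
    have := he hcl
    rw [interior_compl] at this
    exact this hp.1
  · intro p hp
    have k1 : p ∈ closure A := closure_minimal (h1.trans (closure_mono (hi.trans interior_subset)))
      isClosed_closure hp.1
    have hp' : p ∈ closure Bᶜ := by
      rw [← frontier_compl] at hp
      exact hp.1
    have k2 : p ∈ closure Aᶜ := closure_minimal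
      (h2.trans (closure_mono (he.trans interior_subset))) isClosed_closure hp'
    rw [frontier_eq_closure_inter_closure]
    exact ⟨k1, k2⟩

lemma add_mem_image_add_iff {V : Type*} [AddGroup V] (S : Set V) (v p : V) :
    p + v ∈ (fun q => q + v) '' S ↔ p ∈ S :=
  (add_left_injective v).mem_set_image

/-- The curves of a zebra-like coloring are the translates of the graph of a profile. -/
lemma exists_zebra_profile {χ : PlaneColoring} (h : χ.IsZebraLike) :
    ∃ (φ : Plane ≃ₗᵢ[ℝ] ℂ) (f : ℝ → ℝ), Profile f ∧ Separated f ∧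
      χ.boundary = ⋃ i : ℤ, φ ⁻¹' {z | z.im = shift f i z.re} ∧
      ∀ i : ℤ, (φ ⁻¹' {z | shift f i z.re < z.im ∧ z.im < shift f (i + 1) z.re} ⊆ χ.black ∧
          φ ⁻¹' {z | shift f (i - 1) z.re < z.im ∧ z.im < shift f i z.re} ⊆ χ.white) ∨
        (φ ⁻¹' {z | shift f i z.re < z.im ∧ z.im < shift f (i + 1) z.re} ⊆ χ.white ∧
          φ ⁻¹' {z | shift f (i - 1) z.re < z.im ∧ z.im < shift f i z.re} ⊆ χ.black) := by
  obtain ⟨γ, L, x, y, hγ, -, hb, hx, hy, hxy, hper, htr, hcol, hsep⟩ := h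
  obtain ⟨φ, hφx, hφy⟩ := exists_linearIsometryEquiv hx hy hxy
  set v : Plane := (1 / 2 : ℝ) • x + (Real.sqrt 3 / 2 : ℝ) • y with hv
  have hrot : φ v = rot := by
    rw [hv, map_add, map_smul, map_smul, hφx, hφy]
    apply Complex.ext <;> simp
  have hL0 : L 0 = φ ⁻¹' (φ.symm ⁻¹' L 0) := by
    ext p
    simp
  obtain ⟨f, hf, hs, hK⟩ := exists_profile (K := φ.symm ⁻¹' L 0) (by
      have : φ.symm ⁻¹' L 0 = φ '' L 0 := (φ.toEquiv.image_eq_preimage_symm _).symm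
      rw [this, (hγ 0).2.2]
      exact (isPreconnected_range (hγ 0).1).image _ φ.continuous.continuousOn)
    ⟨φ (γ 0 0), by
      rw [mem_preimage, φ.symm_apply_apply, (hγ 0).2.2]
      exact mem_range_self 0⟩
    (fun z => by
      rw [mem_preimage, mem_preimage, map_add, φ.symm_apply_eq.2 hφx.symm]
      conv_lhs => rw [← hper 0]
      exact add_mem_image_add_iff _ _ _)
    (fun A hA B hB => by
      have hB' : φ.symm B + v ∈ L (0 + 1) := by
        rw [htr 0]
        exact mem_image_of_mem _ hB
      have := hsep 0 _ hA _ hB'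
      rwa [acuteAngle_lt_iff_sq φ hφx, dist_comm, ← φ.dist_map, dist_eq_norm, map_sub, map_add,
        hrot, φ.apply_symm_apply, φ.apply_symm_apply] at this)
  have hL : ∀ i : ℤ, L i = φ ⁻¹' {z | z.im = shift f i z.re} := by
    have hstep : ∀ i : ℤ, L (i + 1) = φ ⁻¹' {z | z.im = shift f (i + 1) z.re} ↔
        L i = φ ⁻¹' {z | z.im = shift f i z.re} := by
      intro i
      have key : ∀ p, p + v ∈ φ ⁻¹' {z | z.im = shift f (i + 1) z.re} ↔
          p ∈ φ ⁻¹' {z | z.im = shift f i z.re} := by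
        intro p
        simp only [mem_preimage, mem_ofPred_eq, map_add, hrot, shift_add_one]
        simp
      have key' : ∀ p, p + v ∈ L (i + 1) ↔ p ∈ L i := by
        intro p
        rw [htr i]
        exact add_mem_image_add_iff _ _ _
      constructor
      · intro he
        ext p
        rw [← key, ← key', he]
      · intro he
        ext p
        rw [← sub_add_cancel p v, key, key', he]
    intro i
    induction i using Int.induction_on with
    | zero => rw [hL0, hK, shift_zero]
    | succ i ih => exact (hstep i).2 ih
    | pred i ih =>
      rw [← hstep, sub_add_cancel]
      exact ih
  have hreg : ∀ i, delimitedRegion (L i) (L (i + 1)) =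
      φ ⁻¹' {z | shift f i z.re < z.im ∧ z.im < shift f (i + 1) z.re} := by
    intro i
    rw [hL, hL]
    exact delimitedRegion_graphs φ (hf.shift i).continuous (hf.shift (i + 1)).continuous
      fun t => hf.shift_strictMono t (lt_add_one i)
  refine ⟨φ, f, hf, hs, ?_, fun i => ?_⟩
  · rw [hb]
    exact iUnion_congr hL
  · have hr' := hreg (i - 1)
    rw [sub_add_cancel] at hr'
    rw [← hreg, ← hr']
    exact hcol i

lemma exists_twin {χ : PlaneColoring} (hχ : χ.IsPolygonal) (h : χ.IsZebraLike) :
    ∃ χ' : PlaneColoring, χ'.IsTwin χ ∧ χ'.AvoidsUnitTriangle := by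
  obtain ⟨φ, f, hf, hs, hb, hcol⟩ := exists_zebra_profile h
  have hstrip : ∀ p : Plane, ∃ n : ℤ, InStrip f n (φ p) := fun p =>
    exists_shift_le hf.abs_sub_le_half (φ p).re (φ p).im
  -- The strips contain their lower curve and not their upper one. The twin gives each of them the
  -- color of its interior.
  choose ν hν using hstrip
  set R : ℤ → Set Plane := fun i =>
    φ ⁻¹' {z | shift f i z.re < z.im ∧ z.im < shift f (i + 1) z.re} with hR
  have hRne : ∀ i, (R i).Nonempty := by
    intro i
    have := hf.shift_strictMono 0 (lt_add_one i)
    obtain ⟨y, hy⟩ := exists_between this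
    exact ⟨φ.symm ⟨0, y⟩, by simpa [hR] using hy⟩
  have hbw : ∀ p, p ∈ χ.black → p ∉ χ.white := fun p h1 h2 => χ.disjoint.le_bot ⟨h1, h2⟩
  set c : ℤ → Prop := fun i => R i ⊆ χ.black with hc
  have hcol' : ∀ i, (R (i + 1) ⊆ χ.black ∧ R i ⊆ χ.white) ∨
      (R (i + 1) ⊆ χ.white ∧ R i ⊆ χ.black) := by
    intro i
    have := hcol (i + 1)
    rwa [add_sub_cancel_right] at this
  have halt : ∀ i, c (i + 1) ↔ ¬ c i := by
    intro i
    obtain ⟨p, hp⟩ := hRne i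
    obtain ⟨q, hq⟩ := hRne (i + 1)
    rcases hcol' i with ⟨h1, h2⟩ | ⟨h1, h2⟩
    · exact iff_of_true h1 fun h3 => hbw p (h3 hp) (h2 hp)
    · exact iff_of_false (fun h3 => hbw q (h3 hq) (h1 hq)) (not_not.2 h2)
  have hwhite : ∀ i, ¬ c i → R i ⊆ χ.white := by
    intro i hi
    rcases hcol' i with ⟨-, h2⟩ | ⟨-, h2⟩
    · exact h2
    · exact absurd h2 hi
  have hin : ∀ p ∉ χ.boundary, p ∈ R (ν p) := by
    intro p hp
    refine ⟨lt_of_le_of_ne (hν p).1 fun he => hp ?_, (hν p).2⟩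
    rw [hb]
    exact mem_iUnion.2 ⟨ν p, he.symm⟩
  have hagree : ∀ p ∉ χ.boundary, (c (ν p) ↔ p ∈ χ.black) := by
    intro p hp
    refine ⟨fun h1 => h1 (hin p hp), fun h1 => ?_⟩
    by_contra h2
    exact hbw p h1 (hwhite _ h2 (hin p hp))
  set χ' : PlaneColoring := ⟨{p | c (ν p)}, {p | c (ν p)}ᶜ, disjoint_compl_right,
    union_compl_self _⟩ with hχ'
  refine ⟨χ', ⟨?_, fun p hp => ⟨hagree p hp, ?_⟩⟩, ?_⟩
  · rw [boundary_eq, boundary_eq]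
    refine frontier_eq_of_agree hχ.1 ?_ fun p hp => ?_
    · rw [← white_eq]
      exact hχ.2.1
    · rw [← boundary_eq] at hp
      exact hagree p hp
  · rw [white_eq χ]
    exact (hagree p hp).not
  · rintro ⟨A, B, C, ⟨hAB, hBC, hCA⟩, hmono⟩
    have hsame : (c (ν B) ↔ c (ν A)) ∧ (c (ν C) ↔ c (ν A)) := by
      rcases hmono with hm | hm
      · have hA : c (ν A) := hm (by simp)
        have hB : c (ν B) := hm (by simp)
        have hC : c (ν C) := hm (by simp)
        tauto
      · have hA : ¬ c (ν A) := hm (show A ∈ ({A, B, C} : Set Plane) by simp)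
        have hB : ¬ c (ν B) := hm (show B ∈ ({A, B, C} : Set Plane) by simp)
        have hC : ¬ c (ν C) := hm (show C ∈ ({A, B, C} : Set Plane) by simp)
        tauto
    have hB := iff_even_sub halt _ _ hsame.1
    have hC := iff_even_sub halt _ _ hsame.2
    rw [dist_comm, ← φ.dist_map, dist_eq_norm] at hAB hBC
    rw [← φ.dist_map, dist_eq_norm] at hCA
    rcases eq_rot_mul_or hAB hCA (by rwa [sub_sub_sub_cancel_right]) with h1 | h1
    · refine (hν A).not_even_triangle hf hs hAB (m := ν B) (n := ν C) ?_ ?_ hB hC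
      · rw [add_sub_cancel]; exact hν B
      · rw [← h1, add_sub_cancel]; exact hν C
    · refine (hν A).not_even_triangle hf hs hCA (m := ν C) (n := ν B) ?_ ?_ hC hB
      · rw [add_sub_cancel]; exact hν C
      · rw [← h1, add_sub_cancel]; exact hν B

lemma boundary_of_twin {χ χ' : PlaneColoring} (ht : χ'.IsTwin χ) (ha : χ'.AvoidsUnitTriangle)
    {A B C : Plane} (hT : IsUnitTriangle A B C) (hm : χ.Monochromatic {A, B, C}) :
    A ∈ χ.boundary ∨ B ∈ χ.boundary ∨ C ∈ χ.boundary := by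
  by_contra! hne
  obtain ⟨hA, hB, hC⟩ := hne
  refine ha ⟨A, B, C, hT, ?_⟩
  rcases hm with hm | hm
  · left
    rintro p (rfl | rfl | rfl)
    exacts [(ht.2 _ hA).1.2 (hm (by simp)), (ht.2 _ hB).1.2 (hm (by simp)),
      (ht.2 _ hC).1.2 (hm (by simp))]
  · right
    rintro p (rfl | rfl | rfl)
    exacts [(ht.2 _ hA).2.2 (hm (by simp)), (ht.2 _ hB).2.2 (hm (by simp)),
      (ht.2 _ hC).2.2 (hm (by simp))]

end TwoColoring

theorem theorem3 (χ : PlaneColoring) (hχ : χ.IsPolygonal) :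
    List.TFAE [
      χ.IsZebraLike,
      ∃ χ' : PlaneColoring, χ'.IsTwin χ ∧ χ'.AvoidsUnitTriangle,
      ∀ A B C : Plane, IsUnitTriangle A B C → χ.Monochromatic {A, B, C} →
        A ∈ χ.boundary ∨ B ∈ χ.boundary ∨ C ∈ χ.boundary] := by
  tfae_have 1 → 2 := fun h => TwoColoring.exists_twin hχ h
  tfae_have 2 → 3 := fun ⟨_, ht, ha⟩ _ _ _ hT hm => TwoColoring.boundary_of_twin ht ha hT hm
  tfae_have 3 → 1 := fun h => TwoColoring.isZebraLike_of_triangles hχ h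
  tfae_finish
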